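/- **Setting.** Let $d=p=1$, $\Theta=[\theta_{inf},\theta_{sup}]$, $\theta_{inf}<\theta_0<\theta_{sup}$, and let $K_\theta:\mathbb R\to\mathbb R$, $\theta\in\Theta$, be stationary covariance functions. The observation points are $i+\epsilon X_i$, $i\ge 1$, with $\epsilon\in[0,\tfrac12)$ and $X_i$ i.i.d. uniform on $[-1,1]$. *Condition 1.* $\theta\mapsto K_\theta(t)$ is three times differentiable on $\Theta$; for $q\in\{0,\dots,3\}$ there is $C_q<\infty$ with $|\partial_\theta^q K_\theta(t)|\le C_q/(1+|t|^2)$ for all $\theta\in\Theta$, $t\in\mathbb R$; the Fourier transform $\hat K_\theta(w)=\frac1{2\pi}\int K_\theta(t)e^{-\mathrm i wt}dt$ is positive and continuous in $(w,\theta)\in\mathbb R\times\Theta$, and $K_\theta(t)=\int \hat K_\theta(w)e^{\mathrm i wt}dw$. *Condition 2.* The sequences (indexed by $i\in\mathbb Z$) $K_{\theta_0}(i)$, $\partial_\theta K_{\theta_0}(i)$, $\partial_tK_{\theta_0}(i)\mathbf 1_{i\ne0}$, $\partial_t\partial_\theta K_{\theta_0}(i)\mathbf 1_{i\ne0}$,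 $\partial_t^2K_{\theta_0}(i)\mathbf 1_{i\ne0}$, $\partial_t^2\partial_\theta K_{\theta_0}(i)\mathbf 1_{i\ne0}$ exist and are bounded in absolute value by $Ce^{-a|i|}$ for some $C<\infty$, $a>0$. *Condition 3.* For every $\theta\in\Theta$, $K_\theta(t)$ and $\partial_\theta K_\theta(t)$ are three times differentiable in $t\ne0$, and for all $T>0$, $\theta\in\Theta$ and $k\in\{1,2,3\}$ there is $C<\infty$ with $|\partial_t^kK_\theta(t)|\le C/(1+|t|^2)$ and $|\partial_t^k\partial_\theta K_\theta(t)|\le C/(1+|t|^2)$ for $|t|\ge T$. For a sequence $(s_n)_{n\in\mathbb Z}$ put $\hat s(x)=\sum_{n\in\mathbb Z}s_ne^{\mathrm i nx}$. Let $f,\ f_\theta,\ \mathrm i f_t,\ \mathrm i f_{t,\theta},\ f_{t,t},\ f_{t,t,\theta}$ be the transforms of the six sequences of Condition 2, in the order listed; the functions $f,\dots,f_{t,t,\theta}$ are real. Let $M(g)=\frac1{2\pi}\int_{-\pi}^{\pi}g(x)\,dx$. For $n\ge1$ let $R$ be the $n\times n$ matrix with entries $K_{\theta_0}(i-j+\epsilon(X_i-X_j))$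 and $S$ the one with entries $\partial_\theta K_{\theta_0}(i-j+\epsilon(X_i-X_j))$. For a matrix $A$ let $\operatorname{diag}(A)$ be $A$ with its off-diagonal entries set to $0$; put $D=\operatorname{diag}(R^{-1})$, $Q=R^{-1}SR^{-1}$ and $$M_{ML}=\tfrac12R^{-1}SR^{-1}S,\qquad M_{CV,1}=2(G+G^t)R(G+G^t)R,\quad G=R^{-1}D^{-2}\{\operatorname{diag}(Q)D^{-1}-R^{-1}S\}R^{-1},$$ $$M_{CV,2}=-8D^{-3}\operatorname{diag}(Q)\,Q+2D^{-2}R^{-1}SR^{-1}SR^{-1}+6D^{-4}\operatorname{diag}(Q)^2R^{-1}.$$ $\Sigma_{ML}$, $\Sigma_{CV,1}$, $\Sigma_{CV,2}$ denote the (deterministic) almost sure limits, as $n\to\infty$, of $\frac1n\mathrm{Tr}(M_{ML})$, $\frac1n\mathrm{Tr}(M_{CV,1})$, $\frac1n\mathrm{Tr}(M_{CV,2})$; they depend on $\epsilon$. **Proposition.** Assume Conditions 1 and 2. For $\epsilon=0$ these limits exist and $$\Sigma_{ML}=\tfrac12M\!\left(\tfrac{f_\theta^2}{f^2}\right),$$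 $$\Sigma_{CV,1}=8M\!\left(\tfrac1f\right)^{-6}M\!\left(\tfrac{f_\theta}{f^2}\right)^2M\!\left(\tfrac1{f^2}\right)+8M\!\left(\tfrac1f\right)^{-4}M\!\left(\tfrac{f_\theta^2}{f^4}\right)-16M\!\left(\tfrac1f\right)^{-5}M\!\left(\tfrac{f_\theta}{f^2}\right)M\!\left(\tfrac{f_\theta}{f^3}\right),$$ $$\Sigma_{CV,2}=2M\!\left(\tfrac1f\right)^{-3}\left\{M\!\left(\tfrac{f_\theta^2}{f^3}\right)M\!\left(\tfrac1f\right)-M\!\left(\tfrac{f_\theta}{f^2}\right)^2\right\}.$$ If moreover Condition 3 holds, then $\Sigma_{ML}$ exists for every $\epsilon\in[0,\tfrac12)$, is differentiable in $\epsilon$ on $[0,\tfrac12)$ and twice differentiable (from the right) at $\epsilon=0$, and $$\begin{aligned}\left.\tfrac{\partial^2}{\partial\epsilon^2}\Sigma_{ML}\right|_{\epsilon=0}={}&\tfrac23M\!\left(\tfrac{f_\theta}{f^2}\right)M\!\left(\tfrac{f_t^2f_\theta}{f^2}\right)-\tfrac43M\!\left(\tfrac1f\right)M\!\left(\tfrac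{f_{t,\theta}f_tf_\theta}{f^2}\right)-\tfrac43M\!\left(\tfrac{f_\theta}{f^2}\right)M\!\left(\tfrac{f_{t,\theta}f_t}{f}\right)\\&+\tfrac23M\!\left(\tfrac1f\right)M\!\left(\tfrac{f_t^2f_\theta^2}{f^3}\right)+\tfrac23M\!\left(\tfrac{f_\theta^2}{f^3}\right)M\!\left(\tfrac{f_t^2}{f}\right)-\tfrac23M\!\left(\tfrac{f_{t,t}f_\theta^2}{f^3}\right)\\&+\tfrac23M\!\left(\tfrac1f\right)M\!\left(\tfrac{f_{t,\theta}^2}{f}\right)+\tfrac23M\!\left(\tfrac{f_{t,t,\theta}f_\theta}{f^2}\right).\end{aligned}$$ -/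

import Mathlib

open MeasureTheory ProbabilityTheory Set Filter Topology

noncomputable section

/-- The real function `k` is the covariance function `Cov (Y s, Y t) = k (s - t)` of a stationary
(real, second-order) process on the line: it is even and positive semidefinite. -/
def IsStationaryCovariance (k : ℝ → ℝ) : Prop :=
  (∀ t, k (-t) = k t) ∧
    ∀ (m : ℕ) (t c : Fin m → ℝ), 0 ≤ ∑ i, ∑ j, c i * c j * k (t i - t j)

/-- The Fourier transform `(1 / 2π) ∫ h(t) exp(-i w t) dt` of a real function on the line. -/
def contFourier (h : ℝ → ℝ) (w : ℝ) : ℂ :=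
  (1 / (2 * (Real.pi : ℂ))) * ∫ t : ℝ, (h t : ℂ) * Complex.exp (-(Complex.I * (w : ℂ) * (t : ℂ)))

/-- The derivative `∂K_θ(t)/∂θ` with respect to the parameter `θ ∈ [θinf, θsup]`
(one-sided at the two end points, the usual derivative inside). -/
def dTheta (θinf θsup : ℝ) (K : ℝ → ℝ → ℝ) (θ t : ℝ) : ℝ :=
  derivWithin (fun s => K s t) (Icc θinf θsup) θ

/-- The condition on the parametric model `K_θ`, `θ ∈ [θinf, θsup]`, for `d = 1` and `p = 1`. -/
structure CovarianceModel (θinf θsup : ℝ) (K : ℝ → ℝ → ℝ) : Prop where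
  stationary : ∀ θ ∈ Icc θinf θsup, IsStationaryCovariance (K θ)
  /-- `K_θ(t)` is three times differentiable with respect to `θ`. -/
  differentiable : ∀ t : ℝ, ∀ q < 3,
    DifferentiableOn ℝ (iteratedDerivWithin q (fun θ => K θ t) (Icc θinf θsup)) (Icc θinf θsup)
  bound : ∀ q ≤ 3, ∃ C : ℝ, ∀ θ ∈ Icc θinf θsup, ∀ t : ℝ,
    |iteratedDerivWithin q (fun s => K s t) (Icc θinf θsup) θ| ≤ C / (1 + |t| ^ 2)
  integrable : ∀ θ ∈ Icc θinf θsup, Integrable (K θ)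
  integrable_fourier : ∀ θ ∈ Icc θinf θsup, Integrable (contFourier (K θ))
  inversion : ∀ θ ∈ Icc θinf θsup, ∀ t : ℝ,
    (K θ t : ℂ) = ∫ w : ℝ, contFourier (K θ) w * Complex.exp (Complex.I * (w : ℂ) * (t : ℂ))
  /-- The Fourier transform is real valued and positive. -/
  fourier_pos : ∀ θ ∈ Icc θinf θsup, ∀ w : ℝ,
    (contFourier (K θ) w).im = 0 ∧ 0 < (contFourier (K θ) w).re
  fourier_continuous :
    ContinuousOn (fun z : ℝ × ℝ => contFourier (K z.2) z.1) (univ ×ˢ Icc θinf θsup)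

/-- The condition on the derivatives with respect to `t` under which the asymptotic variances are
twice differentiable in the regularity parameter, for `d = 1` and `p = 1`. -/
structure SpatiallySmooth (θinf θsup : ℝ) (K : ℝ → ℝ → ℝ) : Prop where
  /-- `K_θ` and `∂K_θ/∂θ` are three times differentiable in `t ≠ 0`. -/
  differentiable : ∀ θ ∈ Icc θinf θsup, ∀ q < 3, ∀ t : ℝ, t ≠ 0 →
    DifferentiableAt ℝ (iteratedDeriv q (K θ)) t ∧
      DifferentiableAt ℝ (iteratedDeriv q (dTheta θinf θsup K θ)) t
  bound : ∀ T > (0 : ℝ), ∀ θ ∈ Icc θinf θsup, ∀ k : ℕ, 1 ≤ k → k ≤ 3 →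
    ∃ C : ℝ, ∀ t : ℝ, T ≤ |t| →
      |iteratedDeriv k (K θ) t| ≤ C / (1 + |t| ^ 2) ∧
        |iteratedDeriv k (dTheta θinf θsup K θ) t| ≤ C / (1 + |t| ^ 2)

/-- The sequence `k(i)`, `i ∈ ℤ`. -/
def latticeSeq (k : ℝ → ℝ) (i : ℤ) : ℝ := k i

/-- The sequence `k^{(q)}(i) 1_{i ≠ 0}`, `i ∈ ℤ`, where `k^{(q)}` is the `q`-th derivative. -/
def latticeDerivSeq (q : ℕ) (k : ℝ → ℝ) (i : ℤ) : ℝ :=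
  if i = 0 then 0 else iteratedDeriv q k i

/-- `k` is twice differentiable at every nonzero integer (so that the sequences
`latticeDerivSeq 1 k` and `latticeDerivSeq 2 k` consist of genuine derivatives). -/
def TwiceDifferentiableOnLattice (k : ℝ → ℝ) : Prop :=
  ∀ i : ℤ, i ≠ 0 →
    (∀ᶠ t in 𝓝 (i : ℝ), DifferentiableAt ℝ k t) ∧ DifferentiableAt ℝ (deriv k) (i : ℝ)

/-- The six lattice sequences built from `K_{θ₀}` exist and decay exponentially. -/
structure ExponentialDecay (θinf θsup : ℝ) (K : ℝ → ℝ → ℝ) (θ₀ : ℝ) : Prop where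
  differentiable : TwiceDifferentiableOnLattice (K θ₀)
  differentiable_dTheta : TwiceDifferentiableOnLattice (dTheta θinf θsup K θ₀)
  bound : ∃ C a : ℝ, 0 < a ∧ ∀ i : ℤ,
    |latticeSeq (K θ₀) i| ≤ C * Real.exp (-a * |(i : ℝ)|) ∧
    |latticeSeq (dTheta θinf θsup K θ₀) i| ≤ C * Real.exp (-a * |(i : ℝ)|) ∧
    |latticeDerivSeq 1 (K θ₀) i| ≤ C * Real.exp (-a * |(i : ℝ)|) ∧
    |latticeDerivSeq 1 (dTheta θinf θsup K θ₀) i| ≤ C * Real.exp (-a * |(i : ℝ)|) ∧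
    |latticeDerivSeq 2 (K θ₀) i| ≤ C * Real.exp (-a * |(i : ℝ)|) ∧
    |latticeDerivSeq 2 (dTheta θinf θsup K θ₀) i| ≤ C * Real.exp (-a * |(i : ℝ)|)

/-- The Fourier transform `∑ₙ sₙ exp(i n x)` of a sequence indexed by `ℤ`. -/
def seqFourier (s : ℤ → ℝ) (x : ℝ) : ℂ :=
  ∑' n : ℤ, (s n : ℂ) * Complex.exp (Complex.I * (n : ℂ) * (x : ℂ))

/-! For an even sequence `s` the transform is the real function `(seqFourier s x).re`; for an odd
sequence it is `i` times the real function `(seqFourier s x).im`. The sequences of the values and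
of the second derivatives in `t` are even, those of the first derivatives in `t` are odd. -/

/-- `f`: the transform of `K_{θ₀}(i)`. -/
def specF (K : ℝ → ℝ → ℝ) (θ₀ x : ℝ) : ℝ := (seqFourier (latticeSeq (K θ₀)) x).re

/-- `f_θ`: the transform of `∂_θ K_{θ₀}(i)`. -/
def specFθ (θinf θsup : ℝ) (K : ℝ → ℝ → ℝ) (θ₀ x : ℝ) : ℝ :=
  (seqFourier (latticeSeq (dTheta θinf θsup K θ₀)) x).re

/-- `f_t`: the transform of `∂_t K_{θ₀}(i) 1_{i ≠ 0}` is `i f_t`. -/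
def specFt (K : ℝ → ℝ → ℝ) (θ₀ x : ℝ) : ℝ := (seqFourier (latticeDerivSeq 1 (K θ₀)) x).im

/-- `f_{t,θ}`: the transform of `∂_t ∂_θ K_{θ₀}(i) 1_{i ≠ 0}` is `i f_{t,θ}`. -/
def specFtθ (θinf θsup : ℝ) (K : ℝ → ℝ → ℝ) (θ₀ x : ℝ) : ℝ :=
  (seqFourier (latticeDerivSeq 1 (dTheta θinf θsup K θ₀)) x).im

/-- `f_{t,t}`: the transform of `∂_t² K_{θ₀}(i) 1_{i ≠ 0}`. -/
def specFtt (K : ℝ → ℝ → ℝ) (θ₀ x : ℝ) : ℝ := (seqFourier (latticeDerivSeq 2 (K θ₀)) x).re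

/-- `f_{t,t,θ}`: the transform of `∂_t² ∂_θ K_{θ₀}(i) 1_{i ≠ 0}`. -/
def specFttθ (θinf θsup : ℝ) (K : ℝ → ℝ → ℝ) (θ₀ x : ℝ) : ℝ :=
  (seqFourier (latticeDerivSeq 2 (dTheta θinf θsup K θ₀)) x).re

/-- The mean value over `[-π, π]`. -/
def meanVal (g : ℝ → ℝ) : ℝ := (1 / (2 * Real.pi)) * ∫ x in (-Real.pi)..Real.pi, g x

/-- The observation points `i + ε xᵢ`, `i = 1, 2, …`; the index starts at `0` here, so that the
entry of index `i` belongs to the grid point `i + 1`. -/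
def obsPoint (ε : ℝ) (x : ℕ → ℝ) (i : ℕ) : ℝ := ((i : ℝ) + 1) + ε * x i

/-- The `n × n` matrix with entries `k(s_i - s_j)`, `s` the observation points. With `k = K_{θ₀}`
it is `R`, and with `k = ∂_θ K_{θ₀}` it is `∂R/∂θ`. -/
def gridMatrix (k : ℝ → ℝ) (ε : ℝ) (x : ℕ → ℝ) (n : ℕ) : Matrix (Fin n) (Fin n) ℝ :=
  Matrix.of fun i j => k (obsPoint ε x i - obsPoint ε x j)

/-- `diag A`: the matrix `A` with its off-diagonal entries set to `0`. -/
def diagPart {n : ℕ} (A : Matrix (Fin n) (Fin n) ℝ) : Matrix (Fin n) (Fin n) ℝ :=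
  Matrix.diagonal A.diag

/-- `M_ML = (1/2) R⁻¹ (∂R) R⁻¹ (∂R)`; here and below `R` is the covariance matrix and
`S = ∂R/∂θ`, both at `θ₀`. -/
def matML {n : ℕ} (R S : Matrix (Fin n) (Fin n) ℝ) : Matrix (Fin n) (Fin n) ℝ :=
  (1 / 2 : ℝ) • (R⁻¹ * S * R⁻¹ * S)

/-- The matrix of the gradient `(2 / n) yᵗ M y` of the cross validation criterion. -/
def matCVGrad {n : ℕ} (R S : Matrix (Fin n) (Fin n) ℝ) : Matrix (Fin n) (Fin n) ℝ :=
  R⁻¹ * (diagPart R⁻¹)⁻¹ ^ 2 *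
    (diagPart (R⁻¹ * S * R⁻¹) * (diagPart R⁻¹)⁻¹ - R⁻¹ * S) * R⁻¹

/-- `M_{CV,1} = 2 (M + Mᵗ) R (M + Mᵗ) R`. -/
def matCV1 {n : ℕ} (R S : Matrix (Fin n) (Fin n) ℝ) : Matrix (Fin n) (Fin n) ℝ :=
  (2 : ℝ) • ((matCVGrad R S + (matCVGrad R S).transpose) * R *
    (matCVGrad R S + (matCVGrad R S).transpose) * R)

/-- `M_{CV,2}`. -/
def matCV2 {n : ℕ} (R S : Matrix (Fin n) (Fin n) ℝ) : Matrix (Fin n) (Fin n) ℝ :=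
  (-8 : ℝ) • ((diagPart R⁻¹)⁻¹ ^ 3 * diagPart (R⁻¹ * S * R⁻¹) * R⁻¹ * S * R⁻¹) +
  (2 : ℝ) • ((diagPart R⁻¹)⁻¹ ^ 2 * R⁻¹ * S * R⁻¹ * S * R⁻¹) +
  (6 : ℝ) • ((diagPart R⁻¹)⁻¹ ^ 4 * diagPart (R⁻¹ * S * R⁻¹) * diagPart (R⁻¹ * S * R⁻¹) * R⁻¹)

/-- The number `σ` is the almost sure limit, as `n → ∞`, of `(1 / n) Tr (N R S)`, where
`R = R_{θ₀}` and `S = ∂R_{θ₀}/∂θ` are the `n × n` matrices of the grid perturbed by `ε X`.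
With `N` equal to `matML`, `matCV1`, `matCV2` this says that `σ` is `Σ_ML`, `Σ_{CV,1}`, `Σ_{CV,2}`
at the regularity parameter `ε`. -/
def IsTraceLimit {Ω : Type*} [MeasurableSpace Ω] (P : Measure Ω) (X : ℕ → Ω → ℝ)
    (θinf θsup : ℝ) (K : ℝ → ℝ → ℝ) (θ₀ : ℝ)
    (N : ∀ {n : ℕ}, Matrix (Fin n) (Fin n) ℝ → Matrix (Fin n) (Fin n) ℝ →
      Matrix (Fin n) (Fin n) ℝ) (ε σ : ℝ) : Prop :=
  ∀ᵐ ω ∂P, Tendsto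
    (fun n : ℕ => (1 / (n : ℝ)) *
      (N (gridMatrix (K θ₀) ε (fun i => X i ω) n)
        (gridMatrix (dTheta θinf θsup K θ₀) ε (fun i => X i ω) n)).trace)
    atTop (𝓝 σ)

end

/-! Three mechanisms carry the proof: a symbol calculus for the regular grid, almost additivity for
the existence of the limits, and a calculus of uniform first order jets for the derivatives in `ε`.

Underlying all of them is a lower bound of the covariance matrices, uniform in the dimension and in
the perturbation (`exists_coercive`). On a window `[0, T]` the Fourier transform of the covariance
is at least `m > 0`, hence dominates `m` times a triangle function. At separated points the matrix
of the transformed triangle is `T / 2` times the identity plus entries of order `1 / (T s ^ 2)`,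
negligible for large `T` by Schur's test. Since `ε ≤ b < 1 / 2` keeps the points separated, `R⁻¹` is
bounded uniformly.

At `ε = 0` the matrices are Toeplitz. A Toeplitz matrix with summable coefficients is close, in
normalised Frobenius norm, to the circulant matrix with the same Fourier symbol
(`hasSymbol_toeplitz`). This relation survives sums, products, transposes, inverses with bounded
norm, and passage to the diagonal part, whose symbol is the constant mean value. Normalised traces
converge to the mean of the symbol, so the three variances at `ε = 0` reduce to algebra with
functions; coercivity makes the spectral density positive.

For `ε > 0` the functional `Tr (R⁻¹ S R⁻¹ S)` is Lipschitz in the entrywise `ℓ¹` norm. Cutting the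
grid in two therefore changes it by at most the total interaction across the cut, which is `o(m)` in
the length `m` of the last piece, whatever the length of the first piece
(`GridBounds.abs_mlTrace_cut_le`). Comparison with blocks of length `m` and the strong law of large
numbers give a deterministic limit (`exists_ae_tendsto_of_almost_additive`).

For the derivatives, a `FirstJet` is a function with a candidate derivative, bounds on both and a
quadratic remainder. Such bounds, uniform in `n` and in the perturbation, pass through matrix
algebra, traces, expectations and pointwise limits. Two jets in succession thus show that `Σ_ML` is
differentiable, with a second derivative at `0` equal to the limit of the normalised expected second
derivatives (`exists_firstJet_of_isTraceLimit`). At the regular grid the first derivative of a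
matrix is its commutator with `diag X`; the second moments of the uniform law leave only diagonal
parts, and oddness of the first derivative sequences kills those with imaginary symbol. The
remaining products of means form the stated expression (`SymbolPair.exists_tendsto_expectation`). -/

namespace SpatialSampling

set_option linter.unusedSectionVars false

/-! ### Operator norm, Frobenius norm and coercive matrices -/

section LinearAlgebra

open scoped Matrix.Norms.L2Operator Matrix

variable {𝕜 : Type*} [RCLike 𝕜] {ι : Type*} [Fintype ι] [DecidableEq ι]

lemma sum_norm_sq_mulVec_le (A : Matrix ι ι 𝕜) (v : ι → 𝕜) :
    ∑ i, ‖(A *ᵥ v) i‖ ^ 2 ≤ ‖A‖ ^ 2 * ∑ i, ‖v i‖ ^ 2 := by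
  have h := A.l2_opNorm_mulVec (WithLp.toLp 2 v)
  have h2 := pow_le_pow_left₀ (norm_nonneg _) h 2
  rw [mul_pow, EuclideanSpace.norm_sq_eq, EuclideanSpace.norm_sq_eq] at h2
  simpa using h2

lemma opNorm_le_of_sum_norm_sq_le {A : Matrix ι ι 𝕜} {C : ℝ} (hC : 0 ≤ C)
    (h : ∀ v : ι → 𝕜, ∑ i, ‖(A *ᵥ v) i‖ ^ 2 ≤ C ^ 2 * ∑ i, ‖v i‖ ^ 2) : ‖A‖ ≤ C := by
  rw [Matrix.cstar_norm_def]
  refine ContinuousLinearMap.opNorm_le_bound _ hC fun x => ?_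
  refine (sq_le_sq₀ (norm_nonneg _) (by positivity)).mp ?_
  rw [mul_pow, EuclideanSpace.norm_sq_eq, EuclideanSpace.norm_sq_eq]
  simpa using h x.ofLp

lemma norm_entry_le (A : Matrix ι ι 𝕜) (i j : ι) : ‖A i j‖ ≤ ‖A‖ := by
  have h := sum_norm_sq_mulVec_le A (Pi.single j 1)
  have h1 : ∑ k, ‖(Pi.single j 1 : ι → 𝕜) k‖ ^ 2 = 1 := by
    rw [Finset.sum_eq_single j] <;> simp +contextual
  rw [h1, mul_one] at h
  have h2 : ‖A i j‖ ^ 2 ≤ ∑ k, ‖(A *ᵥ Pi.single j 1) k‖ ^ 2 := by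
    have := Finset.single_le_sum (f := fun k => ‖(A *ᵥ Pi.single j (1 : 𝕜)) k‖ ^ 2)
      (fun k _ => by positivity) (Finset.mem_univ i)
    simpa using this
  exact (sq_le_sq₀ (norm_nonneg _) (norm_nonneg _)).mp (h2.trans h)

/-- Schur's test. -/
lemma opNorm_le_of_row_col_sum_le {A : Matrix ι ι 𝕜} {W : ℝ} (hW : 0 ≤ W)
    (hr : ∀ i, ∑ j, ‖A i j‖ ≤ W) (hc : ∀ j, ∑ i, ‖A i j‖ ≤ W) : ‖A‖ ≤ W := by
  refine opNorm_le_of_sum_norm_sq_le hW fun v => ?_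
  have key : ∀ i, ‖(A *ᵥ v) i‖ ^ 2 ≤ W * ∑ j, ‖A i j‖ * ‖v j‖ ^ 2 := by
    intro i
    have h1 : ‖(A *ᵥ v) i‖ ≤ ∑ j, ‖A i j‖ * ‖v j‖ := by
      simp only [Matrix.mulVec, dotProduct]
      exact (norm_sum_le _ _).trans (le_of_eq (by simp))
    have h2 : (∑ j, ‖A i j‖ * ‖v j‖) ^ 2 ≤ (∑ j, ‖A i j‖) * ∑ j, ‖A i j‖ * ‖v j‖ ^ 2 := by
      refine Finset.sum_sq_le_sum_mul_sum_of_sq_le_mul _ (fun _ _ => by positivity)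
        (fun _ _ => by positivity) (fun _ _ => le_of_eq (by ring))
    refine (pow_le_pow_left₀ (norm_nonneg _) h1 2).trans (h2.trans ?_)
    exact mul_le_mul_of_nonneg_right (hr i) (Finset.sum_nonneg fun _ _ => by positivity)
  refine (Finset.sum_le_sum fun i _ => key i).trans ?_
  rw [← Finset.mul_sum, Finset.sum_comm, sq, mul_assoc]
  refine mul_le_mul_of_nonneg_left ?_ hW
  rw [Finset.mul_sum]
  refine Finset.sum_le_sum fun j _ => ?_
  rw [← Finset.sum_mul]
  exact mul_le_mul_of_nonneg_right (hc j) (by positivity)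

/-- The square of the Frobenius norm. -/
noncomputable def hs (A : Matrix ι ι 𝕜) : ℝ := ∑ i, ∑ j, ‖A i j‖ ^ 2

lemma hs_nonneg (A : Matrix ι ι 𝕜) : 0 ≤ hs A :=
  Finset.sum_nonneg fun _ _ => Finset.sum_nonneg fun _ _ => by positivity

lemma hs_conjTranspose (A : Matrix ι ι 𝕜) : hs Aᴴ = hs A := by
  unfold hs
  rw [Finset.sum_comm]
  simp [Matrix.conjTranspose_apply]

/-- The operator norm bound is applied to each column of `B`. -/
lemma hs_mul_le_left (A B : Matrix ι ι 𝕜) : hs (A * B) ≤ ‖A‖ ^ 2 * hs B := by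
  unfold hs
  rw [Finset.sum_comm, Finset.sum_comm (f := fun i j => ‖B i j‖ ^ 2), Finset.mul_sum]
  refine Finset.sum_le_sum fun j _ => ?_
  have := sum_norm_sq_mulVec_le A (fun k => B k j)
  simpa [Matrix.mul_apply, Matrix.mulVec, dotProduct] using this

lemma hs_mul_le_right (A B : Matrix ι ι 𝕜) : hs (A * B) ≤ hs A * ‖B‖ ^ 2 := by
  rw [← hs_conjTranspose, Matrix.conjTranspose_mul]
  refine (hs_mul_le_left _ _).trans (le_of_eq ?_)
  rw [hs_conjTranspose, Matrix.l2_opNorm_conjTranspose, mul_comm]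

lemma hs_add_le (A B : Matrix ι ι 𝕜) : hs (A + B) ≤ 2 * hs A + 2 * hs B := by
  unfold hs
  simp only [Finset.mul_sum, ← Finset.sum_add_distrib]
  refine Finset.sum_le_sum fun i _ => Finset.sum_le_sum fun j _ => ?_
  have h := pow_le_pow_left₀ (norm_nonneg _) (norm_add_le (A i j) (B i j)) 2
  simp only [Matrix.add_apply]
  nlinarith [sq_nonneg (‖A i j‖ - ‖B i j‖)]

lemma hs_smul (c : 𝕜) (A : Matrix ι ι 𝕜) : hs (c • A) = ‖c‖ ^ 2 * hs A := by
  simp [hs, Finset.mul_sum, mul_pow]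

lemma hs_diagonal_diag_le (A : Matrix ι ι 𝕜) : hs (Matrix.diagonal A.diag) ≤ hs A := by
  refine Finset.sum_le_sum fun i _ => Finset.sum_le_sum fun j _ => ?_
  rw [Matrix.diagonal_apply]
  split_ifs with h
  · subst h; simp
  · simp

lemma norm_trace_sq_le (A : Matrix ι ι 𝕜) : ‖A.trace‖ ^ 2 ≤ Fintype.card ι * hs A := by
  have h1 : ‖A.trace‖ ≤ ∑ i, ‖A i i‖ := norm_sum_le _ _
  have h2 : (∑ i, ‖A i i‖) ^ 2 ≤ Fintype.card ι * ∑ i, ‖A i i‖ ^ 2 := by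
    simpa using sq_sum_le_card_mul_sum_sq (s := Finset.univ) (f := fun i => ‖A i i‖)
  refine (pow_le_pow_left₀ (norm_nonneg _) h1 2).trans (h2.trans ?_)
  refine mul_le_mul_of_nonneg_left ?_ (by positivity)
  refine Finset.sum_le_sum fun i _ => ?_
  exact Finset.single_le_sum (f := fun j => ‖A i j‖ ^ 2) (fun j _ => by positivity)
    (Finset.mem_univ i)

lemma norm_trace_le (A : Matrix ι ι 𝕜) : ‖A.trace‖ ≤ Fintype.card ι * ‖A‖ := by
  refine (norm_sum_le _ _).trans ?_
  refine (Finset.sum_le_sum fun i _ => norm_entry_le A i i).trans (le_of_eq ?_)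
  simp

/-- Entries are bounded by the operator norm. Only the entrywise `ℓ¹` norm of `B` enters, so a
sparse or decaying perturbation costs its total mass and no dimension factor. -/
lemma norm_trace_mul_le (A B : Matrix ι ι 𝕜) :
    ‖(A * B).trace‖ ≤ ‖A‖ * ∑ i, ∑ j, ‖B i j‖ := by
  rw [Matrix.trace_mul_comm]
  simp only [Matrix.trace, Matrix.diag, Matrix.mul_apply, Finset.mul_sum]
  refine (norm_sum_le _ _).trans (Finset.sum_le_sum fun i _ => (norm_sum_le _ _).trans
    (Finset.sum_le_sum fun j _ => ?_))
  rw [norm_mul, mul_comm]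
  exact mul_le_mul_of_nonneg_right (norm_entry_le _ _ _) (norm_nonneg _)

lemma norm_diagonal_diag_le (A : Matrix ι ι 𝕜) : ‖(Matrix.diagonal A.diag : Matrix ι ι 𝕜)‖ ≤ ‖A‖ := by
  rw [Matrix.l2_opNorm_diagonal]
  exact (pi_norm_le_iff_of_nonneg (norm_nonneg _)).mpr fun i => norm_entry_le A i i

/-- The quadratic form of `A` is bounded below by `δ` times the square of the norm. -/
def Coercive (δ : ℝ) (A : Matrix ι ι ℝ) : Prop :=
  ∀ v : ι → ℝ, δ * ∑ i, v i ^ 2 ≤ v ⬝ᵥ A *ᵥ v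

/-- Cauchy–Schwarz on the quadratic form, then division by the squared norm of `v`; symmetry of `A`
plays no role. -/
lemma Coercive.sum_sq_mulVec_ge {δ : ℝ} (hδ : 0 < δ) {A : Matrix ι ι ℝ} (h : Coercive δ A)
    (v : ι → ℝ) : δ ^ 2 * ∑ i, v i ^ 2 ≤ ∑ i, (A *ᵥ v) i ^ 2 := by
  have h1 : (v ⬝ᵥ A *ᵥ v) ^ 2 ≤ (∑ i, v i ^ 2) * ∑ i, (A *ᵥ v) i ^ 2 :=
    Finset.sum_mul_sq_le_sq_mul_sq _ _ _
  have h0 : 0 ≤ ∑ i, v i ^ 2 := Finset.sum_nonneg fun _ _ => sq_nonneg _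
  rcases h0.eq_or_lt with h0 | h0
  · rw [← h0, mul_zero]; exact Finset.sum_nonneg fun _ _ => sq_nonneg _
  have h2 := pow_le_pow_left₀ (by positivity) (h v) 2
  have h3 := h2.trans h1
  rw [mul_pow, sq (∑ i, v i ^ 2)] at h3
  nlinarith

lemma Coercive.isUnit_det {δ : ℝ} (hδ : 0 < δ) {A : Matrix ι ι ℝ} (h : Coercive δ A) :
    IsUnit A.det := by
  rw [isUnit_iff_ne_zero]
  intro h0
  obtain ⟨v, hv, hAv⟩ := Matrix.exists_mulVec_eq_zero_iff.mpr h0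
  have := h.sum_sq_mulVec_ge hδ v
  simp only [hAv, Pi.zero_apply, ne_eq, OfNat.ofNat_ne_zero, not_false_eq_true, zero_pow,
    Finset.sum_const_zero] at this
  have h2 : ∑ i, v i ^ 2 ≤ 0 := by
    by_contra hc
    push Not at hc
    have : 0 < δ ^ 2 * ∑ i, v i ^ 2 := by positivity
    linarith
  apply hv
  funext i
  have h3 := (Finset.sum_eq_zero_iff_of_nonneg (fun i _ => sq_nonneg (v i))).mp
    (le_antisymm h2 (Finset.sum_nonneg fun _ _ => sq_nonneg _)) i (Finset.mem_univ i)
  simpa using h3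

lemma Coercive.norm_inv_le {δ : ℝ} (hδ : 0 < δ) {A : Matrix ι ι ℝ} (h : Coercive δ A) :
    ‖A⁻¹‖ ≤ δ⁻¹ := by
  refine opNorm_le_of_sum_norm_sq_le (by positivity) fun v => ?_
  have h1 := h.sum_sq_mulVec_ge hδ (A⁻¹ *ᵥ v)
  rw [Matrix.mulVec_mulVec, Matrix.mul_nonsing_inv _ (h.isUnit_det hδ), Matrix.one_mulVec] at h1
  simp only [Real.norm_eq_abs, sq_abs]
  rw [inv_pow, ← div_eq_inv_mul, le_div_iff₀ (by positivity)]
  linarith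

/-- For `v = A⁻¹ eᵢ` the quadratic form equals the entry `v i`, while `A v = eᵢ` forces `v` to have
norm at least `1 / C`. This keeps the inverse of the diagonal part of `R⁻¹` bounded in the cross
validation matrices. -/
lemma Coercive.inv_diag_ge {δ C : ℝ} (hδ : 0 < δ) {A : Matrix ι ι ℝ} (h : Coercive δ A)
    (hC : 0 < C) (hA : ‖A‖ ≤ C) (i : ι) : δ / C ^ 2 ≤ A⁻¹ i i := by
  set v := A⁻¹ *ᵥ Pi.single i 1 with hv
  have h1 : A *ᵥ v = Pi.single i 1 := by
    rw [hv, Matrix.mulVec_mulVec, Matrix.mul_nonsing_inv _ (h.isUnit_det hδ), Matrix.one_mulVec]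
  have h2 := h v
  rw [h1, dotProduct_single_one] at h2
  have h3 := sum_norm_sq_mulVec_le A v
  rw [h1] at h3
  have h4 : ∑ k, ‖(Pi.single i 1 : ι → ℝ) k‖ ^ 2 = 1 := by
    rw [Finset.sum_eq_single i] <;> simp +contextual
  rw [h4] at h3
  simp only [Real.norm_eq_abs, sq_abs] at h3
  have h5 : v i = A⁻¹ i i := by rw [hv]; simp
  have h0 : 0 ≤ ∑ i, v i ^ 2 := Finset.sum_nonneg fun _ _ => sq_nonneg _
  have h6 : ‖A‖ ^ 2 ≤ C ^ 2 := pow_le_pow_left₀ (norm_nonneg _) hA 2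
  rw [← h5, div_le_iff₀ (by positivity)]
  have h7 : 1 ≤ C ^ 2 * ∑ i, v i ^ 2 := h3.trans (mul_le_mul_of_nonneg_right h6 h0)
  calc δ = δ * 1 := (mul_one _).symm
    _ ≤ δ * (C ^ 2 * ∑ i, v i ^ 2) := by gcongr
    _ = (δ * ∑ i, v i ^ 2) * C ^ 2 := by ring
    _ ≤ _ := by gcongr

/-- A real matrix acts separately on the real and the imaginary parts of a complex vector. -/
lemma norm_map_ofReal_le (A : Matrix ι ι ℝ) : ‖A.map Complex.ofReal‖ ≤ ‖A‖ := by
  refine opNorm_le_of_sum_norm_sq_le (norm_nonneg _) fun v => ?_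
  have h1 := sum_norm_sq_mulVec_le A (fun i => (v i).re)
  have h2 := sum_norm_sq_mulVec_le A (fun i => (v i).im)
  have hv : ∀ i, ‖v i‖ ^ 2 = (v i).re ^ 2 + (v i).im ^ 2 := fun i => by
    rw [Complex.sq_norm, Complex.normSq_apply]; ring
  have hA : ∀ i, ‖(A.map Complex.ofReal *ᵥ v) i‖ ^ 2 =
      ((A *ᵥ fun i => (v i).re) i) ^ 2 + ((A *ᵥ fun i => (v i).im) i) ^ 2 := fun i => by
    rw [Complex.sq_norm, Complex.normSq_apply]
    simp [Matrix.mulVec, dotProduct, sq]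
  simp only [hA, hv, Finset.sum_add_distrib, mul_add]
  simp only [Real.norm_eq_abs, sq_abs] at h1 h2
  linarith

lemma coercive_smul_one_add {d : ℝ} {N : Matrix ι ι ℝ} {c : ℝ} (hN : ‖N‖ ≤ c) :
    Coercive (d - c) (d • (1 : Matrix ι ι ℝ) + N) := by
  intro v
  have h0 : 0 ≤ ∑ i, v i ^ 2 := Finset.sum_nonneg fun _ _ => sq_nonneg _
  have hc : 0 ≤ c := (norm_nonneg _).trans hN
  have h1 : (v ⬝ᵥ N *ᵥ v) ^ 2 ≤ (∑ i, v i ^ 2) * ∑ i, (N *ᵥ v) i ^ 2 :=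
    Finset.sum_mul_sq_le_sq_mul_sq _ _ _
  have h2 := sum_norm_sq_mulVec_le N v
  simp only [Real.norm_eq_abs, sq_abs] at h2
  have h3 : ‖N‖ ^ 2 ≤ c ^ 2 := pow_le_pow_left₀ (norm_nonneg _) hN 2
  have h4 : (v ⬝ᵥ N *ᵥ v) ^ 2 ≤ (c * ∑ i, v i ^ 2) ^ 2 := by
    refine h1.trans ?_
    calc _ ≤ (∑ i, v i ^ 2) * (c ^ 2 * ∑ i, v i ^ 2) := by
          refine mul_le_mul_of_nonneg_left (h2.trans ?_) h0
          exact mul_le_mul_of_nonneg_right h3 h0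
      _ = _ := by ring
  have h5 := abs_le.mp (abs_le_of_sq_le_sq h4 (by positivity))
  have h6 : v ⬝ᵥ (d • (1 : Matrix ι ι ℝ) + N) *ᵥ v = d * ∑ i, v i ^ 2 + v ⬝ᵥ N *ᵥ v := by
    rw [Matrix.add_mulVec, dotProduct_add, Matrix.smul_mulVec, Matrix.one_mulVec, dotProduct_smul]
    simp [dotProduct, sq]
  rw [h6]
  linarith [h5.1]

end LinearAlgebra

/-! ### Schur's test for entries bounded by a function of the lag -/

section LagSums

lemma sum_fin_sub_le_tsum {w : ℤ → ℝ} (h0 : ∀ k, 0 ≤ w k) (hw : Summable w) {n : ℕ} (i : ℤ) :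
    ∑ j : Fin n, w (i - (j : ℤ)) ≤ ∑' k, w k := by
  rw [← tsum_fintype (L := SummationFilter.unconditional _) (fun j : Fin n => w (i - (j : ℤ)))]
  refine tsum_comp_le_tsum_of_inj hw h0 (i := fun j : Fin n => i - (j : ℤ)) fun a b h => ?_
  simp only [sub_right_inj, Nat.cast_inj] at h
  exact Fin.ext h

lemma sum_fin_sub_le_tsum' {w : ℤ → ℝ} (h0 : ∀ k, 0 ≤ w k) (hw : Summable w) {n : ℕ} (j : ℤ) :
    ∑ i : Fin n, w ((i : ℤ) - j) ≤ ∑' k, w k := by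
  rw [← tsum_fintype (L := SummationFilter.unconditional _) (fun i : Fin n => w ((i : ℤ) - j))]
  refine tsum_comp_le_tsum_of_inj hw h0 (i := fun i : Fin n => (i : ℤ) - j) fun a b h => ?_
  simp only [sub_left_inj, Nat.cast_inj] at h
  exact Fin.ext h

open scoped Matrix.Norms.L2Operator in
lemma opNorm_le_of_lag_bound {𝕜 : Type*} [RCLike 𝕜] {w : ℤ → ℝ} (h0 : ∀ k, 0 ≤ w k)
    (hw : Summable w) {n : ℕ} {A : Matrix (Fin n) (Fin n) 𝕜}
    (hA : ∀ i j : Fin n, ‖A i j‖ ≤ w ((i : ℤ) - (j : ℤ))) : ‖A‖ ≤ ∑' k, w k :=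
  opNorm_le_of_row_col_sum_le (tsum_nonneg h0)
    (fun i => (Finset.sum_le_sum fun j _ => hA i j).trans (sum_fin_sub_le_tsum h0 hw _))
    (fun j => (Finset.sum_le_sum fun i _ => hA i j).trans (sum_fin_sub_le_tsum' h0 hw _))

end LagSums

/-! ### Uniform lower bound of covariance matrices at separated points -/

section Coercivity

open scoped Matrix

/-- The Fejér kernel. The triangle is used because its transform decays like `1 / s ^ 2`, which is
summable over separated points; the transform of an indicator decays only like `1 / s`. -/
lemma integral_triangle_mul_cos {T s : ℝ} (hT : 0 < T) (hs : s ≠ 0) :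
    ∫ w in (0 : ℝ)..T, (1 - w / T) * Real.cos (w * s) = (1 - Real.cos (T * s)) / (T * s ^ 2) := by
  have h : ∀ w ∈ uIcc 0 T, HasDerivAt
      (fun w => (1 - w / T) * (Real.sin (w * s) / s) - Real.cos (w * s) / (T * s ^ 2))
      ((1 - w / T) * Real.cos (w * s)) w := by
    intro w _
    have h1 : HasDerivAt (fun w : ℝ => w * s) s w := by simpa using (hasDerivAt_id w).mul_const s
    have h2 : HasDerivAt (fun w : ℝ => 1 - w / T) (-(1 / T)) w := by
      simpa using ((hasDerivAt_id w).div_const T).const_sub 1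
    have h3 := (h2.mul (h1.sin.div_const s)).sub (h1.cos.div_const (T * s ^ 2))
    refine h3.congr_deriv ?_
    field_simp
    ring
  rw [intervalIntegral.integral_eq_sub_of_hasDerivAt h
    (Continuous.intervalIntegrable (by fun_prop) _ _)]
  simp only [div_self hT.ne', sub_self, zero_mul, Real.cos_zero, Real.sin_zero, zero_div]
  ring

lemma integral_triangle {T : ℝ} (hT : 0 < T) : ∫ w in (0 : ℝ)..T, (1 - w / T) = T / 2 := by
  rw [intervalIntegral.integral_sub (by simp) (Continuous.intervalIntegrable (by fun_prop) _ _),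
    intervalIntegral.integral_div]
  simp
  field_simp
  norm_num

lemma abs_integral_triangle_mul_cos_le {T s : ℝ} (hT : 0 < T) (hs : s ≠ 0) :
    |∫ w in (0 : ℝ)..T, (1 - w / T) * Real.cos (w * s)| ≤ 2 / (T * s ^ 2) := by
  rw [integral_triangle_mul_cos hT hs, abs_div, abs_of_pos (a := T * s ^ 2) (by positivity)]
  gcongr
  rw [abs_le]
  constructor <;> linarith [Real.neg_one_le_cos (T * s), Real.cos_le_one (T * s)]

/-- The matrix of the triangle function at separated points is coercive when the triangle is
wide. -/
lemma exists_coercive_triangle {τ : ℝ} (hτ : 0 < τ) : ∃ T : ℝ, 0 < T ∧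
    ∀ (n : ℕ) (s : Fin n → ℝ), (∀ i j : Fin n, τ * |((i : ℤ) - (j : ℤ) : ℤ)| ≤ |s i - s j|) →
      Coercive (T / 4) (Matrix.of fun i j : Fin n =>
        ∫ w in (0 : ℝ)..T, (1 - w / T) * Real.cos (w * (s i - s j))) := by
  have hsum : Summable fun k : ℤ => 1 / (k : ℝ) ^ 2 := Real.summable_one_div_int_pow.mpr (by norm_num)
  set Z := ∑' k : ℤ, 1 / (k : ℝ) ^ 2 with hZ
  have hZ0 : 0 ≤ Z := tsum_nonneg fun k => by positivity
  -- The off-diagonal part has norm at most `2 * Z / (T * τ ^ 2)`, which has to be at most `T / 4`.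
  -- This amounts to `8 * Z ≤ T ^ 2 * τ ^ 2`, true because `8 * Z = (T - 1) * τ ^ 2`.
  refine ⟨1 + 8 * Z / τ ^ 2, by positivity, fun n s hs => ?_⟩
  set T := 1 + 8 * Z / τ ^ 2 with hT
  have hT1 : 1 ≤ T := by rw [hT]; linarith [show 0 ≤ 8 * Z / τ ^ 2 by positivity]
  have hT0 : 0 < T := by linarith
  set k : Matrix (Fin n) (Fin n) ℝ := Matrix.of fun i j : Fin n =>
        ∫ w in (0 : ℝ)..T, (1 - w / T) * Real.cos (w * (s i - s j)) with hk
  set c := 2 / (T * τ ^ 2) with hc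
  have hN := opNorm_le_of_lag_bound (𝕜 := ℝ) (w := fun k : ℤ => c * (1 / (k : ℝ) ^ 2))
    (fun k => by positivity) (hsum.mul_left c) (A := k - (T / 2) • 1) (fun i j => by
      by_cases hij : i = j
      -- The diagonal has been subtracted, so the weight at lag zero may be the default value `1 / 0
      -- ^ 2 = 0`.
      · subst hij
        simp [hk, integral_triangle hT0]
      · have hij' : ((i : ℤ) - (j : ℤ) : ℤ) ≠ 0 := by
          rw [sub_ne_zero]; exact_mod_cast fun h => hij (Fin.ext h)
        have h1 : 0 < |(((i : ℤ) - (j : ℤ) : ℤ) : ℝ)| := by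
          rw [abs_pos]; exact_mod_cast hij'
        have h2 := hs i j
        have h2' : τ * |(((i : ℤ) - (j : ℤ) : ℤ) : ℝ)| ≤ |s i - s j| := by exact_mod_cast h2
        have h3 : s i - s j ≠ 0 := by
          rw [← abs_pos]; exact lt_of_lt_of_le (by positivity) h2'
        have h4 := abs_integral_triangle_mul_cos_le hT0 h3
        simp only [hk, Matrix.sub_apply, Matrix.of_apply, Matrix.smul_apply, Matrix.one_apply_ne hij,
          smul_zero, sub_zero, Real.norm_eq_abs]
        refine h4.trans ?_
        rw [hc, ← sq_abs (s i - s j), ← sq_abs (((i : ℤ) - (j : ℤ) : ℤ) : ℝ), div_mul_div_comm,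
          mul_one, mul_assoc, ← mul_pow]
        gcongr)
  rw [tsum_mul_left, ← hZ] at hN
  have h := coercive_smul_one_add (d := T / 2) hN
  rw [add_sub_cancel] at h
  intro v
  refine le_trans ?_ (h v)
  refine mul_le_mul_of_nonneg_right ?_ (Finset.sum_nonneg fun _ _ => sq_nonneg _)
  have : c * Z ≤ T / 4 := by
    rw [hc, div_mul_eq_mul_div, div_le_div_iff₀ (by positivity) (by norm_num)]
    have : 8 * Z = (T - 1) * τ ^ 2 := by rw [hT]; field_simp; ring
    nlinarith [mul_nonneg (mul_nonneg hT0.le (sub_nonneg.mpr hT1)) (sq_nonneg τ),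
      mul_pos hT0 (pow_pos hτ 2)]
  linarith

lemma sum_sum_mul_cos_eq {ι : Type*} [Fintype ι] (v s : ι → ℝ) (w : ℝ) :
    ∑ i, ∑ j, v i * v j * Real.cos (w * (s i - s j)) =
      (∑ i, v i * Real.cos (w * s i)) ^ 2 + (∑ i, v i * Real.sin (w * s i)) ^ 2 := by
  simp only [sq, Finset.sum_mul_sum, ← Finset.sum_add_distrib]
  refine Finset.sum_congr rfl fun i _ => Finset.sum_congr rfl fun j _ => ?_
  rw [mul_sub, Real.cos_sub]
  ring

variable {θinf θsup : ℝ} {K : ℝ → ℝ → ℝ} {θ : ℝ}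

lemma integrable_fourier_mul_cos (hK : CovarianceModel θinf θsup K)
    (hθ : θ ∈ Icc θinf θsup) (t : ℝ) :
    Integrable fun w => (contFourier (K θ) w).re * Real.cos (w * t) := by
  refine (hK.integrable_fourier θ hθ).re.mul_bdd (c := 1) (by fun_prop) ?_
  exact Eventually.of_forall fun w => by simpa using Real.abs_cos_le_one (w * t)

/-- Real part of the inversion formula: the transform is real, so only the cosine remains. -/
lemma eq_integral_fourier_mul_cos (hK : CovarianceModel θinf θsup K)
    (hθ : θ ∈ Icc θinf θsup) (t : ℝ) :
    K θ t = ∫ w, (contFourier (K θ) w).re * Real.cos (w * t) := by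
  have hint : Integrable fun w : ℝ =>
      contFourier (K θ) w * Complex.exp (Complex.I * (w : ℂ) * (t : ℂ)) := by
    refine (hK.integrable_fourier θ hθ).mul_bdd (c := 1) (by fun_prop) ?_
    refine Eventually.of_forall fun w => ?_
    rw [Complex.norm_exp]
    simp
  have h := congrArg Complex.re (hK.inversion θ hθ t)
  rw [Complex.ofReal_re] at h
  rw [h]
  refine (integral_re hint).symm.trans (integral_congr_ae (Eventually.of_forall fun w => ?_))
  have h0 := (hK.fourier_pos θ hθ w).1
  have h1 : Complex.I * (w : ℂ) * (t : ℂ) = ((w * t : ℝ) : ℂ) * Complex.I := by push_cast; ring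
  simp only [h1, RCLike.re_to_complex, Complex.mul_re, h0, zero_mul, sub_zero,
    Complex.exp_ofReal_mul_I_re]

/-- The covariance matrices of separated points are uniformly coercive. -/
lemma exists_coercive (hK : CovarianceModel θinf θsup K) (hθ : θ ∈ Icc θinf θsup)
    {τ : ℝ} (hτ : 0 < τ) : ∃ δ : ℝ, 0 < δ ∧
    ∀ (n : ℕ) (s : Fin n → ℝ), (∀ i j : Fin n, τ * |((i : ℤ) - (j : ℤ) : ℤ)| ≤ |s i - s j|) →
      Coercive δ (Matrix.of fun i j : Fin n => K θ (s i - s j)) := by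
  obtain ⟨T, hT, hcoer⟩ := exists_coercive_triangle hτ
  have hcont : ContinuousOn (fun w => (contFourier (K θ) w).re) (Icc 0 T) := by
    refine Complex.continuous_re.comp_continuousOn ?_
    exact hK.fourier_continuous.comp (f := fun w : ℝ => (w, θ))
      (by fun_prop) fun w _ => ⟨mem_univ _, hθ⟩
  -- On the window the density is at least its minimum `m`, hence at least `m * (1 - w / T)`.
  -- Outside the window it is dropped, because the trigonometric quadratic form is a sum of two
  -- squares.
  obtain ⟨w₀, -, hw₀⟩ := isCompact_Icc.exists_isMinOn (nonempty_Icc.mpr hT.le) hcont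
  set m := (contFourier (K θ) w₀).re with hm
  have hm0 : 0 < m := (hK.fourier_pos θ hθ w₀).2
  refine ⟨m * (T / 4), by positivity, fun n s hs v => ?_⟩
  have h1 := mul_le_mul_of_nonneg_left (hcoer n s hs v) hm0.le
  rw [← mul_assoc] at h1
  refine h1.trans ?_
  have hquad : ∀ B : Matrix (Fin n) (Fin n) ℝ, v ⬝ᵥ B *ᵥ v = ∑ i, ∑ j, v i * v j * B i j := by
    intro B
    simp only [dotProduct, Matrix.mulVec, Finset.mul_sum]
    exact Finset.sum_congr rfl fun i _ => Finset.sum_congr rfl fun j _ => by ring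
  rw [hquad, hquad]
  simp only [Matrix.of_apply]
  have hq0 : ∀ w, 0 ≤ ∑ i, ∑ j, v i * v j * Real.cos (w * (s i - s j)) := fun w => by
    rw [sum_sum_mul_cos_eq]; positivity
  have hL : m * ∑ i, ∑ j, v i * v j * ∫ w in (0 : ℝ)..T, (1 - w / T) * Real.cos (w * (s i - s j)) =
      ∫ w in (0 : ℝ)..T, m * (1 - w / T) * ∑ i, ∑ j, v i * v j * Real.cos (w * (s i - s j)) := by
    simp only [Finset.mul_sum]
    rw [intervalIntegral.integral_finsetSum
      fun i _ => Continuous.intervalIntegrable (by fun_prop) _ _]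
    refine Finset.sum_congr rfl fun i _ => ?_
    rw [intervalIntegral.integral_finsetSum
      fun i _ => Continuous.intervalIntegrable (by fun_prop) _ _]
    refine Finset.sum_congr rfl fun j _ => ?_
    rw [← intervalIntegral.integral_const_mul, ← intervalIntegral.integral_const_mul]
    congr 1; funext w; ring
  have hint : ∀ i j : Fin n, Integrable fun w : ℝ =>
      v i * v j * ((contFourier (K θ) w).re * Real.cos (w * (s i - s j))) :=
    fun i j => (integrable_fourier_mul_cos hK hθ _).const_mul _
  have hre : (fun w : ℝ => (contFourier (K θ) w).re *
        ∑ i, ∑ j, v i * v j * Real.cos (w * (s i - s j))) = fun w => ∑ i, ∑ j,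
      v i * v j * ((contFourier (K θ) w).re * Real.cos (w * (s i - s j))) := by
    funext w
    simp only [Finset.mul_sum]
    exact Finset.sum_congr rfl fun i _ => Finset.sum_congr rfl fun j _ => by ring
  have hR : ∑ i, ∑ j, v i * v j * K θ (s i - s j) = ∫ w, (contFourier (K θ) w).re *
        ∑ i, ∑ j, v i * v j * Real.cos (w * (s i - s j)) := by
    rw [hre, integral_finsetSum _ fun i _ => integrable_finsetSum _ fun j _ => hint i j]
    refine Finset.sum_congr rfl fun i _ => ?_
    rw [integral_finsetSum _ fun j _ => hint i j]
    refine Finset.sum_congr rfl fun j _ => ?_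
    rw [integral_const_mul, ← eq_integral_fourier_mul_cos hK hθ]
  have hRint : Integrable fun w : ℝ => (contFourier (K θ) w).re *
        ∑ i, ∑ j, v i * v j * Real.cos (w * (s i - s j)) := by
    rw [hre]
    exact integrable_finsetSum _ fun i _ => integrable_finsetSum _ fun j _ => hint i j
  rw [hL, hR, intervalIntegral.integral_of_le hT.le]
  refine le_trans (setIntegral_mono_on ?_ hRint.integrableOn measurableSet_Ioc fun w hw => ?_)
    (setIntegral_le_integral hRint (Eventually.of_forall fun w =>
      mul_nonneg (hK.fourier_pos θ hθ w).2.le (hq0 w)))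
  · exact (Continuous.integrableOn_Icc (by fun_prop)).mono_set Ioc_subset_Icc_self
  · refine mul_le_mul_of_nonneg_right ?_ (hq0 w)
    have h2 : m ≤ (contFourier (K θ) w).re := hw₀ ⟨hw.1.le, hw.2⟩
    have h3 : 0 ≤ w / T := div_nonneg hw.1.le hT.le
    nlinarith

end Coercivity

/-! ### Riemann sums over the Fourier nodes -/

section RiemannSums

lemma tendsto_riemann_sum_unit {b : ℝ → ℂ} (hb : Continuous b) :
    Tendsto (fun n : ℕ => (1 / (n : ℂ)) * ∑ l ∈ Finset.range n, b (l / n)) atTop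
      (𝓝 (∫ x in (0 : ℝ)..1, b x)) := by
  rw [Metric.tendsto_atTop]
  intro ε hε
  have huc := isCompact_Icc.uniformContinuousOn_of_continuous (s := Icc (0 : ℝ) 1) hb.continuousOn
  rw [Metric.uniformContinuousOn_iff] at huc
  obtain ⟨η, hη, hδ⟩ := huc (ε / 2) (by positivity)
  obtain ⟨N, hN⟩ := exists_nat_gt (1 / η)
  refine ⟨max N 1, fun n hn => ?_⟩
  have hn1 : 1 ≤ n := (le_max_right _ _).trans hn
  have hn0 : (0 : ℝ) < n := by exact_mod_cast hn1
  have hnη : 1 / (n : ℝ) < η := by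
    rw [div_lt_comm₀ hn0 hη]
    exact hN.trans_le (by exact_mod_cast (le_max_left _ _).trans hn)
  have hI : ∀ p q : ℝ, IntervalIntegrable b volume p q := fun p q => hb.intervalIntegrable p q
  have hsum := intervalIntegral.sum_integral_adjacent_intervals (μ := volume) (f := b)
    (a := fun l : ℕ => (l : ℝ) / n) (n := n) fun l _ => hI _ _
  simp only [Nat.cast_zero, zero_div, div_self hn0.ne'] at hsum
  rw [← hsum, Finset.mul_sum, dist_eq_norm, ← Finset.sum_sub_distrib]
  refine (norm_sum_le _ _).trans_lt ?_
  have key : ∀ l ∈ Finset.range n, ‖1 / (n : ℂ) * b (l / n) -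
      ∫ x in (l : ℝ) / n..((l + 1 : ℕ) : ℝ) / n, b x‖ ≤ ε / 2 * (1 / n) := by
    intro l hl
    have hl' : (l : ℝ) + 1 ≤ n := by exact_mod_cast Finset.mem_range.mp hl
    have hlen : ((l + 1 : ℕ) : ℝ) / n - (l : ℝ) / n = 1 / n := by push_cast; ring
    have hle : (l : ℝ) / n ≤ ((l + 1 : ℕ) : ℝ) / n := by
      have : 0 < 1 / (n : ℝ) := by positivity
      linarith
    have h1 : 1 / (n : ℂ) * b (l / n) = ∫ x in (l : ℝ) / n..((l + 1 : ℕ) : ℝ) / n, b (l / n) := by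
      rw [intervalIntegral.integral_const, hlen, Complex.real_smul]
      push_cast; ring
    rw [h1, ← intervalIntegral.integral_sub (by simp) (hI _ _)]
    refine (intervalIntegral.norm_integral_le_of_norm_le_const (C := ε / 2) fun x hx => ?_).trans
      (by rw [hlen, abs_of_pos (by positivity)])
    rw [uIoc_of_le hle] at hx
    have hup : ((l + 1 : ℕ) : ℝ) / n ≤ 1 := by
      rw [div_le_one hn0]; exact_mod_cast hl'
    have hlo : 0 ≤ (l : ℝ) / n := by positivity
    rw [← dist_eq_norm]
    refine (hδ _ ⟨hlo, hle.trans hup⟩ x ⟨hlo.trans hx.1.le, hx.2.trans hup⟩ ?_).le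
    rw [Real.dist_eq, abs_sub_comm, abs_of_pos (by linarith [hx.1])]
    linarith [hx.2]
  refine (Finset.sum_le_sum key).trans_lt ?_
  rw [Finset.sum_const, Finset.card_range, nsmul_eq_mul]
  field_simp
  linarith

/-- The mean value over `[0, 2π]` of a complex function. -/
noncomputable def circleMean (a : ℝ → ℂ) : ℂ :=
  1 / (2 * (Real.pi : ℂ)) * ∫ x in (0 : ℝ)..2 * Real.pi, a x

/-- The nodes `2πl/n`. -/
noncomputable def node (n : ℕ) (l : Fin n) : ℝ := 2 * Real.pi * ((l : ℝ) / n)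

lemma tendsto_riemann_sum {a : ℝ → ℂ} (ha : Continuous a) :
    Tendsto (fun n : ℕ => (1 / (n : ℂ)) * ∑ l : Fin n, a (node n l)) atTop (𝓝 (circleMean a)) := by
  have h := tendsto_riemann_sum_unit (b := fun x => a (2 * Real.pi * x)) (by fun_prop)
  have h2 : ∫ x in (0 : ℝ)..1, a (2 * Real.pi * x) = circleMean a := by
    rw [intervalIntegral.integral_comp_mul_left (fun x => a x) (by positivity)]
    rw [circleMean, Complex.real_smul]
    simp
  rw [h2] at h
  refine h.congr fun n => ?_
  simp only [node]
  rw [← Fin.sum_univ_eq_sum_range (fun l : ℕ => a (2 * Real.pi * ((l : ℝ) / n)))]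

end RiemannSums

/-! ### Circulant matrices and the symbol calculus -/

section Circulant

open scoped Matrix.Norms.L2Operator Matrix

/-- The discrete Fourier matrix. -/
noncomputable def dft (n : ℕ) : Matrix (Fin n) (Fin n) ℂ :=
  Matrix.of fun j l => ((1 / √(n : ℝ) : ℝ) : ℂ) *
    Complex.exp (-(Complex.I * ((j : ℕ) : ℂ) * (node n l : ℂ)))

/-- A full geometric sum of an `n`-th root of unity different from `1`. -/
lemma sum_exp_node_sub {n : ℕ} {l m : Fin n} (h : l ≠ m) :
    ∑ j : Fin n, Complex.exp (Complex.I * ((j : ℕ) : ℂ) * ((node n l - node n m : ℝ) : ℂ)) = 0 := by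
  have hn : (n : ℂ) ≠ 0 := by
    have : 0 < n := l.pos
    exact_mod_cast this.ne'
  set r := Complex.exp (Complex.I * ((node n l - node n m : ℝ) : ℂ)) with hr
  have h1 : ∀ j : ℕ, Complex.exp (Complex.I * (j : ℂ) * ((node n l - node n m : ℝ) : ℂ)) = r ^ j := by
    intro j
    rw [hr, ← Complex.exp_nat_mul]
    congr 1; ring
  simp only [h1]
  rw [Fin.sum_univ_eq_sum_range (fun j => r ^ j)]
  have hrn : r ^ n = 1 := by
    rw [hr, ← Complex.exp_nat_mul, Complex.exp_eq_one_iff]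
    refine ⟨(l : ℤ) - (m : ℤ), ?_⟩
    simp only [node]
    push_cast
    field_simp
  have hr1 : r ≠ 1 := by
    intro h0
    rw [hr, Complex.exp_eq_one_iff] at h0
    obtain ⟨k, hk⟩ := h0
    simp only [node] at hk
    push_cast at hk
    have h2 : (((l : ℕ) : ℂ) - ((m : ℕ) : ℂ)) = k * n := by
      have h3 : 2 * (Real.pi : ℂ) * Complex.I ≠ 0 := Complex.two_pi_I_ne_zero
      field_simp at hk
      linear_combination hk
    have h4 : ((l : ℕ) : ℤ) - ((m : ℕ) : ℤ) = k * n := by exact_mod_cast h2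
    have hl := l.isLt
    have hm := m.isLt
    have hk0 : k = 0 := by
      by_contra hk0
      rcases lt_or_gt_of_ne hk0 with h5 | h5
      · nlinarith
      · nlinarith
    rw [hk0, zero_mul] at h4
    exact h (Fin.ext (by omega))
  have := geom_sum_eq hr1 n
  rw [this, hrn, sub_self, zero_div]

lemma dft_conjTranspose_mul (n : ℕ) : (dft n)ᴴ * dft n = 1 := by
  ext l m
  have hn : (0 : ℝ) < n := by exact_mod_cast l.pos
  have hs : ((1 / √(n : ℝ) : ℝ) : ℂ) * ((1 / √(n : ℝ) : ℝ) : ℂ) = 1 / n := by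
    rw [← Complex.ofReal_mul, div_mul_div_comm, Real.mul_self_sqrt hn.le]
    push_cast; ring
  have hterm : ∀ j : Fin n, star (dft n j l) * dft n j m = 1 / n *
      Complex.exp (Complex.I * ((j : ℕ) : ℂ) * ((node n l - node n m : ℝ) : ℂ)) := by
    intro j
    simp only [dft, Matrix.of_apply, Complex.star_def, map_mul, Complex.conj_ofReal,
      ← Complex.exp_conj, map_neg, Complex.conj_I, map_natCast]
    rw [mul_mul_mul_comm, hs, ← Complex.exp_add]
    congr 2
    push_cast; ring
  simp only [Matrix.mul_apply, Matrix.conjTranspose_apply, hterm, ← Finset.mul_sum]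
  by_cases h : l = m
  · subst h
    have : (n : ℂ) ≠ 0 := by exact_mod_cast hn.ne'
    simp [this]
  · rw [sum_exp_node_sub h, Matrix.one_apply_ne h, mul_zero]

lemma dft_mul_conjTranspose (n : ℕ) : dft n * (dft n)ᴴ = 1 :=
  mul_eq_one_comm.mp (dft_conjTranspose_mul n)

lemma norm_dft_le (n : ℕ) : ‖dft n‖ ≤ 1 := by
  have h := Matrix.l2_opNorm_conjTranspose_mul_self (dft n)
  rw [dft_conjTranspose_mul, ← Matrix.diagonal_one, Matrix.l2_opNorm_diagonal] at h
  have h1 : ‖(fun _ => 1 : Fin n → ℂ)‖ ≤ 1 := (pi_norm_le_iff_of_nonneg zero_le_one).mpr (by simp)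
  rw [h] at h1
  nlinarith [norm_nonneg (dft n)]

/-- The `n × n` circulant matrix with symbol `a`. -/
noncomputable def circ (n : ℕ) (a : ℝ → ℂ) : Matrix (Fin n) (Fin n) ℂ :=
  dft n * Matrix.diagonal (fun l => a (node n l)) * (dft n)ᴴ

lemma circ_mul (n : ℕ) (a b : ℝ → ℂ) : circ n a * circ n b = circ n (fun x => a x * b x) := by
  calc circ n a * circ n b = dft n * Matrix.diagonal (fun l => a (node n l)) * ((dft n)ᴴ * dft n) *
        Matrix.diagonal (fun l => b (node n l)) * (dft n)ᴴ := by simp only [circ, Matrix.mul_assoc]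
    _ = _ := by
      rw [dft_conjTranspose_mul, mul_one, Matrix.mul_assoc (dft n), Matrix.diagonal_mul_diagonal, circ]

lemma circ_add (n : ℕ) (a b : ℝ → ℂ) : circ n a + circ n b = circ n (fun x => a x + b x) := by
  simp only [circ, ← Matrix.diagonal_add, Matrix.mul_add, Matrix.add_mul]

lemma circ_const (n : ℕ) (c : ℂ) : circ n (fun _ => c) = c • (1 : Matrix (Fin n) (Fin n) ℂ) := by
  rw [circ, ← Matrix.smul_one_eq_diagonal, Matrix.mul_smul, mul_one, Matrix.smul_mul,
    dft_mul_conjTranspose]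

lemma circ_conjTranspose (n : ℕ) (a : ℝ → ℂ) :
    (circ n a)ᴴ = circ n (fun x => (starRingEnd ℂ) (a x)) := by
  rw [circ, circ, Matrix.conjTranspose_mul, Matrix.conjTranspose_mul,
    Matrix.conjTranspose_conjTranspose, Matrix.diagonal_conjTranspose, Matrix.mul_assoc]
  rfl

/-- All entries of the Fourier matrix have modulus `1 / √n`, so the diagonal of a circulant is
constant and equal to a Riemann sum of the symbol. -/
lemma circ_diag (n : ℕ) (a : ℝ → ℂ) (j : Fin n) :
    circ n a j j = 1 / n * ∑ l : Fin n, a (node n l) := by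
  have hn : (0 : ℝ) < n := by exact_mod_cast j.pos
  have hs : ((1 / √(n : ℝ) : ℝ) : ℂ) * ((1 / √(n : ℝ) : ℝ) : ℂ) = 1 / n := by
    rw [← Complex.ofReal_mul, div_mul_div_comm, Real.mul_self_sqrt hn.le]
    push_cast; ring
  rw [circ, Matrix.mul_apply, Finset.mul_sum]
  refine Finset.sum_congr rfl fun l _ => ?_
  rw [Matrix.mul_diagonal, Matrix.conjTranspose_apply]
  simp only [dft, Matrix.of_apply, Complex.star_def, map_mul, Complex.conj_ofReal,
      ← Complex.exp_conj, map_neg, Complex.conj_I, map_natCast]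
  rw [mul_right_comm, mul_mul_mul_comm, hs, ← Complex.exp_add]
  simp

lemma trace_circ (n : ℕ) (a : ℝ → ℂ) : (circ n a).trace = ∑ l : Fin n, a (node n l) := by
  rw [circ, Matrix.trace_mul_comm, ← Matrix.mul_assoc, dft_conjTranspose_mul, one_mul,
    Matrix.trace_diagonal]

lemma exists_norm_circ_le {a : ℝ → ℂ} (ha : Continuous a) : ∃ C, ∀ n, ‖circ n a‖ ≤ C := by
  obtain ⟨C, hC⟩ := (isCompact_Icc (a := (0 : ℝ)) (b := 2 * Real.pi)).exists_bound_of_continuousOn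
    ha.continuousOn
  refine ⟨max C 0, fun n => ?_⟩
  have h1 : ‖(Matrix.diagonal (fun l => a (node n l)) : Matrix (Fin n) (Fin n) ℂ)‖ ≤ max C 0 := by
    rw [Matrix.l2_opNorm_diagonal]
    refine (pi_norm_le_iff_of_nonneg (le_max_right _ _)).mpr fun l => ?_
    refine (hC _ ⟨?_, ?_⟩).trans (le_max_left _ _)
    · unfold node; positivity
    · unfold node
      have : (l : ℝ) / n ≤ 1 := by
        rw [div_le_one (by exact_mod_cast l.pos)]
        exact_mod_cast l.isLt.le
      nlinarith [Real.pi_pos]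
  have h2 : ‖(dft n)ᴴ‖ ≤ 1 := by rw [Matrix.l2_opNorm_conjTranspose]; exact norm_dft_le n
  have h3 := norm_dft_le n
  calc ‖circ n a‖ ≤ ‖dft n‖ * ‖(Matrix.diagonal (fun l => a (node n l)) : Matrix (Fin n) (Fin n) ℂ)‖ *
        ‖(dft n)ᴴ‖ := (norm_mul_le _ _).trans (mul_le_mul_of_nonneg_right (norm_mul_le _ _) (norm_nonneg _))
    _ ≤ 1 * max C 0 * 1 := by gcongr
    _ = max C 0 := by ring

/-- The sequence of matrices `A n` is bounded and asymptotically equivalent, in normalised Frobenius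
norm, to the circulant matrices with symbol `a`. -/
structure HasSymbol (A : ∀ n, Matrix (Fin n) (Fin n) ℂ) (a : ℝ → ℂ) : Prop where
  continuous : Continuous a
  bounded : ∃ C, ∀ n, ‖A n‖ ≤ C
  tendsto : Tendsto (fun n : ℕ => hs (A n - circ n a) / n) atTop (𝓝 0)

namespace HasSymbol

variable {A B : ∀ n, Matrix (Fin n) (Fin n) ℂ} {a b : ℝ → ℂ}

lemma tendsto_of_le {E F : ∀ n, Matrix (Fin n) (Fin n) ℂ} {G : ∀ n, Matrix (Fin n) (Fin n) ℂ}
    {c d : ℝ} (hE : Tendsto (fun n : ℕ => hs (E n) / n) atTop (𝓝 0))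
    (hF : Tendsto (fun n : ℕ => hs (F n) / n) atTop (𝓝 0))
    (h : ∀ n, hs (G n) ≤ c * hs (E n) + d * hs (F n)) :
    Tendsto (fun n : ℕ => hs (G n) / n) atTop (𝓝 0) := by
  refine squeeze_zero (g := fun n : ℕ => c * (hs (E n) / n) + d * (hs (F n) / n))
    (fun n => div_nonneg (hs_nonneg _) (by positivity)) (fun n => ?_) ?_
  · rw [← mul_div_assoc, ← mul_div_assoc, ← add_div]
    exact div_le_div_of_nonneg_right (h n) (by positivity)
  · simpa using (hE.const_mul c).add (hF.const_mul d)

lemma congr (hA : HasSymbol A a) (h : ∀ x, a x = b x) : HasSymbol A b := by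
  rwa [← funext h]

lemma congr_left (hA : HasSymbol A a) (h : ∀ n, A n = B n) : HasSymbol B a := by
  rwa [← funext h]

lemma add (hA : HasSymbol A a) (hB : HasSymbol B b) :
    HasSymbol (fun n => A n + B n) (fun x => a x + b x) := by
  obtain ⟨C, hC⟩ := hA.bounded
  obtain ⟨D, hD⟩ := hB.bounded
  refine ⟨hA.continuous.add hB.continuous, ⟨C + D, fun n =>
    (norm_add_le _ _).trans (add_le_add (hC n) (hD n))⟩,
    tendsto_of_le (c := 2) (d := 2) hA.tendsto hB.tendsto fun n => ?_⟩
  rw [← circ_add, add_sub_add_comm]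
  exact hs_add_le _ _

/-- Write `A B - a b = (A - a) B + a (B - b)`: in each term one factor is bounded in operator norm
and the other is small in Frobenius norm. -/
lemma mul (hA : HasSymbol A a) (hB : HasSymbol B b) :
    HasSymbol (fun n => A n * B n) (fun x => a x * b x) := by
  obtain ⟨C, hC⟩ := hA.bounded
  obtain ⟨D, hD⟩ := hB.bounded
  obtain ⟨E, hE⟩ := exists_norm_circ_le hA.continuous
  refine ⟨hA.continuous.mul hB.continuous, ⟨C * D, fun n => (norm_mul_le _ _).trans
    (mul_le_mul (hC n) (hD n) (norm_nonneg _) ((norm_nonneg _).trans (hC n)))⟩,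
    tendsto_of_le (c := 2 * D ^ 2) (d := 2 * E ^ 2) hA.tendsto hB.tendsto fun n => ?_⟩
  have h : A n * B n - circ n (fun x => a x * b x) =
      (A n - circ n a) * B n + circ n a * (B n - circ n b) := by
    rw [← circ_mul]; noncomm_ring
  rw [h]
  refine (hs_add_le _ _).trans ?_
  have h1 := hs_mul_le_right (A n - circ n a) (B n)
  have h2 := hs_mul_le_left (circ n a) (B n - circ n b)
  have h3 : ‖B n‖ ^ 2 ≤ D ^ 2 := pow_le_pow_left₀ (norm_nonneg _) (hD n) 2
  have h4 : ‖circ n a‖ ^ 2 ≤ E ^ 2 := pow_le_pow_left₀ (norm_nonneg _) (hE n) 2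
  nlinarith [mul_le_mul_of_nonneg_left h3 (hs_nonneg (A n - circ n a)),
    mul_le_mul_of_nonneg_right h4 (hs_nonneg (B n - circ n b))]

lemma const (c : ℂ) : HasSymbol (fun n => c • (1 : Matrix (Fin n) (Fin n) ℂ)) (fun _ => c) := by
  refine ⟨continuous_const, ?_, ?_⟩
  · obtain ⟨C, hC⟩ := exists_norm_circ_le (continuous_const (y := c))
    exact ⟨C, fun n => by rw [← circ_const]; exact hC n⟩
  · simp [circ_const, hs]

lemma smul (c : ℂ) (hA : HasSymbol A a) : HasSymbol (fun n => c • A n) (fun x => c * a x) :=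
  ((const c).mul hA).congr_left fun n => by simp

lemma conjTranspose (hA : HasSymbol A a) :
    HasSymbol (fun n => (A n)ᴴ) (fun x => (starRingEnd ℂ) (a x)) := by
  obtain ⟨C, hC⟩ := hA.bounded
  refine ⟨Complex.continuous_conj.comp hA.continuous, ⟨C, fun n => by
    rw [Matrix.l2_opNorm_conjTranspose]; exact hC n⟩, ?_⟩
  simpa only [← circ_conjTranspose, ← Matrix.conjTranspose_sub, hs_conjTranspose] using hA.tendsto

/-- The resolvent identity expresses the error as `-B (A - circ a) circ a⁻¹`. Boundedness of the
inverses is a separate hypothesis, since closeness in normalised Frobenius norm does not exclude a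
few small singular values. -/
lemma inv (hA : HasSymbol A a) (ha : ∀ x, a x ≠ 0) (hB : ∃ C, ∀ n, ‖B n‖ ≤ C)
    (hBA : ∀ n, B n * A n = 1) : HasSymbol B (fun x => (a x)⁻¹) := by
  obtain ⟨D, hD⟩ := hB
  have hcont := hA.continuous.inv₀ ha
  obtain ⟨E, hE⟩ := exists_norm_circ_le hcont
  refine ⟨hcont, ⟨D, hD⟩, tendsto_of_le (c := D ^ 2 * E ^ 2) (d := 0) hA.tendsto hA.tendsto fun n => ?_⟩
  have h1 : circ n a * circ n (fun x => (a x)⁻¹) = 1 := by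
    rw [circ_mul]
    simp only [mul_inv_cancel₀ (ha _), circ_const, one_smul]
  have h : B n - circ n (fun x => (a x)⁻¹) =
      -(B n) * ((A n - circ n a) * circ n (fun x => (a x)⁻¹)) := by
    calc _ = B n * (circ n a * circ n (fun x => (a x)⁻¹)) - (B n * A n) * circ n (fun x => (a x)⁻¹) := by
          rw [h1, hBA, mul_one, one_mul]
      _ = _ := by noncomm_ring
  rw [h, zero_mul, add_zero]
  refine (hs_mul_le_left _ _).trans ?_
  rw [norm_neg]
  have h2 := hs_mul_le_right (A n - circ n a) (circ n (fun x => (a x)⁻¹))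
  have h3 : ‖B n‖ ^ 2 ≤ D ^ 2 := pow_le_pow_left₀ (norm_nonneg _) (hD n) 2
  have h4 : ‖circ n (fun x => (a x)⁻¹)‖ ^ 2 ≤ E ^ 2 := pow_le_pow_left₀ (norm_nonneg _) (hE n) 2
  calc _ ≤ D ^ 2 * (hs (A n - circ n a) * E ^ 2) := by
        refine mul_le_mul h3 (h2.trans ?_) (hs_nonneg _) (by positivity)
        exact mul_le_mul_of_nonneg_left h4 (hs_nonneg _)
    _ = _ := by ring

/-- Taking the diagonal part does not increase the Frobenius norm, and on the circulant model it
gives a Riemann sum times the identity, whence a constant symbol. -/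
lemma diagonal_diag (hA : HasSymbol A a) :
    HasSymbol (fun n => Matrix.diagonal (A n).diag) (fun _ => circleMean a) := by
  obtain ⟨C, hC⟩ := hA.bounded
  have hm := tendsto_riemann_sum hA.continuous
  set m : ℕ → ℂ := fun n => (1 / (n : ℂ)) * ∑ l : Fin n, a (node n l) with hm'
  refine ⟨continuous_const, ⟨C, fun n => (norm_diagonal_diag_le _).trans (hC n)⟩,
    tendsto_of_le (c := 2) (d := 2) (F := fun n => (m n - circleMean a) • 1) hA.tendsto ?_ fun n => ?_⟩
  · refine squeeze_zero (g := fun n : ℕ => ‖m n - circleMean a‖ ^ 2)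
      (fun n => div_nonneg (hs_nonneg _) (by positivity)) (fun n => ?_) ?_
    · rw [hs_smul]
      have : hs (1 : Matrix (Fin n) (Fin n) ℂ) = n := by
        simp [hs, Matrix.one_apply, apply_ite]
      rw [this, mul_div_assoc]
      refine mul_le_of_le_one_right (by positivity) (div_self_le_one _)
    · have := (hm.sub_const (circleMean a)).norm.pow 2
      simpa using this
  · have h : (Matrix.diagonal (A n).diag : Matrix (Fin n) (Fin n) ℂ) - circ n (fun _ => circleMean a) =
        Matrix.diagonal (A n - circ n a).diag + (m n - circleMean a) • 1 := by
      rw [circ_const]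
      ext i j
      by_cases hij : i = j
      · subst hij
        simp only [Matrix.sub_apply, Matrix.diagonal_apply_eq, Matrix.diag_apply, Matrix.smul_apply,
          Matrix.one_apply_eq, smul_eq_mul, mul_one, Matrix.add_apply, circ_diag, hm']
        ring
      · simp [hij]
    rw [h]
    refine (hs_add_le _ _).trans ?_
    gcongr
    exact hs_diagonal_diag_le _

/-- By Cauchy–Schwarz the squared trace of the error is at most `n` times its squared Frobenius
norm, so the normalised trace of the error vanishes; the trace of the circulant is a Riemann sum. -/
lemma tendsto_trace (hA : HasSymbol A a) :
    Tendsto (fun n : ℕ => (1 / (n : ℂ)) * (A n).trace) atTop (𝓝 (circleMean a)) := by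
  have hm := tendsto_riemann_sum hA.continuous
  have h : Tendsto (fun n : ℕ => (1 / (n : ℂ)) * (A n - circ n a).trace) atTop (𝓝 0) := by
    rw [tendsto_zero_iff_norm_tendsto_zero]
    have h2 : Tendsto (fun n : ℕ => √(hs (A n - circ n a) / n)) atTop (𝓝 0) := by
      simpa using hA.tendsto.sqrt
    refine squeeze_zero (fun n => norm_nonneg _) (fun n => ?_) h2
    refine Real.le_sqrt_of_sq_le ?_
    rw [norm_mul, mul_pow]
    have h3 := norm_trace_sq_le (A n - circ n a)
    rw [Fintype.card_fin] at h3
    rcases Nat.eq_zero_or_pos n with h0 | h0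
    · subst h0; simp
    have hn : (0 : ℝ) < n := by exact_mod_cast h0
    simp only [one_div, norm_inv, Complex.norm_natCast]
    calc _ ≤ ((n : ℝ)⁻¹) ^ 2 * (n * hs (A n - circ n a)) := by gcongr
      _ = _ := by field_simp
  have := h.add hm
  rw [zero_add] at this
  refine this.congr fun n => ?_
  rw [Matrix.trace_sub, trace_circ]
  ring

end HasSymbol

end Circulant

/-! ### Toeplitz matrices and their Fourier symbols -/

section Toeplitz

open scoped Matrix.Norms.L2Operator Matrix

/-- The mass of a sequence outside `[-N, N]`. -/
noncomputable def lagTail (w : ℤ → ℝ) (N : ℕ) : ℝ :=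
  ∑' k, w k - ∑ k ∈ Finset.Icc (-(N : ℤ)) N, w k

lemma lagTail_nonneg {w : ℤ → ℝ} (h0 : ∀ k, 0 ≤ w k) (hw : Summable w) (N : ℕ) :
    0 ≤ lagTail w N :=
  sub_nonneg.mpr (hw.sum_le_tsum _ fun k _ => h0 k)

lemma tendsto_lagTail {w : ℤ → ℝ} (hw : Summable w) : Tendsto (lagTail w) atTop (𝓝 0) := by
  have h := (hw.hasSum.comp (Finset.tendsto_Icc_neg (R := ℤ))).const_sub (∑' k, w k)
  rw [sub_self] at h
  exact h

/-- Row `j` of a Toeplitz matrix is at distance `j` from one edge and `n - 1 - j` from the other; on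
average over the rows both boundary effects disappear. -/
lemma tendsto_cesaro_add_reflect {u : ℕ → ℝ} (hu : Tendsto u atTop (𝓝 0)) :
    Tendsto (fun n : ℕ => (∑ j : Fin n, (u j + u (n - 1 - j))) / n) atTop (𝓝 0) := by
  have h := (hu.cesaro.const_mul 2)
  rw [mul_zero] at h
  refine h.congr fun n => ?_
  rw [Fin.sum_univ_eq_sum_range (fun j => u j + u (n - 1 - j)), Finset.sum_add_distrib,
    Finset.sum_range_reflect u n]
  ring

lemma norm_tsum_sub_sum_le {g : ℤ → ℂ} (hg : Summable fun k => ‖g k‖) (I : Finset ℤ) :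
    ‖∑' k, g k - ∑ k ∈ I, g k‖ ≤ ∑' k, ‖g k‖ - ∑ k ∈ I, ‖g k‖ := by
  have h1 := hg.of_norm.sum_add_tsum_compl (s := I)
  have h2 := hg.sum_add_tsum_compl (s := I)
  rw [← h1, ← h2, add_sub_cancel_left, add_sub_cancel_left]
  exact norm_tsum_le_tsum_norm (hg.comp_injective Subtype.coe_injective)

variable {s : ℤ → ℝ}

lemma norm_seqFourier_term (s : ℤ → ℝ) (x : ℝ) (k : ℤ) :
    ‖(s k : ℂ) * Complex.exp (Complex.I * (k : ℂ) * (x : ℂ))‖ = |s k| := by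
  rw [norm_mul, Complex.norm_exp]
  simp

lemma continuous_seqFourier (hs : Summable fun k => |s k|) : Continuous (seqFourier s) :=
  continuous_tsum (fun k => by fun_prop) hs fun k x => (norm_seqFourier_term s x k).le

/-- Truncating the Fourier series of `s` to the lags available in row `j`. -/
lemma norm_sum_sub_seqFourier_le (hs : Summable fun k => |s k|) {n : ℕ} (j : Fin n) (x : ℝ) :
    ‖∑ k : Fin n, (s ((j : ℤ) - (k : ℤ)) : ℂ) *
        Complex.exp (Complex.I * (((j : ℤ) - (k : ℤ) : ℤ) : ℂ) * (x : ℂ)) - seqFourier s x‖ ≤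
      lagTail (fun k => |s k|) j + lagTail (fun k => |s k|) (n - 1 - j) := by
  set g : ℤ → ℂ := fun k => (s k : ℂ) * Complex.exp (Complex.I * (k : ℂ) * (x : ℂ)) with hg
  set e : Fin n → ℤ := fun k => (j : ℤ) - (k : ℤ) with he
  have hinj : Function.Injective e := fun a b h => by
    simp only [he, sub_right_inj, Nat.cast_inj] at h
    exact Fin.ext h
  set I := Finset.univ.image e with hI
  have h1 : ∑ k : Fin n, g (e k) = ∑ k ∈ I, g k := by
    rw [hI, Finset.sum_image fun a _ b _ h => hinj h]
  have hgn : ∀ k, ‖g k‖ = |s k| := norm_seqFourier_term s x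
  have h2 : ‖∑' k, g k - ∑ k ∈ I, g k‖ ≤ ∑' k, |s k| - ∑ k ∈ I, |s k| := by
    simpa only [hgn] using norm_tsum_sub_sum_le (g := g) (by simpa only [hgn] using hs) I
  -- Row `j` contains the lags from `j - (n - 1)` to `j`, an interval that includes `[-N, N]` as
  -- soon as `N` is at most both edge distances.
  have hN : ∀ N : ℕ, N ≤ j → N ≤ n - 1 - j →
      ∑' k, |s k| - ∑ k ∈ I, |s k| ≤ lagTail (fun k => |s k|) N := by
    intro N hNj hNn
    refine sub_le_sub_left (Finset.sum_le_sum_of_subset_of_nonneg (fun k hk => ?_)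
      fun k _ _ => abs_nonneg _) _
    rw [Finset.mem_Icc] at hk
    have hj := j.isLt
    refine Finset.mem_image.mpr ⟨⟨((j : ℤ) - k).toNat, by omega⟩, Finset.mem_univ _, ?_⟩
    simp only [he]
    omega
  rw [norm_sub_rev]
  change ‖∑' k, g k - ∑ k : Fin n, g (e k)‖ ≤ _
  rw [h1]
  have t1 := lagTail_nonneg (fun k => abs_nonneg (s k)) hs j
  have t2 := lagTail_nonneg (fun k => abs_nonneg (s k)) hs (n - 1 - j)
  rcases le_total (j : ℕ) (n - 1 - j) with h | h
  · linarith [hN j le_rfl h]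
  · linarith [hN _ h le_rfl]

/-- The `n × n` Toeplitz matrix of the sequence `s`. -/
def toeplitz (n : ℕ) (s : ℤ → ℝ) : Matrix (Fin n) (Fin n) ℝ :=
  Matrix.of fun i j => s ((i : ℤ) - (j : ℤ))

/-- A real matrix, seen as a complex matrix. -/
def toComplex {n : ℕ} (A : Matrix (Fin n) (Fin n) ℝ) : Matrix (Fin n) (Fin n) ℂ :=
  A.map Complex.ofReal

/-- Each Fourier vector is an approximate eigenvector of the Toeplitz matrix; the error in row `j`
is the truncation error of the Fourier series there. -/
lemma toComplex_mul_dft_sub {n : ℕ} (s : ℤ → ℝ) (j l : Fin n) :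
    (toComplex (toeplitz n s) * dft n -
      dft n * Matrix.diagonal (fun l => seqFourier s (node n l))) j l =
    dft n j l * (∑ k : Fin n, (s ((j : ℤ) - (k : ℤ)) : ℂ) *
        Complex.exp (Complex.I * (((j : ℤ) - (k : ℤ) : ℤ) : ℂ) * (node n l : ℂ)) -
          seqFourier s (node n l)) := by
  rw [Matrix.sub_apply, Matrix.mul_diagonal, Matrix.mul_apply, mul_sub, Finset.mul_sum]
  congr 1
  refine Finset.sum_congr rfl fun k _ => ?_
  simp only [toComplex, toeplitz, dft, Matrix.map_apply, Matrix.of_apply]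
  have h : Complex.exp (-(Complex.I * ((k : ℕ) : ℂ) * (node n l : ℂ))) =
      Complex.exp (-(Complex.I * ((j : ℕ) : ℂ) * (node n l : ℂ))) *
      Complex.exp (Complex.I * (((j : ℤ) - (k : ℤ) : ℤ) : ℂ) * (node n l : ℂ)) := by
    rw [← Complex.exp_add]
    congr 1
    push_cast; ring
  rw [h]
  ring

lemma norm_dft_apply_sq {n : ℕ} (j l : Fin n) : ‖dft n j l‖ ^ 2 = 1 / n := by
  have hn : (0 : ℝ) < n := by exact_mod_cast j.pos
  simp only [dft, Matrix.of_apply, norm_mul, Complex.norm_real, Complex.norm_exp]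
  simp [Real.sq_sqrt hn.le]

/-- Toeplitz matrices of absolutely summable sequences have the Fourier transform of the sequence
as symbol. -/
lemma hasSymbol_toeplitz (hs' : Summable fun k => |s k|) :
    HasSymbol (fun n => toComplex (toeplitz n s)) (seqFourier s) := by
  refine ⟨continuous_seqFourier hs', ⟨∑' k, |s k|, fun n => ?_⟩, ?_⟩
  · exact opNorm_le_of_lag_bound (fun k => abs_nonneg _) hs' fun i j => by
      simp [toComplex, toeplitz]
  set t := lagTail fun k => |s k| with ht
  have ht0 : Tendsto (fun N => 2 * t N ^ 2) atTop (𝓝 0) := by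
    simpa using ((tendsto_lagTail hs').pow 2).const_mul 2
  refine squeeze_zero (fun n => div_nonneg (hs_nonneg _) (by positivity)) (fun n => ?_)
    (tendsto_cesaro_add_reflect ht0)
  refine div_le_div_of_nonneg_right ?_ (by positivity)
  set E := toComplex (toeplitz n s) * dft n -
      dft n * Matrix.diagonal (fun l => seqFourier s (node n l)) with hE
  -- The error measured on the Fourier basis is carried back by a unitary matrix, at no cost in
  -- Frobenius norm.
  have h1 : toComplex (toeplitz n s) - circ n (seqFourier s) = E * (dft n)ᴴ := by
    rw [hE, Matrix.sub_mul, Matrix.mul_assoc (toComplex _), dft_mul_conjTranspose, mul_one]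
    rfl
  rw [h1]
  have h2 : ‖(dft n)ᴴ‖ ^ 2 ≤ 1 := by
    rw [Matrix.l2_opNorm_conjTranspose]
    exact pow_le_one₀ (norm_nonneg _) (norm_dft_le n)
  refine (hs_mul_le_right _ _).trans ((mul_le_of_le_one_right (hs_nonneg _) h2).trans ?_)
  refine Finset.sum_le_sum fun j _ => ?_
  have h3 : ∀ l, ‖E j l‖ ^ 2 ≤ 1 / n * (2 * t j ^ 2 + 2 * t (n - 1 - j) ^ 2) := by
    intro l
    rw [hE, toComplex_mul_dft_sub, norm_mul, mul_pow, norm_dft_apply_sq]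
    refine mul_le_mul_of_nonneg_left ?_ (by positivity)
    refine (pow_le_pow_left₀ (norm_nonneg _) (norm_sum_sub_seqFourier_le hs' j _) 2).trans ?_
    nlinarith [sq_nonneg (t j - t (n - 1 - j))]
  refine (Finset.sum_le_sum fun l _ => h3 l).trans (le_of_eq ?_)
  have hn : (n : ℝ) ≠ 0 := by exact_mod_cast j.pos.ne'
  rw [Finset.sum_const, Finset.card_univ, Fintype.card_fin, nsmul_eq_mul]
  field_simp

/-- A uniform lower bound of the Toeplitz matrices is a lower bound of the spectral density. -/
lemma le_re_seqFourier_of_coercive (hs' : Summable fun k => |s k|) {δ : ℝ}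
    (h : ∀ n, Coercive δ (toeplitz n s)) (x : ℝ) : δ ≤ (seqFourier s x).re := by
  set t := lagTail fun k => |s k| with ht
  have h1 := tendsto_cesaro_add_reflect (tendsto_lagTail hs')
  have h2 := h1.add_const (seqFourier s x).re
  rw [zero_add] at h2
  refine ge_of_tendsto h2 ?_
  filter_upwards [eventually_ge_atTop 1] with n hn
  have hn0 : (0 : ℝ) < n := by exact_mod_cast hn
  -- Testing on the real and imaginary parts of the wave `exp (i x j)`: the squared norms add up to
  -- `n`, and the forms to row sums that approximate the spectral density.
  have hc := h n fun j => Real.cos (x * j)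
  have hsn := h n fun j => Real.sin (x * j)
  have hquad : ∀ v : Fin n → ℝ, v ⬝ᵥ toeplitz n s *ᵥ v =
      ∑ j, ∑ k, v j * v k * s ((j : ℤ) - (k : ℤ)) := by
    intro v
    simp only [dotProduct, Matrix.mulVec, Finset.mul_sum, toeplitz, Matrix.of_apply]
    exact Finset.sum_congr rfl fun i _ => Finset.sum_congr rfl fun j _ => by ring
  rw [hquad] at hc hsn
  have h3 : δ * n ≤ ∑ j : Fin n, (∑ k : Fin n, (s ((j : ℤ) - (k : ℤ)) : ℂ) *
        Complex.exp (Complex.I * (((j : ℤ) - (k : ℤ) : ℤ) : ℂ) * (x : ℂ))).re := by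
    have h4 := add_le_add hc hsn
    rw [← mul_add, ← Finset.sum_add_distrib, ← Finset.sum_add_distrib] at h4
    simp only [Real.cos_sq_add_sin_sq, Finset.sum_const, Finset.card_univ, Fintype.card_fin,
      nsmul_eq_mul, mul_one] at h4
    refine h4.trans (le_of_eq (Finset.sum_congr rfl fun j _ => ?_))
    rw [← Finset.sum_add_distrib, Complex.re_sum]
    refine Finset.sum_congr rfl fun k _ => ?_
    have h5 : Complex.I * (((j : ℤ) - (k : ℤ) : ℤ) : ℂ) * (x : ℂ) =
        ((x * j - x * k : ℝ) : ℂ) * Complex.I := by push_cast; ring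
    rw [h5, Complex.re_ofReal_mul, Complex.exp_ofReal_mul_I_re, Real.cos_sub]
    ring
  have h6 : ∀ j : Fin n, (∑ k : Fin n, (s ((j : ℤ) - (k : ℤ)) : ℂ) *
        Complex.exp (Complex.I * (((j : ℤ) - (k : ℤ) : ℤ) : ℂ) * (x : ℂ))).re ≤
        (t j + t (n - 1 - j)) + (seqFourier s x).re := by
    intro j
    have h7 := (Complex.re_le_norm _).trans (norm_sum_sub_seqFourier_le hs' j x)
    rw [Complex.sub_re] at h7
    linarith
  have h8 := h3.trans (Finset.sum_le_sum fun j _ => h6 j)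
  rw [Finset.sum_add_distrib, Finset.sum_const, Finset.card_univ, Fintype.card_fin, nsmul_eq_mul] at h8
  rw [div_add' _ _ _ hn0.ne', le_div_iff₀ hn0]
  linarith

lemma conj_seqFourier (s : ℤ → ℝ) (x : ℝ) :
    (starRingEnd ℂ) (seqFourier s x) = seqFourier s (-x) := by
  rw [seqFourier, seqFourier, ← RCLike.star_def, tsum_star]
  refine tsum_congr fun k => ?_
  simp only [RCLike.star_def, map_mul, Complex.conj_ofReal, ← Complex.exp_conj, Complex.conj_I,
    map_intCast, Complex.ofReal_neg]
  congr 2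
  ring

lemma seqFourier_neg_of_even (he : ∀ k, s (-k) = s k) (x : ℝ) :
    seqFourier s (-x) = seqFourier s x := by
  rw [seqFourier, ← (Equiv.neg ℤ).tsum_eq, seqFourier]
  refine tsum_congr fun k => ?_
  simp [he]

lemma seqFourier_neg_of_odd (ho : ∀ k, s (-k) = -s k) (x : ℝ) :
    seqFourier s (-x) = -seqFourier s x := by
  rw [seqFourier, ← (Equiv.neg ℤ).tsum_eq, seqFourier, ← tsum_neg]
  refine tsum_congr fun k => ?_
  simp [ho]

lemma seqFourier_eq_ofReal_of_even (he : ∀ k, s (-k) = s k) (x : ℝ) :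
    seqFourier s x = ((seqFourier s x).re : ℂ) := by
  have := conj_seqFourier s x
  rw [seqFourier_neg_of_even he] at this
  exact (Complex.conj_eq_iff_re.mp this).symm

lemma seqFourier_eq_I_mul_of_odd (ho : ∀ k, s (-k) = -s k) (x : ℝ) :
    seqFourier s x = Complex.I * ((seqFourier s x).im : ℂ) := by
  have h := conj_seqFourier s x
  rw [seqFourier_neg_of_odd ho] at h
  have h1 := congrArg Complex.re h
  simp only [Complex.conj_re, Complex.neg_re] at h1
  apply Complex.ext
  · simp; linarith
  · simp

lemma seqFourier_add_two_pi (s : ℤ → ℝ) (x : ℝ) :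
    seqFourier s (x + 2 * Real.pi) = seqFourier s x := by
  refine tsum_congr fun k => ?_
  congr 1
  rw [Complex.exp_eq_exp_iff_exists_int]
  exact ⟨k, by push_cast; ring⟩

/-- By periodicity the mean over `[0, 2π]`, natural for the nodes, is the mean over `[-π, π]`. -/
lemma circleMean_ofReal {g : ℝ → ℝ} (hg : Function.Periodic g (2 * Real.pi)) :
    circleMean (fun x => (g x : ℂ)) = (meanVal g : ℂ) := by
  have h := hg.intervalIntegral_add_eq 0 (-Real.pi)
  rw [zero_add, show -Real.pi + 2 * Real.pi = Real.pi by ring] at h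
  rw [circleMean, meanVal, intervalIntegral.integral_ofReal, h]
  push_cast
  rfl

lemma meanVal_eq_zero_of_odd {g : ℝ → ℝ} (hg : ∀ x, g (-x) = -g x) : meanVal g = 0 := by
  have h := intervalIntegral.integral_comp_neg (a := -Real.pi) (b := Real.pi) g
  simp only [hg, neg_neg, intervalIntegral.integral_neg] at h
  have : ∫ x in (-Real.pi)..Real.pi, g x = 0 := by linarith
  rw [meanVal, this, mul_zero]

end Toeplitz

/-! ### Real symbols and the three variances at the regular grid -/

section RealSymbols

open scoped Matrix.Norms.L2Operator Matrix

lemma toComplex_mul {n : ℕ} (A B : Matrix (Fin n) (Fin n) ℝ) :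
    toComplex (A * B) = toComplex A * toComplex B :=
  Matrix.map_mul (f := Complex.ofRealHom)

lemma toComplex_add {n : ℕ} (A B : Matrix (Fin n) (Fin n) ℝ) :
    toComplex (A + B) = toComplex A + toComplex B := by
  ext; simp [toComplex]

lemma toComplex_smul {n : ℕ} (c : ℝ) (A : Matrix (Fin n) (Fin n) ℝ) :
    toComplex (c • A) = (c : ℂ) • toComplex A := by
  ext; simp [toComplex]

lemma toComplex_one {n : ℕ} : toComplex (1 : Matrix (Fin n) (Fin n) ℝ) = 1 :=
  Matrix.map_one _ Complex.ofReal_zero Complex.ofReal_one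

lemma toComplex_transpose {n : ℕ} (A : Matrix (Fin n) (Fin n) ℝ) :
    toComplex A.transpose = (toComplex A)ᴴ := by
  ext; simp [toComplex]

lemma toComplex_diagPart {n : ℕ} (A : Matrix (Fin n) (Fin n) ℝ) :
    toComplex (diagPart A) = Matrix.diagonal (toComplex A).diag := by
  ext i j
  by_cases h : i = j
  · subst h; simp [toComplex, diagPart]
  · simp [toComplex, diagPart, h]

lemma trace_toComplex {n : ℕ} (A : Matrix (Fin n) (Fin n) ℝ) :
    (toComplex A).trace = (A.trace : ℂ) := by
  simp [toComplex, Matrix.trace]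

/-- A sequence of real matrices with the real symbol `a`. -/
def RealSymbol (A : ∀ n, Matrix (Fin n) (Fin n) ℝ) (a : ℝ → ℝ) : Prop :=
  HasSymbol (fun n => toComplex (A n)) (fun x => (a x : ℂ))

lemma HasSymbol.tendsto_trace_re {A : ∀ n, Matrix (Fin n) (Fin n) ℝ} {a : ℝ → ℝ}
    (hA : HasSymbol (fun n => toComplex (A n)) (fun x => (a x : ℂ)))
    (ha : Function.Periodic a (2 * Real.pi)) :
    Tendsto (fun n : ℕ => (1 / (n : ℝ)) * (A n).trace) atTop (𝓝 (meanVal a)) := by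
  have h := hA.tendsto_trace
  rw [circleMean_ofReal ha] at h
  have h2 := (Complex.continuous_re.tendsto _).comp h
  rw [Complex.ofReal_re] at h2
  refine h2.congr fun n => ?_
  simp only [Function.comp, trace_toComplex]
  rw [show (1 / (n : ℂ)) * ((A n).trace : ℂ) = ((1 / (n : ℝ) * (A n).trace : ℝ) : ℂ) by push_cast; rfl,
    Complex.ofReal_re]

namespace RealSymbol

variable {A B : ∀ n, Matrix (Fin n) (Fin n) ℝ} {a b : ℝ → ℝ}

lemma continuous (hA : RealSymbol A a) : Continuous a := by
  have := Complex.continuous_re.comp (HasSymbol.continuous hA)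
  exact this

lemma congr (hA : RealSymbol A a) (h : ∀ x, a x = b x) : RealSymbol A b := by
  rwa [← funext h]

lemma congr_left (hA : RealSymbol A a) (h : ∀ n, A n = B n) : RealSymbol B a := by
  rwa [← funext h]

lemma add (hA : RealSymbol A a) (hB : RealSymbol B b) :
    RealSymbol (fun n => A n + B n) (fun x => a x + b x) :=
  ((HasSymbol.add hA hB).congr fun x => by push_cast; rfl).congr_left fun n =>
    (toComplex_add _ _).symm

lemma mul (hA : RealSymbol A a) (hB : RealSymbol B b) :
    RealSymbol (fun n => A n * B n) (fun x => a x * b x) :=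
  ((HasSymbol.mul hA hB).congr fun x => by push_cast; rfl).congr_left fun n =>
    (toComplex_mul _ _).symm

lemma smul (c : ℝ) (hA : RealSymbol A a) : RealSymbol (fun n => c • A n) (fun x => c * a x) :=
  ((HasSymbol.smul (c : ℂ) hA).congr fun _ => by push_cast; rfl).congr_left fun _ =>
    (toComplex_smul _ _).symm

lemma one : RealSymbol (fun _ => 1) (fun _ => 1) :=
  ((HasSymbol.const 1).congr fun _ => by push_cast; rfl).congr_left fun _ => by
    rw [toComplex_one, one_smul]

lemma sub (hA : RealSymbol A a) (hB : RealSymbol B b) :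
    RealSymbol (fun n => A n - B n) (fun x => a x - b x) :=
  ((hA.add (hB.smul (-1))).congr fun _ => by ring).congr_left fun _ => by
    rw [neg_one_smul, sub_eq_add_neg]

lemma pow (hA : RealSymbol A a) (k : ℕ) : RealSymbol (fun n => A n ^ k) (fun x => a x ^ k) := by
  induction k with
  | zero => simpa using one
  | succ k ih => simpa only [pow_succ] using ih.mul hA

lemma transpose (hA : RealSymbol A a) : RealSymbol (fun n => (A n).transpose) a :=
  ((HasSymbol.conjTranspose hA).congr fun _ => Complex.conj_ofReal _).congr_left fun _ =>
    (toComplex_transpose _).symm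

lemma diagPart (hA : RealSymbol A a) (ha : Function.Periodic a (2 * Real.pi)) :
    RealSymbol (fun n => diagPart (A n)) (fun _ => meanVal a) :=
  ((HasSymbol.diagonal_diag hA).congr fun _ => circleMean_ofReal ha).congr_left fun _ =>
    (toComplex_diagPart _).symm

lemma inv (hA : RealSymbol A a) (ha : ∀ x, a x ≠ 0) (hu : ∀ n, IsUnit (A n).det)
    (hB : ∃ C, ∀ n, ‖(A n)⁻¹‖ ≤ C) : RealSymbol (fun n => (A n)⁻¹) (fun x => (a x)⁻¹) := by
  obtain ⟨C, hC⟩ := hB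
  refine (HasSymbol.inv hA (fun x => by exact_mod_cast ha x)
    (B := fun n => toComplex (A n)⁻¹) ⟨C, fun n => (norm_map_ofReal_le _).trans (hC n)⟩
    fun n => ?_).congr fun x => by push_cast; rfl
  rw [← toComplex_mul, Matrix.nonsing_inv_mul _ (hu n), toComplex_one]

lemma tendsto_trace (hA : RealSymbol A a) (ha : Function.Periodic a (2 * Real.pi)) :
    Tendsto (fun n : ℕ => (1 / (n : ℝ)) * (A n).trace) atTop (𝓝 (meanVal a)) :=
  HasSymbol.tendsto_trace_re hA ha

end RealSymbol

lemma meanVal_add {g h : ℝ → ℝ} (hg : Continuous g) (hh : Continuous h) :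
    meanVal (fun x => g x + h x) = meanVal g + meanVal h := by
  rw [meanVal, intervalIntegral.integral_add (hg.intervalIntegrable _ _)
    (hh.intervalIntegrable _ _), mul_add, meanVal, meanVal]

lemma meanVal_const_mul (c : ℝ) (g : ℝ → ℝ) : meanVal (fun x => c * g x) = c * meanVal g := by
  rw [meanVal, intervalIntegral.integral_const_mul, meanVal]; ring

lemma meanVal_linear_combination {g₁ g₂ g₃ : ℝ → ℝ} (h₁ : Continuous g₁) (h₂ : Continuous g₂)
    (h₃ : Continuous g₃) (c₁ c₂ c₃ : ℝ) :
    meanVal (fun x => c₁ * g₁ x + (c₂ * g₂ x + c₃ * g₃ x)) =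
      c₁ * meanVal g₁ + (c₂ * meanVal g₂ + c₃ * meanVal g₃) := by
  rw [meanVal_add (h := fun x => c₂ * g₂ x + c₃ * g₃ x) (h₁.const_mul c₁) (by fun_prop), meanVal_add (h₂.const_mul c₂) (h₃.const_mul c₃), meanVal_const_mul, meanVal_const_mul,
    meanVal_const_mul]

lemma meanVal_pos {g : ℝ → ℝ} (hg : Continuous g) (h : ∀ x, 0 < g x) : 0 < meanVal g := by
  rw [meanVal]
  have hpos : 0 < ∫ x in (-Real.pi)..Real.pi, g x :=
    intervalIntegral.intervalIntegral_pos_of_pos (hg.intervalIntegrable _ _) h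
      (by linarith [Real.pi_pos])
  positivity

/-- A bounded, uniformly coercive sequence of matrices `R n` with symbol `f` together with a
sequence `S n` with symbol `g`. -/
structure SymbolPair (R S : ∀ n, Matrix (Fin n) (Fin n) ℝ) (f g : ℝ → ℝ) : Prop where
  left : RealSymbol R f
  right : RealSymbol S g
  pos : ∀ x, 0 < f x
  periodic_left : Function.Periodic f (2 * Real.pi)
  periodic_right : Function.Periodic g (2 * Real.pi)
  coercive : ∃ δ, 0 < δ ∧ ∀ n, Coercive δ (R n)

namespace SymbolPair

variable {R S : ∀ n, Matrix (Fin n) (Fin n) ℝ} {f g : ℝ → ℝ}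

lemma ne_zero (h : SymbolPair R S f g) (x : ℝ) : f x ≠ 0 := (h.pos x).ne'

lemma inv (h : SymbolPair R S f g) : RealSymbol (fun n => (R n)⁻¹) (fun x => (f x)⁻¹) := by
  obtain ⟨δ, hδ, hc⟩ := h.coercive
  exact h.left.inv h.ne_zero (fun n => (hc n).isUnit_det hδ) ⟨δ⁻¹, fun n => (hc n).norm_inv_le hδ⟩

lemma tendsto_matML (h : SymbolPair R S f g) :
    Tendsto (fun n : ℕ => (1 / (n : ℝ)) * (matML (R n) (S n)).trace) atTop
      (𝓝 ((1 / 2) * meanVal (fun x => g x ^ 2 / f x ^ 2))) := by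
  have h1 := ((((h.inv.mul h.right).mul h.inv).mul h.right).smul (1 / 2)).congr
    (b := fun x => 1 / 2 * (g x ^ 2 / f x ^ 2)) fun x => by
      have := h.ne_zero x
      field_simp
  rw [← meanVal_const_mul]
  refine h1.tendsto_trace fun x => ?_
  simp only [h.periodic_left x, h.periodic_right x]

lemma continuous_left (h : SymbolPair R S f g) : Continuous f := h.left.continuous

lemma continuous_right (h : SymbolPair R S f g) : Continuous g := h.right.continuous

lemma continuous_div (h : SymbolPair R S f g) (p q : ℕ) :
    Continuous fun x => g x ^ p / f x ^ q :=
  (h.continuous_right.pow p).div (h.continuous_left.pow q) fun x => pow_ne_zero _ (h.ne_zero x)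

lemma meanVal_inv_pos (h : SymbolPair R S f g) : 0 < meanVal (fun x => 1 / f x) := by
  refine meanVal_pos ?_ fun x => one_div_pos.mpr (h.pos x)
  simpa using h.continuous_div 0 1

/-- The diagonal entries of `R⁻¹` are bounded below by `Coercive.inv_diag_ge`, so the diagonal part
is itself coercive and the inversion rule applies to its constant symbol. -/
lemma diag_inv_inv (h : SymbolPair R S f g) :
    RealSymbol (fun n => (diagPart (R n)⁻¹)⁻¹) (fun _ => (meanVal (fun x => 1 / f x))⁻¹) := by
  obtain ⟨δ, hδ, hc⟩ := h.coercive
  obtain ⟨C₀, hC₀⟩ := h.left.bounded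
  have hd : RealSymbol (fun n => diagPart (R n)⁻¹) (fun _ => meanVal (fun x => 1 / f x)) := by
    have := h.inv.diagPart (fun x => by simp only [h.periodic_left x])
    simpa only [one_div] using this
  -- The symbol calculus bounds the complexified matrices; restriction to real vectors returns a
  -- real bound. The maximum with `1` keeps the constant positive.
  have hreal : ∀ n, ‖R n‖ ≤ max C₀ 1 := fun n => by
    refine opNorm_le_of_sum_norm_sq_le (by positivity) fun v => ?_
    have h1 := sum_norm_sq_mulVec_le (toComplex (R n)) (fun i => (v i : ℂ))
    have h2 : ∀ i, ‖(toComplex (R n) *ᵥ fun i => (v i : ℂ)) i‖ = ‖(R n *ᵥ v) i‖ := fun i => by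
      rw [← Complex.norm_real]
      congr 1
      simp [toComplex, Matrix.mulVec, dotProduct]
    simp only [h2, Complex.norm_real] at h1
    refine h1.trans (mul_le_mul_of_nonneg_right ?_ (Finset.sum_nonneg fun _ _ => by positivity))
    exact pow_le_pow_left₀ (norm_nonneg _) ((hC₀ n).trans (le_max_left _ _)) 2
  have hpos : ∀ n i, δ / (max C₀ 1) ^ 2 ≤ (R n)⁻¹ i i := fun n i =>
    (hc n).inv_diag_ge hδ (by positivity) (hreal n) i
  have hcoer : ∀ n, Coercive (δ / (max C₀ 1) ^ 2) (diagPart (R n)⁻¹) := fun n v => by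
    simp only [diagPart, Matrix.mulVec_diagonal, dotProduct, Matrix.diag_apply, Finset.mul_sum]
    refine Finset.sum_le_sum fun i _ => ?_
    have := mul_le_mul_of_nonneg_right (hpos n i) (sq_nonneg (v i))
    linarith
  have hδ' : 0 < δ / (max C₀ 1) ^ 2 := by positivity
  exact hd.inv (fun _ => h.meanVal_inv_pos.ne') (fun n => (hcoer n).isUnit_det hδ')
    ⟨_, fun n => (hcoer n).norm_inv_le hδ'⟩

lemma inv_mul_inv (h : SymbolPair R S f g) :
    RealSymbol (fun n => (R n)⁻¹ * S n * (R n)⁻¹) (fun x => g x / f x ^ 2) :=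
  ((h.inv.mul h.right).mul h.inv).congr fun x => by
    have := h.ne_zero x
    field_simp

lemma diag_inv_mul_inv (h : SymbolPair R S f g) :
    RealSymbol (fun n => diagPart ((R n)⁻¹ * S n * (R n)⁻¹))
      (fun _ => meanVal fun x => g x / f x ^ 2) :=
  h.inv_mul_inv.diagPart fun x => by simp only [h.periodic_left x, h.periodic_right x]

lemma matCVGrad (h : SymbolPair R S f g) :
    RealSymbol (fun n => matCVGrad (R n) (S n)) (fun x =>
      (f x)⁻¹ * (meanVal (fun x => 1 / f x))⁻¹ ^ 2 *
        ((meanVal fun x => g x / f x ^ 2) * (meanVal (fun x => 1 / f x))⁻¹ - (f x)⁻¹ * g x) *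
          (f x)⁻¹) :=
  ((h.inv.mul (h.diag_inv_inv.pow 2)).mul
    ((h.diag_inv_mul_inv.mul h.diag_inv_inv).sub (h.inv.mul h.right))).mul h.inv

/-- Transposition fixes a real symbol, so `G + Gᵗ` has twice the symbol of `G`; together with the
outer factor `2` this gives `8` and, from the cross term of the square, `16`. -/
lemma tendsto_matCV1 (h : SymbolPair R S f g) :
    Tendsto (fun n : ℕ => (1 / (n : ℝ)) * (matCV1 (R n) (S n)).trace) atTop
      (𝓝 (8 * meanVal (fun x => 1 / f x) ^ (-6 : ℤ) * meanVal (fun x => g x / f x ^ 2) ^ 2 *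
          meanVal (fun x => 1 / f x ^ 2)
        + 8 * meanVal (fun x => 1 / f x) ^ (-4 : ℤ) * meanVal (fun x => g x ^ 2 / f x ^ 4)
        - 16 * meanVal (fun x => 1 / f x) ^ (-5 : ℤ) * meanVal (fun x => g x / f x ^ 2) *
          meanVal (fun x => g x / f x ^ 3))) := by
  have hG := h.matCVGrad
  have hd := h.meanVal_inv_pos
  set d := meanVal (fun x => 1 / f x) with hdd
  set q := meanVal (fun x => g x / f x ^ 2) with hq
  have h1 := (((((hG.add hG.transpose).mul h.left).mul (hG.add hG.transpose)).mul h.left).smul 2).congr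
    (b := fun x => (8 * d ^ (-6 : ℤ) * q ^ 2) * (g x ^ 0 / f x ^ 2) +
      ((8 * d ^ (-4 : ℤ)) * (g x ^ 2 / f x ^ 4) + (-(16 * d ^ (-5 : ℤ) * q)) * (g x ^ 1 / f x ^ 3)))
    fun x => by
      have := h.ne_zero x
      have := hd.ne'
      simp only [zpow_neg, zpow_ofNat]
      field_simp
      ring
  have h2 := h1.tendsto_trace fun x => by simp only [h.periodic_left x, h.periodic_right x]
  rw [meanVal_linear_combination (h.continuous_div 0 2) (h.continuous_div 2 4)
    (h.continuous_div 1 3)] at h2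
  simp only [pow_zero, pow_one] at h2
  convert! h2 using 2
  ring

/-- The first and third terms of the matrix both contribute multiples of `d⁻¹ ^ 3 * q ^ 2`, with
coefficients `-8` and `6`; their sum is the subtracted square. -/
lemma tendsto_matCV2 (h : SymbolPair R S f g) :
    Tendsto (fun n : ℕ => (1 / (n : ℝ)) * (matCV2 (R n) (S n)).trace) atTop
      (𝓝 (2 * meanVal (fun x => 1 / f x) ^ (-3 : ℤ) *
        (meanVal (fun x => g x ^ 2 / f x ^ 3) * meanVal (fun x => 1 / f x)
          - meanVal (fun x => g x / f x ^ 2) ^ 2))) := by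
  have hd := h.meanVal_inv_pos
  have hD := h.diag_inv_inv
  have hQ := h.diag_inv_mul_inv
  have hdd : meanVal (fun x => g x ^ 0 / f x ^ 1) = meanVal (fun x => 1 / f x) := by simp
  have hqq : meanVal (fun x => g x ^ 1 / f x ^ 2) = meanVal (fun x => g x / f x ^ 2) := by simp
  set d := meanVal (fun x => 1 / f x) with hd'
  set q := meanVal (fun x => g x / f x ^ 2) with hq
  have e1 := (((((hD.pow 3).mul hQ).mul h.inv).mul h.right).mul h.inv).smul (-8)
  have e2 := (((((hD.pow 2).mul h.inv).mul h.right).mul h.inv).mul h.right).mul h.inv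
  have e3 := ((((hD.pow 4).mul hQ).mul hQ).mul h.inv).smul 6
  have h1 := ((e1.add (e2.smul 2)).add e3).congr
    (b := fun x => (-8 * d⁻¹ ^ 3 * q) * (g x ^ 1 / f x ^ 2) +
      ((2 * d⁻¹ ^ 2) * (g x ^ 2 / f x ^ 3) + (6 * d⁻¹ ^ 4 * q ^ 2) * (g x ^ 0 / f x ^ 1)))
    fun x => by
      have := h.ne_zero x
      have := hd.ne'
      field_simp
      ring
  have h2 := h1.tendsto_trace fun x => by simp only [h.periodic_left x, h.periodic_right x]
  rw [meanVal_linear_combination (h.continuous_div 1 2) (h.continuous_div 2 3)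
    (h.continuous_div 0 1), hdd, hqq] at h2
  convert! h2 using 2
  have := hd.ne'
  simp only [zpow_neg, zpow_ofNat]
  field_simp
  ring

end SymbolPair

end RealSymbols

/-! ### Block diagonal matrices and stability of the likelihood trace -/

section Blocks

open scoped Matrix.Norms.L2Operator Matrix

variable {ι κ : Type*} [Fintype ι] [DecidableEq ι] [Fintype κ] [DecidableEq κ]

lemma norm_submatrix_equiv_le (A : Matrix ι ι ℝ) (e : κ ≃ ι) : ‖A.submatrix e e‖ ≤ ‖A‖ := by
  refine opNorm_le_of_sum_norm_sq_le (norm_nonneg _) fun v => ?_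
  have h := sum_norm_sq_mulVec_le A (v ∘ e.symm)
  rw [← e.sum_comp] at h
  have h2 : ∑ i, ‖(v ∘ e.symm) i‖ ^ 2 = ∑ i, ‖v i‖ ^ 2 := by
    rw [← e.sum_comp]; simp
  rw [h2] at h
  refine le_trans (le_of_eq ?_) h
  refine Finset.sum_congr rfl fun i _ => ?_
  congr 2
  simp only [Matrix.mulVec, dotProduct, Matrix.submatrix_apply, Function.comp]
  rw [← e.sum_comp]
  simp

lemma norm_fromBlocks_diag_le {A : Matrix ι ι ℝ} {D : Matrix κ κ ℝ} {C : ℝ} (hA : ‖A‖ ≤ C)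
    (hD : ‖D‖ ≤ C) : ‖Matrix.fromBlocks A 0 0 D‖ ≤ C := by
  refine opNorm_le_of_sum_norm_sq_le ((norm_nonneg _).trans hA) fun v => ?_
  have h1 := sum_norm_sq_mulVec_le A (v ∘ Sum.inl)
  have h2 := sum_norm_sq_mulVec_le D (v ∘ Sum.inr)
  have h3 : ‖A‖ ^ 2 ≤ C ^ 2 := pow_le_pow_left₀ (norm_nonneg _) hA 2
  have h4 : ‖D‖ ^ 2 ≤ C ^ 2 := pow_le_pow_left₀ (norm_nonneg _) hD 2
  simp only [Fintype.sum_sum_type, Matrix.fromBlocks_mulVec, Sum.elim_inl, Sum.elim_inr,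
    Matrix.zero_mulVec, add_zero, zero_add, mul_add]
  exact add_le_add (h1.trans (mul_le_mul_of_nonneg_right h3 (by positivity)))
    (h2.trans (mul_le_mul_of_nonneg_right h4 (by positivity)))

lemma inv_fromBlocks_diag {A : Matrix ι ι ℝ} {D : Matrix κ κ ℝ} (hA : IsUnit A.det)
    (hD : IsUnit D.det) : (Matrix.fromBlocks A 0 0 D)⁻¹ = Matrix.fromBlocks A⁻¹ 0 0 D⁻¹ := by
  refine Matrix.inv_eq_right_inv ?_
  rw [Matrix.fromBlocks_multiply]
  simp [Matrix.mul_nonsing_inv _ hA, Matrix.mul_nonsing_inv _ hD]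

lemma abs_trace_mul_le {A : Matrix ι ι ℝ} {c : ℝ} (hA : ‖A‖ ≤ c) (B : Matrix ι ι ℝ) :
    |(A * B).trace| ≤ c * ∑ i, ∑ j, |B i j| := by
  have h := norm_trace_mul_le A B
  simp only [Real.norm_eq_abs] at h
  exact h.trans (mul_le_mul_of_nonneg_right hA
    (Finset.sum_nonneg fun _ _ => Finset.sum_nonneg fun _ _ => abs_nonneg _))

/-- The trace functional of the maximum likelihood variance (without the factor `1 / 2`). -/
noncomputable def mlTrace (R S : Matrix ι ι ℝ) : ℝ := (R⁻¹ * S * R⁻¹ * S).trace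

lemma trace_matML {n : ℕ} (R S : Matrix (Fin n) (Fin n) ℝ) :
    (matML R S).trace = 1 / 2 * mlTrace R S := by
  rw [matML, Matrix.trace_smul, smul_eq_mul, mlTrace]

lemma mlTrace_submatrix (R S : Matrix ι ι ℝ) (e : κ ≃ ι) :
    mlTrace (R.submatrix e e) (S.submatrix e e) = mlTrace R S := by
  rw [mlTrace, mlTrace, Matrix.inv_submatrix_equiv, Matrix.submatrix_mul_equiv,
    Matrix.submatrix_mul_equiv, Matrix.submatrix_mul_equiv]
  simp only [Matrix.trace, Matrix.diag_apply, Matrix.submatrix_apply]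
  exact e.sum_comp fun i => (R⁻¹ * S * R⁻¹ * S) i i

lemma mlTrace_fromBlocks {A A' : Matrix ι ι ℝ} {D D' : Matrix κ κ ℝ} (hA : IsUnit A.det)
    (hD : IsUnit D.det) : mlTrace (Matrix.fromBlocks A 0 0 D) (Matrix.fromBlocks A' 0 0 D') =
      mlTrace A A' + mlTrace D D' := by
  rw [mlTrace, inv_fromBlocks_diag hA hD]
  simp [Matrix.fromBlocks_multiply, mlTrace, Matrix.trace, Fintype.sum_sum_type]

/-- Lipschitz dependence of the trace functional on the entries of the matrices. -/
lemma abs_mlTrace_sub_le {R R' S S' : Matrix ι ι ℝ} {C : ℝ} (hC : 1 ≤ C) (hR : IsUnit R.det)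
    (hR' : IsUnit R'.det) (h1 : ‖R⁻¹‖ ≤ C) (h2 : ‖R'⁻¹‖ ≤ C) (h3 : ‖S‖ ≤ C) (h4 : ‖S'‖ ≤ C) :
    |mlTrace R S - mlTrace R' S'| ≤
      2 * C ^ 5 * (∑ i, ∑ j, |(R - R') i j| + ∑ i, ∑ j, |(S - S') i j|) := by
  set P := R⁻¹ with hP
  set P' := R'⁻¹ with hP'
  have hPR : P * R = 1 := Matrix.nonsing_inv_mul _ hR
  have hPR' : R' * P' = 1 := Matrix.mul_nonsing_inv _ hR'
  set V := P * S + P' * S' with hV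
  have hdiff : P * S - P' * S' = P * (S - S') - P * (R - R') * P' * S' := by
    have : P * (R - R') * P' = P' - P := by
      rw [mul_sub, hPR, sub_mul, one_mul, mul_assoc, hPR', mul_one]
    rw [this]; noncomm_ring
  -- For `W = P S` and `W' = P' S'`, cyclicity gives `Tr W² - Tr W'² = Tr ((W + W') (W - W'))`, and
  -- `W - W'` is linear in `S - S'` and `R - R'`.
  have htr : mlTrace R S - mlTrace R' S' =
      (V * P * (S - S')).trace - (P' * S' * V * P * (R - R')).trace := by
    have e1 : mlTrace R S - mlTrace R' S' = (V * (P * S - P' * S')).trace := by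
      have e2 : V * (P * S - P' * S') = P * S * P * S - P' * S' * P' * S' +
          (P' * S' * (P * S) - P * S * (P' * S')) := by rw [hV]; noncomm_ring
      rw [e2, Matrix.trace_add, Matrix.trace_sub, Matrix.trace_sub,
        Matrix.trace_mul_comm (P' * S') (P * S), sub_self, add_zero]
      rfl
    rw [e1, hdiff, mul_sub, Matrix.trace_sub]
    congr 1
    · rw [mul_assoc]
    · rw [show V * (P * (R - R') * P' * S') = (V * P * (R - R')) * (P' * S') by noncomm_ring,
        Matrix.trace_mul_comm]
      congr 1; noncomm_ring
  have hC0 : 0 ≤ C := by linarith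
  have hmul : ∀ {A B : Matrix ι ι ℝ} {a b : ℝ}, ‖A‖ ≤ a → ‖B‖ ≤ b → ‖A * B‖ ≤ a * b :=
    fun ha hb => (norm_mul_le _ _).trans
      (mul_le_mul ha hb (norm_nonneg _) ((norm_nonneg _).trans ha))
  have hVn : ‖V‖ ≤ C * C + C * C := (norm_add_le _ _).trans (add_le_add (hmul h1 h3) (hmul h2 h4))
  have b1 : ‖V * P‖ ≤ 2 * C ^ 5 := by
    refine (hmul hVn h1).trans ?_
    have : C ^ 3 ≤ C ^ 5 := pow_le_pow_right₀ hC (by norm_num)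
    nlinarith
  have b2 : ‖P' * S' * V * P‖ ≤ 2 * C ^ 5 := by
    refine (hmul (hmul (hmul h2 h4) hVn) h1).trans (le_of_eq (by ring))
  have c1 := abs_trace_mul_le b1 (S - S')
  have c2 := abs_trace_mul_le b2 (R - R')
  rw [htr]
  refine (abs_sub _ _).trans ?_
  linarith

end Blocks

/-! ### Uniform bounds on perturbed grids -/

section GridBounds

open scoped Matrix.Norms.L2Operator Matrix

/-- The weight `1 / (1 + k²)`. -/
noncomputable def lagWeight (k : ℤ) : ℝ := 1 / (1 + (k : ℝ) ^ 2)

lemma lagWeight_nonneg (k : ℤ) : 0 ≤ lagWeight k := by unfold lagWeight; positivity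

lemma lagWeight_neg (k : ℤ) : lagWeight (-k) = lagWeight k := by simp [lagWeight]

lemma summable_lagWeight : Summable lagWeight := by
  have h : Summable fun k : ℤ => 1 / (k : ℝ) ^ 2 := Real.summable_one_div_int_pow.mpr (by norm_num)
  refine Summable.of_norm_bounded_eventually h ?_
  have : {k : ℤ | ¬ ‖lagWeight k‖ ≤ 1 / (k : ℝ) ^ 2} ⊆ {0} := by
    intro k hk
    by_contra h0
    apply hk
    rw [mem_singleton_iff] at h0
    have h1 : 0 < (k : ℝ) ^ 2 := by positivity
    rw [Real.norm_of_nonneg (lagWeight_nonneg k)]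
    exact one_div_le_one_div_of_le h1 (by linarith)
  exact (finite_singleton 0).subset this

/-- The perturbation sequence `x` takes its values in `[-1, 1]`. -/
def Admissible (x : ℕ → ℝ) : Prop := ∀ i, |x i| ≤ 1

lemma Admissible.shift {x : ℕ → ℝ} (hx : Admissible x) (p : ℕ) : Admissible fun i => x (p + i) :=
  fun i => hx (p + i)

/-- Two perturbations change a difference by at most `2 * b`, which is at most `2 * b` times the lag
when the lag is nonzero. Hence the points stay separated for `b < 1 / 2`. -/
lemma obsPoint_sub_ge {b ε : ℝ} (hε : ε ∈ Icc 0 b) {x : ℕ → ℝ} (hx : Admissible x) (i j : ℕ) :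
    (1 - 2 * b) * |((i : ℤ) - (j : ℤ) : ℤ)| ≤ |obsPoint ε x i - obsPoint ε x j| := by
  by_cases hij : i = j
  · subst hij; simp
  have h1 : (1 : ℝ) ≤ |(((i : ℤ) - (j : ℤ) : ℤ) : ℝ)| := by
    have : (1 : ℤ) ≤ |(i : ℤ) - (j : ℤ)| := Int.one_le_abs (by omega)
    exact_mod_cast this
  have h2 : obsPoint ε x i - obsPoint ε x j =
      (((i : ℤ) - (j : ℤ) : ℤ) : ℝ) - -(ε * (x i - x j)) := by
    unfold obsPoint; push_cast; ring
  have h3 : |-(ε * (x i - x j))| ≤ 2 * b := by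
    rw [abs_neg, abs_mul, abs_of_nonneg hε.1]
    have : |x i - x j| ≤ 2 := (abs_sub _ _).trans (by linarith [hx i, hx j])
    nlinarith [hε.1, hε.2, abs_nonneg (x i - x j)]
  have h4 := abs_sub_abs_le_abs_sub (((i : ℤ) - (j : ℤ) : ℤ) : ℝ) (-(ε * (x i - x j)))
  rw [h2, Int.cast_abs]
  have h5 : 0 ≤ b := hε.1.trans hε.2
  nlinarith

lemma le_of_decay {τ C t : ℝ} {k : ℤ} (hτ : 0 < τ) (hτ1 : τ ≤ 1) (hC : 0 ≤ C)
    (ht : τ * |(k : ℝ)| ≤ |t|) : C / (1 + |t| ^ 2) ≤ C / τ ^ 2 * lagWeight k := by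
  rw [lagWeight, div_mul_div_comm, mul_one]
  refine div_le_div_of_nonneg_left hC (by positivity) ?_
  have h1 := pow_le_pow_left₀ (by positivity) ht 2
  rw [mul_pow, sq_abs] at h1
  have : τ ^ 2 ≤ 1 := pow_le_one₀ hτ.le hτ1
  linarith

/-- Entrywise bound of the matrices of a kernel with quadratic decay. -/
lemma abs_gridMatrix_le {k : ℝ → ℝ} {C b ε : ℝ} (hC : 0 ≤ C) (hk : ∀ t, |k t| ≤ C / (1 + |t| ^ 2))
    (hb : b < 1 / 2) (hε : ε ∈ Icc 0 b) {x : ℕ → ℝ} (hx : Admissible x) (i j : ℕ) :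
    |k (obsPoint ε x i - obsPoint ε x j)| ≤
      C / (1 - 2 * b) ^ 2 * lagWeight ((i : ℤ) - (j : ℤ)) := by
  refine (hk _).trans (le_of_decay (by linarith) (by linarith [hε.1.trans hε.2]) hC ?_)
  have := obsPoint_sub_ge hε hx i j
  rwa [Int.cast_abs] at this

variable {θinf θsup : ℝ} {K : ℝ → ℝ → ℝ} {θ : ℝ}

/-- Uniform bounds of the matrices `R` and `S` for `ε ∈ [0, b]`. -/
structure GridBounds (k k' : ℝ → ℝ) (b δ C : ℝ) : Prop where
  pos : 0 < δ
  one_le : 1 ≤ C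
  coercive : ∀ ε ∈ Icc 0 b, ∀ x, Admissible x → ∀ n, Coercive δ (gridMatrix k ε x n)
  inv_le : δ⁻¹ ≤ C
  entry : ∀ ε ∈ Icc 0 b, ∀ x, Admissible x → ∀ i j : ℕ,
    |k (obsPoint ε x i - obsPoint ε x j)| ≤ C * lagWeight ((i : ℤ) - (j : ℤ)) ∧
    |k' (obsPoint ε x i - obsPoint ε x j)| ≤ C * lagWeight ((i : ℤ) - (j : ℤ))
  norm_le : ∀ ε ∈ Icc 0 b, ∀ x, Admissible x → ∀ n,
    ‖gridMatrix k ε x n‖ ≤ C ∧ ‖gridMatrix k' ε x n‖ ≤ C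

lemma CovarianceModel.exists_decay (hK : CovarianceModel θinf θsup K) (hθ : θ ∈ Icc θinf θsup) :
    ∃ C, 0 ≤ C ∧ (∀ t, |K θ t| ≤ C / (1 + |t| ^ 2)) ∧
      ∀ t, |dTheta θinf θsup K θ t| ≤ C / (1 + |t| ^ 2) := by
  obtain ⟨C₀, h₀⟩ := hK.bound 0 (by norm_num)
  obtain ⟨C₁, h₁⟩ := hK.bound 1 (by norm_num)
  refine ⟨max (max C₀ C₁) 0, le_max_right _ _, fun t => ?_, fun t => ?_⟩
  · have h := h₀ θ hθ t
    rw [iteratedDerivWithin_zero] at h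
    refine h.trans ?_
    gcongr
    exact (le_max_left _ _).trans (le_max_left _ _)
  · have h := h₁ θ hθ t
    rw [iteratedDerivWithin_one] at h
    refine h.trans ?_
    gcongr
    exact (le_max_right _ _).trans (le_max_left _ _)

lemma CovarianceModel.exists_gridBounds (hK : CovarianceModel θinf θsup K)
    (hθ : θ ∈ Icc θinf θsup) {b : ℝ} (hb : b < 1 / 2) :
    ∃ δ C, GridBounds (K θ) (dTheta θinf θsup K θ) b δ C := by
  obtain ⟨δ, hδ, hcoer⟩ := exists_coercive hK hθ (τ := 1 - 2 * b) (by linarith)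
  obtain ⟨C, hC, h0, h1⟩ := CovarianceModel.exists_decay hK hθ
  set c := C / (1 - 2 * b) ^ 2 with hc
  have hc0 : 0 ≤ c := by positivity
  set Z := ∑' k, lagWeight k
  have hZ : 0 ≤ Z := tsum_nonneg lagWeight_nonneg
  set M := max (max 1 δ⁻¹) (max c (c * Z)) with hM
  have hcM : c ≤ M := (le_max_left _ _).trans (le_max_right _ _)
  have hcZM : c * Z ≤ M := (le_max_right _ _).trans (le_max_right _ _)
  refine ⟨δ, M, hδ, (le_max_left _ _).trans (le_max_left _ _), fun ε hε x hx n => ?_,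
    (le_max_right _ _).trans (le_max_left _ _), fun ε hε x hx i j => ⟨?_, ?_⟩,
    fun ε hε x hx n => ⟨?_, ?_⟩⟩
  · exact hcoer n (fun i => obsPoint ε x i) fun i j => by
      have := obsPoint_sub_ge hε hx i j
      exact_mod_cast this
  · exact (abs_gridMatrix_le hC h0 hb hε hx i j).trans
      (mul_le_mul_of_nonneg_right hcM (lagWeight_nonneg _))
  · exact (abs_gridMatrix_le hC h1 hb hε hx i j).trans
      (mul_le_mul_of_nonneg_right hcM (lagWeight_nonneg _))
  · refine le_trans ?_ hcZM
    rw [← tsum_mul_left]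
    exact opNorm_le_of_lag_bound (fun k => mul_nonneg hc0 (lagWeight_nonneg k))
      (summable_lagWeight.mul_left c) fun i j => abs_gridMatrix_le hC h0 hb hε hx i j
  · refine le_trans ?_ hcZM
    rw [← tsum_mul_left]
    exact opNorm_le_of_lag_bound (fun k => mul_nonneg hc0 (lagWeight_nonneg k))
      (summable_lagWeight.mul_left c) fun i j => abs_gridMatrix_le hC h1 hb hε hx i j

end GridBounds

/-! ### Cost of cutting the grid in two -/

section Cut

open scoped Matrix.Norms.L2Operator Matrix

/-- The interaction, weighted by `lagWeight`, of `m` consecutive points with all the points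
before them. -/
noncomputable def cutWeight (m : ℕ) : ℝ :=
  ∑ v ∈ Finset.range m, ∑' u : ℕ, lagWeight ((u + (v + 1) : ℕ) : ℤ)

lemma summable_lagWeight_nat : Summable fun u : ℕ => lagWeight (u : ℤ) :=
  summable_lagWeight.comp_injective Nat.cast_injective

lemma cutWeight_nonneg (m : ℕ) : 0 ≤ cutWeight m :=
  Finset.sum_nonneg fun _ _ => tsum_nonneg fun _ => lagWeight_nonneg _

/-- The quotient is the Cesàro mean of the tails of a convergent series. -/
lemma tendsto_cutWeight_div : Tendsto (fun m : ℕ => cutWeight m / m) atTop (𝓝 0) := by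
  have h := (tendsto_sum_nat_add fun u : ℕ => lagWeight (u : ℤ)).comp (tendsto_add_atTop_nat 1)
  refine h.cesaro.congr fun n => ?_
  rw [div_eq_inv_mul]
  rfl

lemma sum_sum_lagWeight_le (p m : ℕ) :
    ∑ a : Fin p, ∑ v : Fin m, lagWeight ((a : ℤ) - ((p + v : ℕ) : ℤ)) ≤ cutWeight m := by
  rw [Finset.sum_comm, cutWeight, ← Fin.sum_univ_eq_sum_range
    (fun v => ∑' u : ℕ, lagWeight ((u + (v + 1) : ℕ) : ℤ))]
  refine Finset.sum_le_sum fun v _ => ?_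
  have hs : Summable fun u : ℕ => lagWeight ((u + ((v : ℕ) + 1) : ℕ) : ℤ) :=
    (summable_nat_add_iff (f := fun u : ℕ => lagWeight (u : ℤ)) ((v : ℕ) + 1)).mpr
      summable_lagWeight_nat
  -- Counted backwards from the cut, the point `a` before it and the point `v` after it are at lag
  -- `a + v + 1`.
  rw [← Equiv.sum_comp Fin.revPerm]
  have h1 : ∀ a : Fin p, lagWeight (((Fin.revPerm a : Fin p) : ℤ) - ((p + v : ℕ) : ℤ)) =
      lagWeight (((a : ℕ) + ((v : ℕ) + 1) : ℕ) : ℤ) := by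
    intro a
    rw [← lagWeight_neg]
    congr 1
    have := a.isLt
    simp only [Fin.revPerm_apply, Fin.val_rev]
    omega
  simp only [h1]
  rw [Fin.sum_univ_eq_sum_range (fun a => lagWeight ((a + ((v : ℕ) + 1) : ℕ) : ℤ))]
  exact hs.sum_le_tsum _ fun _ _ => lagWeight_nonneg _

/-- Only differences of points matter, so the second diagonal block is the grid matrix of the
shifted perturbation sequence. -/
lemma gridMatrix_submatrix (k : ℝ → ℝ) (ε : ℝ) (x : ℕ → ℝ) (p m : ℕ) :
    (gridMatrix k ε x (p + m)).submatrix finSumFinEquiv finSumFinEquiv =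
      Matrix.fromBlocks (gridMatrix k ε x p)
        (Matrix.of fun (a : Fin p) (v : Fin m) => k (obsPoint ε x a - obsPoint ε x (p + v)))
        (Matrix.of fun (v : Fin m) (a : Fin p) => k (obsPoint ε x (p + v) - obsPoint ε x a))
        (gridMatrix k ε (fun i => x (p + i)) m) := by
  ext i j
  rcases i with i | i <;> rcases j with j | j
  · simp [gridMatrix]
  · simp [gridMatrix]
  · simp [gridMatrix]
  · simp only [gridMatrix, Matrix.submatrix_apply, finSumFinEquiv_apply_right, Matrix.of_apply,
      Fin.val_natAdd, Matrix.fromBlocks_apply₂₂, obsPoint]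
    congr 1
    push_cast; ring

lemma sum_abs_sub_fromBlocks_le {k : ℝ → ℝ} {C ε : ℝ} {x : ℕ → ℝ}
    (h : ∀ i j : ℕ, |k (obsPoint ε x i - obsPoint ε x j)| ≤ C * lagWeight ((i : ℤ) - (j : ℤ)))
    (hC : 0 ≤ C) (p m : ℕ) :
    ∑ i, ∑ j, |((gridMatrix k ε x (p + m)).submatrix finSumFinEquiv finSumFinEquiv -
      Matrix.fromBlocks (gridMatrix k ε x p) 0 0 (gridMatrix k ε (fun i => x (p + i)) m)) i j| ≤
        2 * C * cutWeight m := by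
  rw [gridMatrix_submatrix]
  simp only [Fintype.sum_sum_type, Matrix.sub_apply, Matrix.fromBlocks_apply₁₁,
    Matrix.fromBlocks_apply₁₂, Matrix.fromBlocks_apply₂₁, Matrix.fromBlocks_apply₂₂, sub_self,
    abs_zero, Finset.sum_const_zero, zero_add, add_zero, Matrix.zero_apply, sub_zero,
    Matrix.of_apply]
  have h1 : ∑ a : Fin p, ∑ v : Fin m, |k (obsPoint ε x a - obsPoint ε x (p + v))| ≤
      C * cutWeight m := by
    refine le_trans ?_ (mul_le_mul_of_nonneg_left (sum_sum_lagWeight_le p m) hC)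
    simp only [Finset.mul_sum]
    exact Finset.sum_le_sum fun a _ => Finset.sum_le_sum fun v _ => h a (p + v)
  have h2 : ∑ v : Fin m, ∑ a : Fin p, |k (obsPoint ε x (p + v) - obsPoint ε x a)| ≤
      C * cutWeight m := by
    rw [Finset.sum_comm]
    refine le_trans ?_ (mul_le_mul_of_nonneg_left (sum_sum_lagWeight_le p m) hC)
    simp only [Finset.mul_sum]
    refine Finset.sum_le_sum fun a _ => Finset.sum_le_sum fun v _ => ?_
    rw [← lagWeight_neg, neg_sub]
    exact h (p + v) a
  linarith

/-- Cutting the last `m` points off the grid changes the trace functional by at most a multiple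
of `cutWeight m`. -/
lemma GridBounds.abs_mlTrace_cut_le {k k' : ℝ → ℝ} {b δ C : ℝ} (h : GridBounds k k' b δ C)
    {ε : ℝ} (hε : ε ∈ Icc 0 b) {x : ℕ → ℝ} (hx : Admissible x) (p m : ℕ) :
    |mlTrace (gridMatrix k ε x (p + m)) (gridMatrix k' ε x (p + m)) -
      mlTrace (gridMatrix k ε x p) (gridMatrix k' ε x p) -
      mlTrace (gridMatrix k ε (fun i => x (p + i)) m) (gridMatrix k' ε (fun i => x (p + i)) m)| ≤
        8 * C ^ 6 * cutWeight m := by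
  have hx' := hx.shift p
  have hC0 : 0 ≤ C := by linarith [h.one_le]
  have u1 := (h.coercive ε hε x hx p).isUnit_det h.pos
  have u2 := (h.coercive ε hε _ hx' m).isUnit_det h.pos
  have u3 := (h.coercive ε hε x hx (p + m)).isUnit_det h.pos
  have n1 := ((h.coercive ε hε x hx p).norm_inv_le h.pos).trans h.inv_le
  have n2 := ((h.coercive ε hε _ hx' m).norm_inv_le h.pos).trans h.inv_le
  have n3 := ((h.coercive ε hε x hx (p + m)).norm_inv_le h.pos).trans h.inv_le
  -- The two separate traces form the trace of a block diagonal pair, which differs from the full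
  -- pair only in the interaction blocks.
  rw [sub_sub, ← mlTrace_fromBlocks u1 u2, ← mlTrace_submatrix _ _ finSumFinEquiv]
  refine (abs_mlTrace_sub_le (C := C) h.one_le ?_ ?_ ?_ ?_ ?_ ?_).trans ?_
  · rwa [Matrix.det_submatrix_equiv_self]
  · rw [Matrix.det_fromBlocks_zero₂₁]; exact u1.mul u2
  · rw [Matrix.inv_submatrix_equiv]; exact (norm_submatrix_equiv_le _ _).trans n3
  · rw [inv_fromBlocks_diag u1 u2]; exact norm_fromBlocks_diag_le n1 n2
  · exact (norm_submatrix_equiv_le _ _).trans (h.norm_le ε hε x hx _).2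
  · exact norm_fromBlocks_diag_le (h.norm_le ε hε x hx _).2 (h.norm_le ε hε _ hx' _).2
  · have e1 := sum_abs_sub_fromBlocks_le (fun i j => (h.entry ε hε x hx i j).1) hC0 p m
    have e2 := sum_abs_sub_fromBlocks_le (fun i j => (h.entry ε hε x hx i j).2) hC0 p m
    calc _ ≤ 2 * C ^ 5 * (2 * C * cutWeight m + 2 * C * cutWeight m) := by gcongr
      _ = _ := by ring

lemma GridBounds.abs_mlTrace_le {k k' : ℝ → ℝ} {b δ C : ℝ} (h : GridBounds k k' b δ C)
    {ε : ℝ} (hε : ε ∈ Icc 0 b) {x : ℕ → ℝ} (hx : Admissible x) (n : ℕ) :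
    |mlTrace (gridMatrix k ε x n) (gridMatrix k' ε x n)| ≤ C ^ 4 * n := by
  have n1 := ((h.coercive ε hε x hx n).norm_inv_le h.pos).trans h.inv_le
  have n2 := (h.norm_le ε hε x hx n).2
  have h1 := norm_trace_le ((gridMatrix k ε x n)⁻¹ * gridMatrix k' ε x n * (gridMatrix k ε x n)⁻¹ *
    gridMatrix k' ε x n)
  have hmul : ∀ {A B : Matrix (Fin n) (Fin n) ℝ} {a b : ℝ}, ‖A‖ ≤ a → ‖B‖ ≤ b → ‖A * B‖ ≤ a * b :=
    fun ha hb => (norm_mul_le _ _).trans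
      (mul_le_mul ha hb (norm_nonneg _) ((norm_nonneg _).trans ha))
  have h2 := hmul (hmul (hmul n1 n2) n1) n2
  rw [Fintype.card_fin] at h1
  refine h1.trans ?_
  rw [mul_comm]
  refine mul_le_mul_of_nonneg_right (h2.trans (le_of_eq (by ring))) (by positivity)

end Cut

/-! ### Law of large numbers for almost additive functionals -/

section AlmostAdditive

/-- A Cauchy criterion with approximate limits `e m` of precision `η m`. It gives convergence of
block averages here, and of derivatives of jets further on. -/
lemma exists_tendsto_of_forall_eventually_le {u e η : ℕ → ℝ} (hη : Tendsto η atTop (𝓝 0))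
    (h : ∀ m, 1 ≤ m → ∀ ε > 0, ∀ᶠ n in atTop, |u n - e m| ≤ η m + ε) :
    ∃ l, Tendsto u atTop (𝓝 l) ∧ ∀ m, 1 ≤ m → |l - e m| ≤ η m := by
  have hc : CauchySeq u := by
    rw [Metric.cauchySeq_iff']
    intro ε hε
    obtain ⟨m, hm1, hm⟩ := ((eventually_ge_atTop 1).and
      (hη.eventually (gt_mem_nhds (show (0 : ℝ) < ε / 4 by positivity)))).exists
    obtain ⟨N, hN⟩ := eventually_atTop.mp (h m hm1 (ε / 8) (by positivity))
    refine ⟨N, fun n hn => ?_⟩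
    have h1 := abs_le.mp (hN n hn)
    have h2 := abs_le.mp (hN N le_rfl)
    rw [Real.dist_eq, abs_lt]
    constructor <;> linarith [h1.1, h1.2, h2.1, h2.2]
  obtain ⟨l, hl⟩ := cauchySeq_tendsto_of_complete hc
  refine ⟨l, hl, fun m hm => le_of_forall_pos_le_add fun ε hε => ?_⟩
  exact le_of_tendsto (hl.sub_const (e m)).abs (h m hm ε hε)

variable {H : ℕ → (ℕ → ℝ) → ℝ} {L : ℕ → ℝ} {C : ℝ} {x : ℕ → ℝ}

/-- Blocks are peeled off the end one at a time; each costs `L m`, since the cutting bound depends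
only on the length of the last piece. -/
lemma abs_sub_sum_blocks_le (hx : Admissible x)
    (hcut : ∀ x, Admissible x → ∀ p m, |H (p + m) x - H p x - H m (fun i => x (p + i))| ≤ L m)
    (h0 : ∀ x, Admissible x → H 0 x = 0) (m N : ℕ) :
    |H (N * m) x - ∑ k ∈ Finset.range N, H m (fun i => x (k * m + i))| ≤ N * L m := by
  induction N with
  | zero => simp [h0 x hx]
  | succ N ih =>
    have h1 := hcut x hx (N * m) m
    rw [Finset.sum_range_succ, show (N + 1) * m = N * m + m by ring]
    have := abs_add_le (H (N * m) x - ∑ k ∈ Finset.range N, H m (fun i => x (k * m + i)))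
      (H (N * m + m) x - H (N * m) x - H m (fun i => x (N * m + i)))
    push_cast
    calc _ = |H (N * m) x - ∑ k ∈ Finset.range N, H m (fun i => x (k * m + i)) +
          (H (N * m + m) x - H (N * m) x - H m (fun i => x (N * m + i)))| := by congr 1; ring
      _ ≤ _ := by linarith

lemma tendsto_div_div_atTop {m : ℕ} (hm : 1 ≤ m) :
    Tendsto (fun n : ℕ => ((n / m : ℕ) : ℝ) / n) atTop (𝓝 (1 / m)) := by
  have h := (tendsto_nat_floor_div_atTop (R := ℝ)).comp
    ((tendsto_natCast_atTop_atTop (R := ℝ)).atTop_div_const (show (0 : ℝ) < m by exact_mod_cast hm))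
  have h2 := h.const_mul (1 / (m : ℝ))
  rw [mul_one] at h2
  refine h2.congr fun n => ?_
  simp only [Function.comp, Nat.floor_div_natCast, Nat.floor_natCast]
  have : (m : ℝ) ≠ 0 := by exact_mod_cast (by omega : m ≠ 0)
  rcases Nat.eq_zero_or_pos n with h0 | h0
  · subst h0; simp
  have : (n : ℝ) ≠ 0 := by exact_mod_cast h0.ne'
  field_simp

/-- Almost additivity compares the averages with the averages over blocks of length `m`. -/
lemma eventually_abs_div_sub_le (hx : Admissible x)
    (hcut : ∀ x, Admissible x → ∀ p m, |H (p + m) x - H p x - H m (fun i => x (p + i))| ≤ L m)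
    (hC : ∀ x, Admissible x → ∀ m, |H m x| ≤ C * m) (hL : ∀ m, 0 ≤ L m)
    {m : ℕ} (hm : 1 ≤ m) {E : ℝ}
    (hlln : Tendsto (fun N : ℕ => (∑ k ∈ Finset.range N, H m (fun i => x (k * m + i))) / N) atTop
      (𝓝 E)) {ε : ℝ} (hε : 0 < ε) :
    ∀ᶠ n : ℕ in atTop, |H n x / n - E / m| ≤ L m / m + ε := by
  have h0 : ∀ x, Admissible x → H 0 x = 0 := fun x hx => by simpa using hC x hx 0
  have hm0 : (0 : ℝ) < m := by exact_mod_cast hm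
  have hC0 : 0 ≤ C := by
    have := (abs_nonneg _).trans (hC x hx 1)
    simpa using this
  -- This constant absorbs the incomplete last block, of length `n % m`: its own value and the cost
  -- of cutting it off.
  set B := C * m + ∑ r ∈ Finset.range m, L r with hB
  have key : ∀ n : ℕ, |H n x - ∑ k ∈ Finset.range (n / m), H m (fun i => x (k * m + i))| ≤
      ((n / m : ℕ) : ℝ) * L m + B := by
    intro n
    have h1 := abs_sub_sum_blocks_le hx hcut h0 m (n / m)
    have h2 := hcut x hx (n / m * m) (n % m)
    rw [Nat.div_add_mod'] at h2
    have h3 := hC _ (hx.shift (n / m * m)) (n % m)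
    have hr : n % m < m := Nat.mod_lt _ hm
    have h4 : L (n % m) ≤ ∑ r ∈ Finset.range m, L r :=
      Finset.single_le_sum (fun r _ => hL r) (Finset.mem_range.mpr hr)
    have h5 : C * ((n % m : ℕ) : ℝ) ≤ C * m :=
      mul_le_mul_of_nonneg_left (by exact_mod_cast hr.le) hC0
    rw [abs_le] at h1 h2 h3 ⊢
    constructor <;> linarith [h1.1, h1.2, h2.1, h2.2, h3.1, h3.2]
  have hdm := tendsto_div_div_atTop hm
  have hN : Tendsto (fun n : ℕ => n / m) atTop atTop := Nat.tendsto_div_const_atTop (by omega)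
  have t1 : Tendsto (fun n : ℕ => (∑ k ∈ Finset.range (n / m), H m (fun i => x (k * m + i))) / n)
      atTop (𝓝 (E / m)) := by
    have := (hlln.comp hN).mul hdm
    rw [mul_one_div] at this
    refine this.congr' ?_
    filter_upwards [hN.eventually_ge_atTop 1] with n hn
    have hne : ((n / m : ℕ) : ℝ) ≠ 0 := by exact_mod_cast (by omega : n / m ≠ 0)
    simp only [Function.comp]
    rw [div_mul_div_comm, mul_comm ((n / m : ℕ) : ℝ) (n : ℝ), mul_div_mul_right _ _ hne]
  have t2 : Tendsto (fun n : ℕ => ((n / m : ℕ) : ℝ) / n * L m + B / n) atTop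
      (𝓝 (1 / m * L m + 0)) :=
    (hdm.mul_const _).add (tendsto_const_nhds.div_atTop tendsto_natCast_atTop_atTop)
  have t3 := (t1.sub_const (E / m)).abs
  rw [sub_self, abs_zero] at t3
  have e1 := t3.eventually (gt_mem_nhds (half_pos hε))
  have e2 := t2.eventually (gt_mem_nhds (show 1 / (m : ℝ) * L m + 0 < L m / m + ε / 2 by
    rw [add_zero, one_div_mul_eq_div]; linarith))
  filter_upwards [e1, e2, eventually_ge_atTop 1] with n h1 h2 hn
  have hn0 : (0 : ℝ) < n := by exact_mod_cast hn
  have h3 : |H n x / n - (∑ k ∈ Finset.range (n / m), H m (fun i => x (k * m + i))) / n| ≤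
      ((n / m : ℕ) : ℝ) / n * L m + B / n := by
    rw [← sub_div, abs_div, abs_of_pos hn0, div_mul_eq_mul_div, ← add_div]
    exact div_le_div_of_nonneg_right (key n) hn0.le
  have h4 := abs_add_le (H n x / n - (∑ k ∈ Finset.range (n / m), H m (fun i => x (k * m + i))) / n)
    ((∑ k ∈ Finset.range (n / m), H m (fun i => x (k * m + i))) / n - E / m)
  rw [sub_add_sub_cancel] at h4
  linarith

variable {Ω : Type*} [MeasurableSpace Ω] {P : Measure Ω} [IsProbabilityMeasure P]
  {X : ℕ → Ω → ℝ}

lemma integrable_of_admissible (hXm : ∀ i, Measurable (X i))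
    (hXa : ∀ᵐ ω ∂P, Admissible fun i => X i ω) {h : (ℕ → ℝ) → ℝ} (hmeas : Measurable h) {B : ℝ}
    (hB : ∀ x, Admissible x → |h x| ≤ B) : Integrable (fun ω => h fun i => X i ω) P := by
  refine Integrable.of_bound (C := B)
    (hmeas.comp (measurable_pi_lambda _ hXm)).aestronglyMeasurable ?_
  filter_upwards [hXa] with ω hω using hB _ hω

/-- A functional of the first `m` coordinates, evaluated on disjoint blocks, gives pairwise
independent and identically distributed bounded variables. -/
lemma tendsto_block_average (hXm : ∀ i, Measurable (X i)) (hXi : iIndepFun X P)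
    (hXd : ∀ i, P.map (X i) = P.map (X 0)) (hXa : ∀ᵐ ω ∂P, Admissible fun i => X i ω)
    {m : ℕ} {h : (ℕ → ℝ) → ℝ} (hmeas : Measurable h)
    (hloc : ∀ x y, (∀ i < m, x i = y i) → h x = h y) {B : ℝ} (hB : ∀ x, Admissible x → |h x| ≤ B) :
    ∀ᵐ ω ∂P, Tendsto (fun N : ℕ => (∑ k ∈ Finset.range N, h (fun i => X (k * m + i) ω)) / N) atTop
      (𝓝 (∫ ω, h (fun i => X i ω) ∂P)) := by
  -- Extension by zero turns `h` into a measurable function of `m` variables; locality makes the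
  -- added values immaterial.
  set ext : (Fin m → ℝ) → ℕ → ℝ := fun z i => if hi : i < m then z ⟨i, hi⟩ else 0 with hext
  have hext_meas : Measurable ext := by
    refine measurable_pi_lambda _ fun i => ?_
    by_cases hi : i < m
    · simp only [hext, hi, dite_true]; exact measurable_pi_apply _
    · simp only [hext, hi, dite_false]; exact measurable_const
  set Z : ℕ → Ω → Fin m → ℝ := fun k ω i => X (k * m + i) ω with hZ
  have hYZ : ∀ k, (fun ω => h fun i => X (k * m + i) ω) = (h ∘ ext) ∘ Z k := by
    intro k
    funext ω
    refine hloc _ _ fun i hi => ?_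
    simp [hext, hZ, hi]
  have hφ : Measurable (h ∘ ext) := hmeas.comp hext_meas
  have hZm : ∀ k, Measurable (Z k) := fun k => measurable_pi_lambda _ fun i => hXm _
  have hZlaw : ∀ k, P.map (Z k) = Measure.pi fun _ : Fin m => P.map (X 0) := by
    intro k
    have hinj : Function.Injective fun i : Fin m => k * m + (i : ℕ) := fun a b hab => by
      apply Fin.ext; simpa using hab
    have := (hXi.precomp hinj).map_fun_eq_pi_map (fun i => (hXm _).aemeasurable)
    simp only [hXd] at this
    exact this
  have hindep : Pairwise fun k l => IndepFun (fun ω => h fun i => X (k * m + i) ω)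
      (fun ω => h fun i => X (l * m + i) ω) P := by
    intro k l hkl
    have hdisj : Disjoint (Finset.Ico (k * m) (k * m + m)) (Finset.Ico (l * m) (l * m + m)) := by
      rw [Finset.disjoint_left]
      intro a ha hb
      rw [Finset.mem_Ico] at ha hb
      rcases lt_or_gt_of_ne hkl with h1 | h1
      · have : (k + 1) * m ≤ l * m := Nat.mul_le_mul_right _ h1
        rw [Nat.succ_mul] at this
        omega
      · have : (l + 1) * m ≤ k * m := Nat.mul_le_mul_right _ h1
        rw [Nat.succ_mul] at this
        omega
    have h1 := hXi.indepFun_finset _ _ hdisj hXm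
    have hψ : ∀ k : ℕ, ∃ ψ : (Finset.Ico (k * m) (k * m + m) → ℝ) → ℝ, Measurable ψ ∧
        (fun ω => h fun i => X (k * m + i) ω) =
          ψ ∘ fun ω (i : Finset.Ico (k * m) (k * m + m)) => X i ω := by
      intro k
      have hmem : ∀ i : Fin m, k * m + i ∈ Finset.Ico (k * m) (k * m + m) := fun i => by
        have := i.isLt
        rw [Finset.mem_Ico]; omega
      have hsel : Measurable fun (z : Finset.Ico (k * m) (k * m + m) → ℝ) (i : Fin m) =>
          z ⟨k * m + i, hmem i⟩ := by fun_prop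
      exact ⟨_, hφ.comp hsel, by rw [hYZ k]; rfl⟩
    obtain ⟨ψ, hψm, hψe⟩ := hψ k
    obtain ⟨ψ', hψm', hψe'⟩ := hψ l
    rw [hψe, hψe']
    exact h1.comp hψm hψm'
  have hident : ∀ k, IdentDistrib (fun ω => h fun i => X (k * m + i) ω)
      (fun ω => h fun i => X (0 * m + i) ω) P P := by
    intro k
    rw [hYZ, hYZ]
    exact IdentDistrib.comp ⟨(hZm k).aemeasurable, (hZm 0).aemeasurable, by
      rw [hZlaw k, hZlaw 0]⟩ hφ
  have hint : Integrable (fun ω => h fun i => X (0 * m + i) ω) P := by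
    simpa using integrable_of_admissible hXm hXa hmeas hB
  have := strong_law_ae_real (fun k ω => h fun i => X (k * m + i) ω) hint hindep hident
  simpa using this

/-- Averages of almost additive bounded functionals of an i.i.d. sequence converge almost surely
to a constant. -/
lemma exists_ae_tendsto_of_almost_additive (hXm : ∀ i, Measurable (X i)) (hXi : iIndepFun X P)
    (hXd : ∀ i, P.map (X i) = P.map (X 0)) (hXa : ∀ᵐ ω ∂P, Admissible fun i => X i ω)
    (hmeas : ∀ m, Measurable (H m)) (hloc : ∀ m x y, (∀ i < m, x i = y i) → H m x = H m y)
    (hcut : ∀ x, Admissible x → ∀ p m, |H (p + m) x - H p x - H m (fun i => x (p + i))| ≤ L m)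
    (hC : ∀ x, Admissible x → ∀ m, |H m x| ≤ C * m) (hL : ∀ m, 0 ≤ L m)
    (hL0 : Tendsto (fun m : ℕ => L m / m) atTop (𝓝 0)) :
    ∃ σ, ∀ᵐ ω ∂P, Tendsto (fun n : ℕ => H n (fun i => X i ω) / n) atTop (𝓝 σ) := by
  set e : ℕ → ℝ := fun m => (∫ ω, H m (fun i => X i ω) ∂P) / m with he
  have hlln : ∀ᵐ ω ∂P, ∀ m, Tendsto
      (fun N : ℕ => (∑ k ∈ Finset.range N, H m (fun i => X (k * m + i) ω)) / N) atTop
      (𝓝 (∫ ω, H m (fun i => X i ω) ∂P)) :=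
    ae_all_iff.mpr fun m => tendsto_block_average hXm hXi hXd hXa (hmeas m) (hloc m)
      fun x hx => hC x hx m
  have hlim : ∀ᵐ ω ∂P, ∃ l, Tendsto (fun n : ℕ => H n (fun i => X i ω) / n) atTop (𝓝 l) ∧
      ∀ m, 1 ≤ m → |l - e m| ≤ L m / m := by
    filter_upwards [hlln, hXa] with ω h1 h2
    exact exists_tendsto_of_forall_eventually_le hL0 fun m hm ε hε =>
      eventually_abs_div_sub_le h2 hcut hC hL hm (h1 m) hε
  -- The limit at one sample point serves for all: it is within `L m / m` of the deterministic
  -- number `e m` for every `m ≥ 1`.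
  obtain ⟨ω₀, σ, -, hσ⟩ := hlim.exists
  refine ⟨σ, ?_⟩
  filter_upwards [hlim] with ω hω
  obtain ⟨l, hl, hle⟩ := hω
  have : l = σ := by
    have h0 : Tendsto (fun m : ℕ => 2 * (L m / m)) atTop (𝓝 0) := by simpa using hL0.const_mul 2
    have h1 : |l - σ| ≤ 0 := ge_of_tendsto h0 (by
      filter_upwards [eventually_ge_atTop 1] with m hm
      have a1 := abs_le.mp (hle m hm)
      have a2 := abs_le.mp (hσ m hm)
      rw [abs_le]
      constructor <;> linarith [a1.1, a1.2, a2.1, a2.2])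
    have := abs_nonpos_iff.mp h1
    linarith
  rwa [← this]

end AlmostAdditive

/-! ### Measurability of matrix expressions -/

section Measurability

variable {α ι : Type*} [MeasurableSpace α] [Fintype ι] [DecidableEq ι]

/-- The entries of the matrix valued function `A` are measurable. -/
def MeasurableEntries (A : α → Matrix ι ι ℝ) : Prop := ∀ i j, Measurable fun a => A a i j

namespace MeasurableEntries

variable {A B : α → Matrix ι ι ℝ}

lemma add (hA : MeasurableEntries A) (hB : MeasurableEntries B) :
    MeasurableEntries fun a => A a + B a := fun i j => (hA i j).add (hB i j)

lemma neg (hA : MeasurableEntries A) : MeasurableEntries fun a => -A a := fun i j => (hA i j).neg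

lemma mul (hA : MeasurableEntries A) (hB : MeasurableEntries B) :
    MeasurableEntries fun a => A a * B a := fun i j => by
  simp only [Matrix.mul_apply]
  exact Finset.measurable_fun_sum _ fun k _ => (hA i k).mul (hB k j)

lemma det (hA : MeasurableEntries A) : Measurable fun a => (A a).det := by
  simp only [Matrix.det_apply']
  refine Finset.measurable_fun_sum _ fun σ _ => Measurable.const_mul ?_ _
  exact Finset.measurable_fun_prod _ fun i _ => hA _ _

/-- Cramer's rule; singular matrices have inverse zero, consistently with inversion in `ℝ` at a zero
determinant. -/
lemma inv (hA : MeasurableEntries A) : MeasurableEntries fun a => (A a)⁻¹ := fun i j => by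
  simp only [Matrix.inv_def, Matrix.smul_apply, Ring.inverse_eq_inv', Matrix.adjugate_apply]
  refine hA.det.inv.smul (det fun k l => ?_)
  by_cases h : k = j
  · subst h; simp only [Matrix.updateRow_self]; exact measurable_const
  · simp only [ne_eq, h, not_false_eq_true, Matrix.updateRow_ne]; exact hA k l

lemma trace (hA : MeasurableEntries A) : Measurable fun a => (A a).trace :=
  Finset.measurable_fun_sum _ fun i _ => hA i i

lemma mlTrace (hA : MeasurableEntries A) (hB : MeasurableEntries B) :
    Measurable fun a => mlTrace (A a) (B a) :=
  (((hA.inv.mul hB).mul hA.inv).mul hB).trace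

end MeasurableEntries

lemma measurableEntries_gridMatrix {k : ℝ → ℝ} (hk : Measurable k) (ε : ℝ) (n : ℕ) :
    MeasurableEntries fun x : ℕ → ℝ => gridMatrix k ε x n := fun i j => by
  simp only [gridMatrix, Matrix.of_apply, obsPoint]
  exact hk.comp (by fun_prop)

end Measurability

/-! ### Existence of the likelihood variance on perturbed grids -/

section Existence

variable {Ω : Type*} [MeasurableSpace Ω] {P : Measure Ω} [IsProbabilityMeasure P]
  {X : ℕ → Ω → ℝ}

lemma GridBounds.exists_ae_tendsto {k k' : ℝ → ℝ} {b δ C : ℝ} (h : GridBounds k k' b δ C)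
    (hk : Measurable k) (hk' : Measurable k') (hXm : ∀ i, Measurable (X i)) (hXi : iIndepFun X P)
    (hXd : ∀ i, P.map (X i) = P.map (X 0)) (hXa : ∀ᵐ ω ∂P, Admissible fun i => X i ω)
    {ε : ℝ} (hε : ε ∈ Icc 0 b) :
    ∃ σ, ∀ᵐ ω ∂P, Tendsto (fun n : ℕ => (1 / (n : ℝ)) *
      (matML (gridMatrix k ε (fun i => X i ω) n) (gridMatrix k' ε (fun i => X i ω) n)).trace)
      atTop (𝓝 σ) := by
  have hC : 0 ≤ C := by linarith [h.one_le]
  obtain ⟨σ, hσ⟩ := exists_ae_tendsto_of_almost_additive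
    (H := fun n x => mlTrace (gridMatrix k ε x n) (gridMatrix k' ε x n))
    (L := fun m => 8 * C ^ 6 * cutWeight m) hXm hXi hXd hXa
    (fun m => (measurableEntries_gridMatrix hk ε m).mlTrace (measurableEntries_gridMatrix hk' ε m))
    (fun m x y hxy => by
      have : ∀ k : ℝ → ℝ, gridMatrix k ε x m = gridMatrix k ε y m := fun k => by
        ext i j
        simp [gridMatrix, obsPoint, hxy i i.isLt, hxy j j.isLt]
      rw [this, this])
    (fun x hx p m => h.abs_mlTrace_cut_le hε hx p m)
    (fun x hx m => h.abs_mlTrace_le hε hx m)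
    (fun m => mul_nonneg (by positivity) (cutWeight_nonneg m))
    (by simpa [mul_div_assoc] using tendsto_cutWeight_div.const_mul (8 * C ^ 6))
  refine ⟨1 / 2 * σ, ?_⟩
  filter_upwards [hσ] with ω hω
  refine (hω.const_mul (1 / 2)).congr fun n => ?_
  rw [trace_matML]
  ring

end Existence

/-! ### Calculus of first order jets -/

section FirstJets

variable {𝔸 : Type*} [NormedRing 𝔸] [NormedAlgebra ℝ 𝔸] {I : Set ℝ} {C D : ℝ} {A A' B B' : ℝ → 𝔸}

/-- `A'` is the derivative of `A` on `I`, with bounds `C` on `A`, on `A'` and on the quadratic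
remainder. -/
structure FirstJet {E : Type*} [NormedAddCommGroup E] [NormedSpace ℝ E] (I : Set ℝ) (C : ℝ)
    (A A' : ℝ → E) : Prop where
  bound : ∀ s ∈ I, ‖A s‖ ≤ C
  bound' : ∀ s ∈ I, ‖A' s‖ ≤ C
  remainder : ∀ s ∈ I, ∀ t ∈ I, ‖A t - A s - (t - s) • A' s‖ ≤ C * (t - s) ^ 2

namespace FirstJet

lemma mono {E : Type*} [NormedAddCommGroup E] [NormedSpace ℝ E] {A A' : ℝ → E}
    (h : FirstJet I C A A') (hCD : C ≤ D) : FirstJet I D A A' :=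
  ⟨fun s hs => (h.bound s hs).trans hCD, fun s hs => (h.bound' s hs).trans hCD,
    fun s hs t ht => (h.remainder s hs t ht).trans (by gcongr)⟩

lemma norm_diff_le (h : FirstJet I C A A') (hI : ∀ s ∈ I, ∀ t ∈ I, |t - s| ≤ 1) {s t : ℝ}
    (hs : s ∈ I) (ht : t ∈ I) : ‖A t - A s‖ ≤ 2 * C * |t - s| := by
  have hC : 0 ≤ C := (norm_nonneg _).trans (h.bound s hs)
  have h1 := h.remainder s hs t ht
  have h2 : ‖(t - s) • A' s‖ ≤ |t - s| * C := by
    rw [norm_smul, Real.norm_eq_abs]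
    exact mul_le_mul_of_nonneg_left (h.bound' s hs) (abs_nonneg _)
  have h3 : (t - s) ^ 2 ≤ |t - s| := by
    rw [← sq_abs]
    nlinarith [hI s hs t ht, abs_nonneg (t - s)]
  calc ‖A t - A s‖ = ‖(A t - A s - (t - s) • A' s) + (t - s) • A' s‖ := by congr 1; abel
    _ ≤ C * (t - s) ^ 2 + |t - s| * C := (norm_add_le _ _).trans (add_le_add h1 h2)
    _ ≤ _ := by nlinarith

lemma add (hA : FirstJet I C A A') (hB : FirstJet I D B B') :
    FirstJet I (C + D) (fun s => A s + B s) (fun s => A' s + B' s) := by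
  refine ⟨fun s hs => (norm_add_le _ _).trans (add_le_add (hA.bound s hs) (hB.bound s hs)),
    fun s hs => (norm_add_le _ _).trans (add_le_add (hA.bound' s hs) (hB.bound' s hs)),
    fun s hs t ht => ?_⟩
  have h : A t + B t - (A s + B s) - (t - s) • (A' s + B' s) =
      (A t - A s - (t - s) • A' s) + (B t - B s - (t - s) • B' s) := by
    rw [smul_add]; abel
  rw [h, add_mul]
  exact (norm_add_le _ _).trans (add_le_add (hA.remainder s hs t ht) (hB.remainder s hs t ht))

lemma neg (hA : FirstJet I C A A') : FirstJet I C (fun s => -A s) (fun s => -A' s) := by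
  refine ⟨fun s hs => by rw [norm_neg]; exact hA.bound s hs,
    fun s hs => by rw [norm_neg]; exact hA.bound' s hs, fun s hs t ht => ?_⟩
  have h : -A t - -A s - (t - s) • -A' s = -(A t - A s - (t - s) • A' s) := by
    rw [smul_neg]; abel
  rw [h, norm_neg]
  exact hA.remainder s hs t ht

/-- The remainder splits into each factor's remainder times the other factor, plus the product of
two first order increments, which is again quadratic. -/
lemma mul (hI : ∀ s ∈ I, ∀ t ∈ I, |t - s| ≤ 1) (hA : FirstJet I C A A') (hB : FirstJet I D B B') :
    FirstJet I (4 * C * D) (fun s => A s * B s) (fun s => A' s * B s + A s * B' s) := by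
  have hm : ∀ {a b : 𝔸} {c d : ℝ}, ‖a‖ ≤ c → ‖b‖ ≤ d → ‖a * b‖ ≤ c * d := fun ha hb =>
    (norm_mul_le _ _).trans (mul_le_mul ha hb (norm_nonneg _) ((norm_nonneg _).trans ha))
  refine ⟨fun s hs => ?_, fun s hs => ?_, fun s hs t ht => ?_⟩
  · have hC : 0 ≤ C := (norm_nonneg _).trans (hA.bound s hs)
    have hD : 0 ≤ D := (norm_nonneg _).trans (hB.bound s hs)
    exact (hm (hA.bound s hs) (hB.bound s hs)).trans (by nlinarith [mul_nonneg hC hD])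
  · have hC : 0 ≤ C := (norm_nonneg _).trans (hA.bound s hs)
    have hD : 0 ≤ D := (norm_nonneg _).trans (hB.bound s hs)
    exact ((norm_add_le _ _).trans (add_le_add (hm (hA.bound' s hs) (hB.bound s hs))
      (hm (hA.bound s hs) (hB.bound' s hs)))).trans (by nlinarith [mul_nonneg hC hD])
  · have h : A t * B t - A s * B s - (t - s) • (A' s * B s + A s * B' s) =
        (A t - A s - (t - s) • A' s) * B t + A s * (B t - B s - (t - s) • B' s) +
          (t - s) • A' s * (B t - B s) := by
      simp only [sub_mul, mul_sub, smul_add, smul_mul_assoc, mul_smul_comm]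
      abel
    rw [h]
    have h1 := hm (hA.remainder s hs t ht) (hB.bound t ht)
    have h2 := hm (hA.bound s hs) (hB.remainder s hs t ht)
    have h3 : ‖(t - s) • A' s‖ ≤ |t - s| * C := by
      rw [norm_smul, Real.norm_eq_abs]
      exact mul_le_mul_of_nonneg_left (hA.bound' s hs) (abs_nonneg _)
    have h4 := hm h3 (hB.norm_diff_le hI hs ht)
    refine ((norm_add_le _ _).trans (add_le_add ((norm_add_le _ _).trans (add_le_add h1 h2))
      h4)).trans (le_of_eq ?_)
    rw [← sq_abs (t - s)]; ring

/-- The identity `B t - B s = -B t (A t - A s) B s` shows that `B` is Lipschitz. Used a second time,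
it leaves the remainder of `A`, at cost `C ^ 3`, and a product of increments, at cost `2 * C ^ 5`.
-/
lemma inv (hI : ∀ s ∈ I, ∀ t ∈ I, |t - s| ≤ 1) (hC : 1 ≤ C) (hA : FirstJet I C A A')
    (hB : ∀ s ∈ I, ‖B s‖ ≤ C) (hAB : ∀ s ∈ I, A s * B s = 1) (hBA : ∀ s ∈ I, B s * A s = 1) :
    FirstJet I (3 * C ^ 5) B (fun s => -(B s * A' s * B s)) := by
  have hm : ∀ {a b : 𝔸} {c d : ℝ}, ‖a‖ ≤ c → ‖b‖ ≤ d → ‖a * b‖ ≤ c * d := fun ha hb =>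
    (norm_mul_le _ _).trans (mul_le_mul ha hb (norm_nonneg _) ((norm_nonneg _).trans ha))
  have h15 : C ^ 1 ≤ C ^ 5 := pow_le_pow_right₀ hC (by norm_num)
  have h35 : C ^ 3 ≤ C ^ 5 := pow_le_pow_right₀ hC (by norm_num)
  have h0 : 0 ≤ C ^ 5 := by positivity
  rw [pow_one] at h15
  have hdiff : ∀ s ∈ I, ∀ t ∈ I, B t - B s = -(B t * (A t - A s) * B s) := by
    intro s hs t ht
    rw [mul_sub, sub_mul, hBA t ht, one_mul, mul_assoc, hAB s hs, mul_one]
    abel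
  refine ⟨fun s hs => (hB s hs).trans (by linarith), fun s hs => ?_, fun s hs t ht => ?_⟩
  · rw [norm_neg]
    exact (hm (hm (hB s hs) (hA.bound' s hs)) (hB s hs)).trans (by nlinarith)
  · have h : B t - B s - (t - s) • -(B s * A' s * B s) =
        -(B t * (A t - A s - (t - s) • A' s) * B s) -
          (B t - B s) * ((t - s) • A' s) * B s := by
      set Y := (t - s) • A' s with hY
      have h1 : (t - s) • -(B s * A' s * B s) = -(B s * Y * B s) := by
        simp only [hY, smul_neg, smul_mul_assoc, mul_smul_comm]
      have h2 : -(B t * (A t - A s - Y) * B s) - (B t - B s) * Y * B s =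
          -(B t * (A t - A s) * B s) + B s * Y * B s := by noncomm_ring
      rw [h1, h2, ← hdiff s hs t ht, sub_neg_eq_add]
    rw [h]
    have e1 := hm (hm (hB t ht) (hA.remainder s hs t ht)) (hB s hs)
    have e2 : ‖B t - B s‖ ≤ C * (2 * C * |t - s|) * C := by
      rw [hdiff s hs t ht, norm_neg]
      exact hm (hm (hB t ht) (hA.norm_diff_le hI hs ht)) (hB s hs)
    have e3 : ‖(t - s) • A' s‖ ≤ |t - s| * C := by
      rw [norm_smul, Real.norm_eq_abs]
      exact mul_le_mul_of_nonneg_left (hA.bound' s hs) (abs_nonneg _)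
    have e4 := hm (hm e2 e3) (hB s hs)
    refine (norm_sub_le _ _).trans ?_
    rw [norm_neg]
    refine (add_le_add e1 e4).trans ?_
    rw [← sq_abs (t - s)]
    have h5 : C ^ 3 * |t - s| ^ 2 ≤ C ^ 5 * |t - s| ^ 2 :=
      mul_le_mul_of_nonneg_right h35 (by positivity)
    nlinarith

/-- First order jets of real functions are preserved by pointwise limits. -/
lemma exists_limit {φ φ' : ℕ → ℝ → ℝ} {σ : ℝ → ℝ} {b : ℝ} (hb : 0 < b)
    (h : ∀ n, FirstJet (Icc 0 b) C (φ n) (φ' n))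
    (hσ : ∀ s ∈ Icc 0 b, Tendsto (fun n => φ n s) atTop (𝓝 (σ s))) :
    ∃ σ', (∀ s ∈ Icc 0 b, Tendsto (fun n => φ' n s) atTop (𝓝 (σ' s))) ∧
      FirstJet (Icc 0 b) C σ σ' := by
  have key : ∀ s ∈ Icc 0 b, ∃ l, Tendsto (fun n => φ' n s) atTop (𝓝 l) := by
    intro s hs
    -- An increment directed towards the farther end point, so that `s + d m` stays in `[0, b]`.
    set d : ℕ → ℝ := fun m => if s ≤ b / 2 then b / 2 / m else -(b / 2 / m) with hd
    have hdabs : ∀ m, |d m| = b / 2 / m := fun m => by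
      simp only [hd]
      split_ifs
      · exact abs_of_nonneg (by positivity)
      · rw [abs_neg]; exact abs_of_nonneg (by positivity)
    have hd0 : Tendsto (fun m => C * |d m|) atTop (𝓝 0) := by
      simp only [hdabs]
      simpa using (tendsto_const_nhds.div_atTop tendsto_natCast_atTop_atTop :
        Tendsto (fun m : ℕ => b / 2 / (m : ℝ)) atTop (𝓝 0)).const_mul C
    -- Convergence of the derivatives is a conclusion: the difference quotients of `φ n` are within
    -- `C * |d m|` of the derivative uniformly in `n`, and for fixed `m` they converge.
    obtain ⟨l, hl, -⟩ := exists_tendsto_of_forall_eventually_le (u := fun n => φ' n s)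
      (e := fun m => (σ (s + d m) - σ s) / d m) hd0 fun m hm ε hε => by
        have hm0 : (0 : ℝ) < m := by exact_mod_cast hm
        have hdne : d m ≠ 0 := by
          rw [← abs_pos, hdabs]; positivity
        have hle : b / 2 / (m : ℝ) ≤ b / 2 :=
          div_le_self (by positivity) (by exact_mod_cast hm)
        have hpos : 0 < b / 2 / (m : ℝ) := by positivity
        have hmem : s + d m ∈ Icc 0 b := by
          simp only [hd]
          split_ifs with h1
          · constructor <;> linarith [hs.1, hs.2]
          · push Not at h1; constructor <;> linarith [hs.1, hs.2]
        have ht := (((hσ _ hmem).sub (hσ s hs)).div_const (d m)).sub_const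
          ((σ (s + d m) - σ s) / d m)
        rw [sub_self] at ht
        have ht2 := ht.abs
        rw [abs_zero] at ht2
        filter_upwards [ht2.eventually (gt_mem_nhds hε)] with n hn
        have hr := (h n).remainder s hs _ hmem
        rw [add_sub_cancel_left, smul_eq_mul, Real.norm_eq_abs] at hr
        have h2 : |φ' n s - (φ n (s + d m) - φ n s) / d m| ≤ C * |d m| := by
          have h3 : φ' n s - (φ n (s + d m) - φ n s) / d m =
              -((φ n (s + d m) - φ n s - d m * φ' n s) / d m) := by field_simp; ring
          rw [h3, abs_neg, abs_div, div_le_iff₀ (abs_pos.mpr hdne)]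
          rw [← sq_abs] at hr
          linarith
        have h4 := abs_add_le (φ' n s - (φ n (s + d m) - φ n s) / d m)
          ((φ n (s + d m) - φ n s) / d m - (σ (s + d m) - σ s) / d m)
        rw [sub_add_sub_cancel] at h4
        linarith
    exact ⟨l, hl⟩
  choose! σ' hσ' using key
  refine ⟨σ', hσ', fun s hs => ?_, fun s hs => ?_, fun s hs t ht => ?_⟩
  · exact le_of_tendsto (hσ s hs).norm (Eventually.of_forall fun n => (h n).bound s hs)
  · exact le_of_tendsto (hσ' s hs).norm (Eventually.of_forall fun n => (h n).bound' s hs)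
  · exact le_of_tendsto (((hσ t ht).sub (hσ s hs)).sub ((hσ' s hs).const_smul (t - s))).norm
      (Eventually.of_forall fun n => (h n).remainder s hs t ht)

lemma hasDerivWithinAt {σ σ' : ℝ → ℝ} (h : FirstJet I C σ σ') {s : ℝ} (hs : s ∈ I) :
    HasDerivWithinAt σ (σ' s) I s := by
  rw [hasDerivWithinAt_iff_isLittleO]
  have h1 : (fun t => σ t - σ s - (t - s) • σ' s) =O[𝓝[I] s] fun t => (t - s) ^ 2 := by
    refine Asymptotics.IsBigO.of_bound C ?_
    filter_upwards [self_mem_nhdsWithin] with t ht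
    rw [Real.norm_of_nonneg (sq_nonneg (t - s))]
    exact h.remainder s hs t ht
  refine h1.trans_isLittleO ?_
  have h2 : Tendsto (fun t => t - s) (𝓝[I] s) (𝓝 0) := by
    have : Tendsto (fun t => t - s) (𝓝 s) (𝓝 (s - s)) := (continuous_id.sub continuous_const).tendsto s
    rw [sub_self] at this
    exact this.mono_left nhdsWithin_le_nhds
  have h3 := (Asymptotics.isLittleO_one_iff ℝ).mpr h2
  have h4 := h3.mul_isBigO (Asymptotics.isBigO_refl (fun t => t - s) (𝓝[I] s))
  simpa [sq] using h4

/-- First order jets of random functions are preserved by expectations. -/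
lemma integral {Ω : Type*} [MeasurableSpace Ω] {P : Measure Ω} [IsProbabilityMeasure P]
    {g g' : Ω → ℝ → ℝ} (h : ∀ᵐ ω ∂P, FirstJet I C (g ω) (g' ω))
    (hg : ∀ s, AEStronglyMeasurable (fun ω => g ω s) P)
    (hg' : ∀ s, AEStronglyMeasurable (fun ω => g' ω s) P) :
    FirstJet I C (fun s => ∫ ω, g ω s ∂P) (fun s => ∫ ω, g' ω s ∂P) := by
  have i1 : ∀ s ∈ I, Integrable (fun ω => g ω s) P := fun s hs =>
    Integrable.of_bound (hg s) C (by filter_upwards [h] with ω hω using hω.bound s hs)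
  have i2 : ∀ s ∈ I, Integrable (fun ω => g' ω s) P := fun s hs =>
    Integrable.of_bound (hg' s) C (by filter_upwards [h] with ω hω using hω.bound' s hs)
  refine ⟨fun s hs => ?_, fun s hs => ?_, fun s hs t ht => ?_⟩
  · simpa using norm_integral_le_of_norm_le_const (μ := P) (f := fun ω => g ω s) (C := C)
      (by filter_upwards [h] with ω hω using hω.bound s hs)
  · simpa using norm_integral_le_of_norm_le_const (μ := P) (f := fun ω => g' ω s) (C := C)
      (by filter_upwards [h] with ω hω using hω.bound' s hs)
  · have h1 : (∫ ω, g ω t ∂P) - (∫ ω, g ω s ∂P) - (t - s) • ∫ ω, g' ω s ∂P =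
        ∫ ω, (g ω t - g ω s - (t - s) • g' ω s) ∂P := by
      rw [integral_sub (f := fun ω => g ω t - g ω s) (g := fun ω => (t - s) • g' ω s)
        ((i1 t ht).sub (i1 s hs)) ((i2 s hs).smul (t - s)), integral_sub (i1 t ht) (i1 s hs), integral_smul]
    rw [h1]
    simpa using norm_integral_le_of_norm_le_const (μ := P)
      (f := fun ω => g ω t - g ω s - (t - s) • g' ω s) (C := C * (t - s) ^ 2)
      (by filter_upwards [h] with ω hω using hω.remainder s hs t ht)

end FirstJet

/-- First order Taylor formula with a bound on the second derivative. -/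
lemma abs_taylor_le {φ φ₁ φ₂ : ℝ → ℝ} {p q M : ℝ}
    (h₁ : ∀ s ∈ Icc p q, HasDerivAt φ (φ₁ s) s) (h₂ : ∀ s ∈ Icc p q, HasDerivAt φ₁ (φ₂ s) s)
    (hM : ∀ s ∈ Icc p q, |φ₂ s| ≤ M) {s t : ℝ} (hs : s ∈ Icc p q) (ht : t ∈ Icc p q) :
    |φ t - φ s - (t - s) * φ₁ s| ≤ M * (t - s) ^ 2 := by
  have hM0 : 0 ≤ M := (abs_nonneg _).trans (hM s hs)
  have hsub : uIcc s t ⊆ Icc p q := uIcc_subset_Icc hs ht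
  have h3 : ∀ r ∈ uIcc s t, ‖φ₁ r - φ₁ s‖ ≤ M * |t - s| := by
    intro r hr
    have := (convex_Icc p q).norm_image_sub_le_of_norm_hasDerivWithin_le
      (fun y hy => (h₂ y hy).hasDerivWithinAt) hM hs (hsub hr)
    refine this.trans (mul_le_mul_of_nonneg_left ?_ hM0)
    rw [Real.norm_eq_abs]
    exact abs_sub_left_of_mem_uIcc hr
  have h4 := (convex_uIcc s t).norm_image_sub_le_of_norm_hasDerivWithin_le
    (f := fun r => φ r - (r - s) * φ₁ s) (f' := fun r => φ₁ r - φ₁ s)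
    (fun y hy => by
      have h5 : HasDerivAt (fun r => (r - s) * φ₁ s) (1 * φ₁ s) y :=
        ((hasDerivAt_id y).sub_const s).mul_const _
      rw [one_mul] at h5
      exact ((h₁ y (hsub hy)).sub h5).hasDerivWithinAt) h3 left_mem_uIcc right_mem_uIcc
  rw [Real.norm_eq_abs, Real.norm_eq_abs] at h4
  rw [← sq_abs (t - s)]
  have e : φ t - φ s - (t - s) * φ₁ s = φ t - (t - s) * φ₁ s - (φ s - (s - s) * φ₁ s) := by ring
  rw [e]
  linarith

end FirstJets

/-! ### Uniform jets of grid matrices in the regularity parameter -/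

section JetMatrices

open scoped Matrix.Norms.L2Operator Matrix

/-- The entrywise `q`-th derivative in `ε` of a grid matrix, where `u` is the `q`-th derivative of
the kernel. -/
def jetMatrix (q : ℕ) (u : ℝ → ℝ) (n : ℕ) (x : ℕ → ℝ) (ε : ℝ) : Matrix (Fin n) (Fin n) ℝ :=
  Matrix.of fun i j => (x i - x j) ^ q * u (obsPoint ε x i - obsPoint ε x j)

lemma jetMatrix_zero (k : ℝ → ℝ) (n : ℕ) (x : ℕ → ℝ) (ε : ℝ) :
    jetMatrix 0 k n x ε = gridMatrix k ε x n := by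
  ext; simp [jetMatrix, gridMatrix]

/-- A family of matrix valued functions with first order jets on `[0, b]`, uniformly in the
dimension and in the perturbation. -/
def UniformJet (b : ℝ) (A A' : ∀ n : ℕ, (ℕ → ℝ) → ℝ → Matrix (Fin n) (Fin n) ℝ) : Prop :=
  ∃ C, 1 ≤ C ∧ ∀ n x, Admissible x → FirstJet (Icc 0 b) C (A n x) (A' n x)

namespace UniformJet

variable {b : ℝ} {A A' B B' : ∀ n : ℕ, (ℕ → ℝ) → ℝ → Matrix (Fin n) (Fin n) ℝ}

lemma add (hA : UniformJet b A A') (hB : UniformJet b B B') :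
    UniformJet b (fun n x s => A n x s + B n x s) (fun n x s => A' n x s + B' n x s) := by
  obtain ⟨C, hC, hA⟩ := hA
  obtain ⟨D, hD, hB⟩ := hB
  exact ⟨C + D, by linarith, fun n x hx => (hA n x hx).add (hB n x hx)⟩

lemma neg (hA : UniformJet b A A') :
    UniformJet b (fun n x s => -A n x s) (fun n x s => -A' n x s) := by
  obtain ⟨C, hC, hA⟩ := hA
  exact ⟨C, hC, fun n x hx => (hA n x hx).neg⟩

lemma smul (c : ℝ) (hA : UniformJet b A A') :
    UniformJet b (fun n x s => c • A n x s) (fun n x s => c • A' n x s) := by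
  obtain ⟨C, hC, hA⟩ := hA
  have h0 : 0 ≤ C := by linarith
  have hmax : C ≤ max |c| 1 * C := le_mul_of_one_le_left h0 (le_max_right _ _)
  refine ⟨max |c| 1 * C, hC.trans hmax, fun n x hx => ⟨fun s hs => ?_, fun s hs => ?_,
    fun s hs t ht => ?_⟩⟩
  · rw [norm_smul]
    exact mul_le_mul (le_max_left _ _) ((hA n x hx).bound s hs) (norm_nonneg _) (by positivity)
  · rw [norm_smul]
    exact mul_le_mul (le_max_left _ _) ((hA n x hx).bound' s hs) (norm_nonneg _) (by positivity)
  · rw [smul_comm (t - s) c, ← smul_sub, ← smul_sub, norm_smul, mul_assoc]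
    exact mul_le_mul (le_max_left _ _) ((hA n x hx).remainder s hs t ht) (norm_nonneg _)
      (by positivity)

lemma mul (hb : b ≤ 1) (hA : UniformJet b A A') (hB : UniformJet b B B') :
    UniformJet b (fun n x s => A n x s * B n x s)
      (fun n x s => A' n x s * B n x s + A n x s * B' n x s) := by
  obtain ⟨C, hC, hA⟩ := hA
  obtain ⟨D, hD, hB⟩ := hB
  refine ⟨4 * C * D, by nlinarith, fun n x hx => (hA n x hx).mul (fun s hs t ht => ?_) (hB n x hx)⟩
  rw [abs_le]; constructor <;> linarith [hs.1, hs.2, ht.1, ht.2]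

lemma inv (hb : b ≤ 1) (hA : UniformJet b A A')
    (hinv : ∃ D, ∀ n x, Admissible x → ∀ s ∈ Icc 0 b, IsUnit (A n x s).det ∧ ‖(A n x s)⁻¹‖ ≤ D) :
    UniformJet b (fun n x s => (A n x s)⁻¹)
      (fun n x s => -((A n x s)⁻¹ * A' n x s * (A n x s)⁻¹)) := by
  obtain ⟨C, hC, hA⟩ := hA
  obtain ⟨D, hD⟩ := hinv
  have hM : 1 ≤ max C D := hC.trans (le_max_left _ _)
  refine ⟨3 * max C D ^ 5, by nlinarith [one_le_pow₀ hM (n := 5)], fun n x hx =>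
    ((hA n x hx).mono (le_max_left C D)).inv (fun s hs t ht => ?_) hM
      (fun s hs => (hD n x hx s hs).2.trans (le_max_right _ _))
      (fun s hs => Matrix.mul_nonsing_inv _ (hD n x hx s hs).1)
      (fun s hs => Matrix.nonsing_inv_mul _ (hD n x hx s hs).1)⟩
  rw [abs_le]; constructor <;> linarith [hs.1, hs.2, ht.1, ht.2]

/-- Normalised traces of uniform jets. -/
lemma trace (hA : UniformJet b A A') : ∃ C, ∀ (n : ℕ) x, Admissible x → FirstJet (Icc 0 b) C
    (fun s => (1 / (n : ℝ)) * (A n x s).trace) (fun s => (1 / (n : ℝ)) * (A' n x s).trace) := by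
  obtain ⟨C, hC, hA⟩ := hA
  have key : ∀ {n : ℕ} (T : Matrix (Fin n) (Fin n) ℝ), ‖(1 / (n : ℝ)) * T.trace‖ ≤ ‖T‖ := by
    intro n T
    have h := norm_trace_le T
    rw [Fintype.card_fin] at h
    rw [norm_mul, norm_div, norm_one, Real.norm_natCast, one_div_mul_eq_div]
    exact div_le_of_le_mul₀ (by positivity) (norm_nonneg _) (by rwa [mul_comm])
  refine ⟨C, fun n x hx => ⟨fun s hs => (key _).trans ((hA n x hx).bound s hs),
    fun s hs => (key _).trans ((hA n x hx).bound' s hs), fun s hs t ht => ?_⟩⟩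
  refine le_trans (le_of_eq ?_) ((key _).trans ((hA n x hx).remainder s hs t ht))
  rw [Matrix.trace_sub, Matrix.trace_sub, Matrix.trace_smul]
  congr 1
  simp only [smul_eq_mul]
  ring

end UniformJet

/-- Off the diagonal the arguments stay at distance at least `1 - 2 * b` from `0`, where the kernel
is smooth with summable derivatives. Taylor's formula then bounds the remainder entrywise, and
Schur's test transfers the bound to the operator norm. -/
lemma uniformJet_jetMatrix {q : ℕ} {u u₁ u₂ : ℝ → ℝ} {b C : ℝ} (hC : 0 ≤ C) (hb : b < 1 / 2)
    (h₁ : ∀ t, t ≠ 0 → HasDerivAt u (u₁ t) t) (h₂ : ∀ t, t ≠ 0 → HasDerivAt u₁ (u₂ t) t)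
    (h0 : |0 ^ q * u 0| ≤ C)
    (hbd : ∀ t, 1 - 2 * b ≤ |t| → |u t| ≤ C / (1 + |t| ^ 2) ∧ |u₁ t| ≤ C / (1 + |t| ^ 2) ∧
      |u₂ t| ≤ C / (1 + |t| ^ 2)) :
    UniformJet b (jetMatrix q u) (jetMatrix (q + 1) u₁) := by
  by_cases hb0 : 0 ≤ b
  swap
  · refine ⟨1, le_rfl, fun n x _ => ⟨fun s hs => ?_, fun s hs => ?_, fun s hs => ?_⟩⟩ <;>
    exact absurd (hs.1.trans hs.2) hb0
  set τ := 1 - 2 * b with hτ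
  have hτ0 : 0 < τ := by linarith
  have hτ1 : τ ≤ 1 := by linarith
  -- The power covers the factors `(x i - x j) ^ r` with `r ≤ q + 2` that successive differentiation
  -- in `ε` brings out.
  set D := 2 ^ (q + 2) * (C / τ ^ 2) with hD
  have hCτ : C ≤ C / τ ^ 2 := le_div_self hC (by positivity) (pow_le_one₀ hτ0.le hτ1)
  have hD0 : 0 ≤ D := by positivity
  set Z := ∑' k, lagWeight k
  have hw0 : ∀ k, 0 ≤ D * lagWeight k := fun k => mul_nonneg hD0 (lagWeight_nonneg k)
  have hws := summable_lagWeight.mul_left D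
  have hpow : ∀ {y : ℝ} {r : ℕ}, |y| ≤ 2 → r ≤ q + 2 → ∀ {v e : ℝ}, |v| ≤ C / τ ^ 2 * e → 0 ≤ e →
      |y ^ r * v| ≤ D * e := by
    intro y r hy hr v e hv he
    rw [abs_mul, abs_pow]
    have e1 : |y| ^ r ≤ 2 ^ (q + 2) := (pow_le_pow_left₀ (abs_nonneg _) hy r).trans
      (pow_le_pow_right₀ (by norm_num) hr)
    calc _ ≤ 2 ^ (q + 2) * (C / τ ^ 2 * e) := by gcongr
      _ = D * e := by rw [hD]; ring
  have hx2 : ∀ {x : ℕ → ℝ}, Admissible x → ∀ i j, |x i - x j| ≤ 2 := fun hx i j =>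
    (abs_sub _ _).trans (by linarith [hx i, hx j])
  have hdist : ∀ {x : ℕ → ℝ}, Admissible x → ∀ s ∈ Icc 0 b, ∀ i j : ℕ,
      τ * |(((i : ℤ) - (j : ℤ) : ℤ) : ℝ)| ≤ |obsPoint s x i - obsPoint s x j| := by
    intro x hx s hs i j
    have := obsPoint_sub_ge hs hx i j
    rwa [Int.cast_abs] at this
  have hsep : ∀ {x : ℕ → ℝ}, Admissible x → ∀ s ∈ Icc 0 b, ∀ i j : ℕ, i ≠ j →
      τ ≤ |obsPoint s x i - obsPoint s x j| := by
    intro x hx s hs i j hij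
    refine le_trans ?_ (hdist hx s hs i j)
    have : (1 : ℤ) ≤ |(i : ℤ) - (j : ℤ)| := Int.one_le_abs (by omega)
    have : (1 : ℝ) ≤ |(((i : ℤ) - (j : ℤ) : ℤ) : ℝ)| := by exact_mod_cast this
    nlinarith
  have hu : ∀ {x : ℕ → ℝ}, Admissible x → ∀ s ∈ Icc 0 b, ∀ i j : ℕ, i ≠ j →
      |u (obsPoint s x i - obsPoint s x j)| ≤ C / τ ^ 2 * lagWeight ((i : ℤ) - (j : ℤ)) ∧
      |u₁ (obsPoint s x i - obsPoint s x j)| ≤ C / τ ^ 2 * lagWeight ((i : ℤ) - (j : ℤ)) ∧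
      |u₂ (obsPoint s x i - obsPoint s x j)| ≤ C / τ ^ 2 * lagWeight ((i : ℤ) - (j : ℤ)) := by
    intro x hx s hs i j hij
    obtain ⟨a1, a2, a3⟩ := hbd _ (hsep hx s hs i j hij)
    have := le_of_decay hτ0 hτ1 hC (hdist hx s hs i j)
    exact ⟨a1.trans this, a2.trans this, a3.trans this⟩
  have hdiag : lagWeight 0 = 1 := by simp [lagWeight]
  have hfin : ∀ {n : ℕ} {i j : Fin n}, i ≠ j → (i : ℕ) ≠ j := fun h h' => h (Fin.ext h')
  have hDC : C ≤ D := hCτ.trans (le_mul_of_one_le_left (by positivity) (one_le_pow₀ (by norm_num)))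
  refine ⟨max 1 (D * Z), le_max_left _ _, fun n x hx => FirstJet.mono ?_ (le_max_right _ _)⟩
  rw [← tsum_mul_left]
  refine ⟨fun s hs => opNorm_le_of_lag_bound hw0 hws fun i j => ?_,
    fun s hs => opNorm_le_of_lag_bound hw0 hws fun i j => ?_, fun s hs t ht => ?_⟩
  · by_cases hij : i = j
    · subst hij
      simp only [jetMatrix, Matrix.of_apply, sub_self, hdiag, mul_one, Real.norm_eq_abs]
      exact h0.trans hDC
    · exact hpow (hx2 hx i j) (by omega) (hu hx s hs i j (hfin hij)).1 (lagWeight_nonneg _)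
  · by_cases hij : i = j
    · subst hij
      simp [jetMatrix, hdiag, hD0]
    · exact hpow (hx2 hx i j) (by omega) (hu hx s hs i j (hfin hij)).2.1 (lagWeight_nonneg _)
  · rw [mul_comm, ← tsum_mul_left]
    refine opNorm_le_of_lag_bound (fun k => mul_nonneg (sq_nonneg _) (hw0 k))
      (hws.mul_left _) fun i j => ?_
    by_cases hij : i = j
    -- A diagonal entry does not depend on `ε`, so a lack of smoothness of the kernel at `0` is
    -- harmless.
    · subst hij
      simp only [jetMatrix, Matrix.sub_apply, Matrix.smul_apply, Matrix.of_apply, sub_self, ne_eq,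
        Nat.add_eq_zero_iff, one_ne_zero, and_false, not_false_eq_true, zero_pow, zero_mul,
        smul_zero, norm_zero]
      positivity
    · have hne : ∀ r ∈ Icc 0 b, obsPoint r x i - obsPoint r x j ≠ 0 := fun r hr => by
        rw [← abs_pos]; exact hτ0.trans_le (hsep hx r hr i j (hfin hij))
      have hd : ∀ r, HasDerivAt (fun r => obsPoint r x i - obsPoint r x j) (x i - x j) r := by
        intro r
        have e1 : ∀ i : ℕ, HasDerivAt (fun r => obsPoint r x i) (x i) r := fun i => by
          have := ((hasDerivAt_id r).mul_const (x i)).const_add ((i : ℝ) + 1)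
          simpa [obsPoint] using this
        exact (e1 i).sub (e1 j)
      have ht1 : ∀ r ∈ Icc 0 b, HasDerivAt
          (fun r => (x i - x j) ^ q * u (obsPoint r x i - obsPoint r x j))
          ((x i - x j) ^ (q + 1) * u₁ (obsPoint r x i - obsPoint r x j)) r := fun r hr => by
        have := ((h₁ _ (hne r hr)).comp r (hd r)).const_mul ((x i - x j) ^ q)
        exact this.congr_deriv (by ring)
      have ht2 : ∀ r ∈ Icc 0 b, HasDerivAt
          (fun r => (x i - x j) ^ (q + 1) * u₁ (obsPoint r x i - obsPoint r x j))
          ((x i - x j) ^ (q + 2) * u₂ (obsPoint r x i - obsPoint r x j)) r := fun r hr => by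
        have := ((h₂ _ (hne r hr)).comp r (hd r)).const_mul ((x i - x j) ^ (q + 1))
        exact this.congr_deriv (by ring)
      have := abs_taylor_le ht1 ht2 (fun r hr => hpow (hx2 hx i j) le_rfl
        (hu hx r hr i j (hfin hij)).2.2 (lagWeight_nonneg _)) hs ht
      rw [mul_comm ((t - s) ^ 2)]
      exact this

end JetMatrices

/-! ### Second derivative of the likelihood trace -/

section MLDerivatives

variable {ι : Type*} [Fintype ι] [DecidableEq ι]

/-- First derivative of `R⁻¹`. -/
noncomputable def invD₁ (R R₁ : Matrix ι ι ℝ) : Matrix ι ι ℝ := -(R⁻¹ * R₁ * R⁻¹)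

/-- Second derivative of `R⁻¹`. -/
noncomputable def invD₂ (R R₁ R₂ : Matrix ι ι ℝ) : Matrix ι ι ℝ :=
  -((invD₁ R R₁ * R₁ + R⁻¹ * R₂) * R⁻¹ + R⁻¹ * R₁ * invD₁ R R₁)

/-- First derivative of `R⁻¹ S`. -/
noncomputable def quotD₁ (R R₁ S S₁ : Matrix ι ι ℝ) : Matrix ι ι ℝ := invD₁ R R₁ * S + R⁻¹ * S₁

/-- Second derivative of `R⁻¹ S`. -/
noncomputable def quotD₂ (R R₁ R₂ S S₁ S₂ : Matrix ι ι ℝ) : Matrix ι ι ℝ :=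
  (invD₂ R R₁ R₂ * S + invD₁ R R₁ * S₁) + (invD₁ R R₁ * S₁ + R⁻¹ * S₂)

/-- First derivative of `(1 / 2) R⁻¹ S R⁻¹ S`. -/
noncomputable def mlD₁ (R R₁ S S₁ : Matrix ι ι ℝ) : Matrix ι ι ℝ :=
  (1 / 2 : ℝ) • (quotD₁ R R₁ S S₁ * (R⁻¹ * S) + R⁻¹ * S * quotD₁ R R₁ S S₁)

/-- Second derivative of `(1 / 2) R⁻¹ S R⁻¹ S`. -/
noncomputable def mlD₂ (R R₁ R₂ S S₁ S₂ : Matrix ι ι ℝ) : Matrix ι ι ℝ :=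
  (1 / 2 : ℝ) • ((quotD₂ R R₁ R₂ S S₁ S₂ * (R⁻¹ * S) + quotD₁ R R₁ S S₁ * quotD₁ R R₁ S S₁) +
    (quotD₁ R R₁ S S₁ * quotD₁ R R₁ S S₁ + R⁻¹ * S * quotD₂ R R₁ R₂ S S₁ S₂))

/-- For `W = R⁻¹ S` the trace is `Tr (W'' W) + Tr (W' W')`. Cyclicity brings each term to the form
`U A V B` or `U B`, with derivatives `U`, `V` of the matrices and `A`, `B` among three products of
`R⁻¹` and `S`. -/
lemma trace_mlD₂ {R R₁ R₂ S S₁ S₂ P B C : Matrix ι ι ℝ} (hP : R⁻¹ = P) (hC : P * S * P = C)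
    (hB : P * S * P * S * P = B) :
    (mlD₂ R R₁ R₂ S S₁ S₂).trace =
      2 * (R₁ * P * R₁ * B).trace + (R₁ * C * R₁ * C).trace - 2 * (R₁ * P * S₁ * C).trace -
        2 * (R₁ * C * S₁ * P).trace + (S₁ * P * S₁ * P).trace - (R₂ * B).trace + (S₂ * C).trace := by
  have hW₁ : quotD₁ R R₁ S S₁ = P * S₁ - P * R₁ * P * S := by
    rw [quotD₁, invD₁, hP]; noncomm_ring
  have hW₂ : quotD₂ R R₁ R₂ S S₁ S₂ = P * R₁ * P * R₁ * P * S + P * R₁ * P * R₁ * P * S -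
      P * R₂ * P * S - P * R₁ * P * S₁ - P * R₁ * P * S₁ + P * S₂ := by
    rw [quotD₂, invD₂, invD₁, hP]; noncomm_ring
  have e1 : (quotD₂ R R₁ R₂ S S₁ S₂ * (P * S)).trace = 2 * (R₁ * P * R₁ * B).trace -
      (R₂ * B).trace - 2 * (R₁ * P * S₁ * C).trace + (S₂ * C).trace := by
    have : quotD₂ R R₁ R₂ S S₁ S₂ * (P * S) =
        P * (R₁ * P * R₁ * P * S * P * S) + P * (R₁ * P * R₁ * P * S * P * S) -
        P * (R₂ * P * S * P * S) - P * (R₁ * P * S₁ * P * S) - P * (R₁ * P * S₁ * P * S) +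
        P * (S₂ * P * S) := by rw [hW₂]; noncomm_ring
    rw [this]
    simp only [Matrix.trace_add, Matrix.trace_sub, Matrix.trace_mul_comm P]
    rw [← hB, ← hC]
    simp only [Matrix.mul_assoc]
    ring
  have e2 : (quotD₁ R R₁ S S₁ * quotD₁ R R₁ S S₁).trace = (S₁ * P * S₁ * P).trace -
      2 * (R₁ * C * S₁ * P).trace + (R₁ * C * R₁ * C).trace := by
    have : quotD₁ R R₁ S S₁ * quotD₁ R R₁ S S₁ = P * (S₁ * P * S₁) - P * (S₁ * P * R₁ * P * S) -
        P * (R₁ * P * S * P * S₁) + P * (R₁ * P * S * P * R₁ * P * S) := by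
      rw [hW₁]; noncomm_ring
    have h3 : (P * (S₁ * P * R₁ * P * S)).trace = (R₁ * C * S₁ * P).trace := by
      rw [show P * (S₁ * P * R₁ * P * S) = (P * S₁ * P) * (R₁ * P * S) by noncomm_ring,
        Matrix.trace_mul_comm, ← hC]
      simp only [Matrix.mul_assoc]
    rw [this]
    simp only [Matrix.trace_add, Matrix.trace_sub]
    rw [h3]
    simp only [Matrix.trace_mul_comm P]
    rw [← hC]
    simp only [Matrix.mul_assoc]
    ring
  rw [mlD₂, hP, Matrix.trace_smul, Matrix.trace_add, Matrix.trace_add, Matrix.trace_add,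
    Matrix.trace_mul_comm (P * S), e1, e2, smul_eq_mul]
  ring

end MLDerivatives

/-! ### Expectations of traces with random perturbations -/

section Expectation

open scoped Matrix

variable {Ω : Type*} [MeasurableSpace Ω] {P : Measure Ω}

/-- `f` is integrable with integral `c`. -/
def HasExpectation (P : Measure Ω) (f : Ω → ℝ) (c : ℝ) : Prop :=
  Integrable f P ∧ ∫ ω, f ω ∂P = c

namespace HasExpectation

variable {f g : Ω → ℝ} {c d : ℝ}

lemma add (hf : HasExpectation P f c) (hg : HasExpectation P g d) :
    HasExpectation P (fun ω => f ω + g ω) (c + d) :=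
  ⟨hf.1.add hg.1, by rw [integral_add hf.1 hg.1, hf.2, hg.2]⟩

lemma sub (hf : HasExpectation P f c) (hg : HasExpectation P g d) :
    HasExpectation P (fun ω => f ω - g ω) (c - d) :=
  ⟨hf.1.sub hg.1, by rw [integral_sub hf.1 hg.1, hf.2, hg.2]⟩

lemma const_mul (a : ℝ) (hf : HasExpectation P f c) :
    HasExpectation P (fun ω => a * f ω) (a * c) :=
  ⟨hf.1.const_mul a, by rw [integral_const_mul, hf.2]⟩

lemma sum {κ : Type*} {s : Finset κ} {f : κ → Ω → ℝ} {c : κ → ℝ}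
    (h : ∀ i ∈ s, HasExpectation P (f i) (c i)) :
    HasExpectation P (fun ω => ∑ i ∈ s, f i ω) (∑ i ∈ s, c i) :=
  ⟨integrable_finsetSum _ fun i hi => (h i hi).1, by
    rw [integral_finsetSum _ fun i hi => (h i hi).1]
    exact Finset.sum_congr rfl fun i hi => (h i hi).2⟩

lemma congr (hf : HasExpectation P f c) (hfg : ∀ ω, f ω = g ω) (hcd : c = d) :
    HasExpectation P g d := by
  rw [← hcd, ← funext hfg]; exact hf

end HasExpectation

/-- The variables `X i` are uncorrelated, with second moment `1 / 3`. -/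
def SecondMoments (P : Measure Ω) (X : ℕ → Ω → ℝ) : Prop :=
  ∀ i j, HasExpectation P (fun ω => X i ω * X j ω) (if i = j then 1 / 3 else 0)

variable {X : ℕ → Ω → ℝ} {n : ℕ}

/-- The trace is `∑ M i j * N j i * X i * X j`; uncorrelatedness retains the terms `i = j`. -/
lemma SecondMoments.trace_diagonal (hX : SecondMoments P X) (M N : Matrix (Fin n) (Fin n) ℝ) :
    HasExpectation P (fun ω => (Matrix.diagonal (fun i : Fin n => X i ω) * M *
      Matrix.diagonal (fun i : Fin n => X i ω) * N).trace)
      (1 / 3 * (diagPart M * diagPart N).trace) := by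
  have h : HasExpectation P (fun ω => ∑ i : Fin n, ∑ j : Fin n,
      M i j * N j i * (X i ω * X j ω)) (∑ i : Fin n, ∑ j : Fin n,
        M i j * N j i * if (i : ℕ) = j then 1 / 3 else 0) :=
    HasExpectation.sum fun i _ => HasExpectation.sum fun j _ => (hX i j).const_mul _
  refine h.congr (fun ω => ?_) ?_
  · simp only [Matrix.trace, Matrix.diag_apply, Matrix.mul_apply (N := N), Matrix.mul_diagonal,
      Matrix.diagonal_mul]
    exact Finset.sum_congr rfl fun i _ => Finset.sum_congr rfl fun j _ => by ring
  · simp only [diagPart, Matrix.diagonal_mul_diagonal, Matrix.trace_diagonal, Matrix.diag_apply,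
      Finset.mul_sum]
    refine Finset.sum_congr rfl fun i _ => ?_
    rw [Finset.sum_eq_single i]
    · simp; ring
    · intro j _ hj
      rw [if_neg fun h => hj (Fin.ext h.symm), mul_zero]
    · simp

/-- The matrix with entries `(x i - x j)^q U i j`. -/
def perturbMatrix (q : ℕ) (x : ℕ → ℝ) (U : Matrix (Fin n) (Fin n) ℝ) : Matrix (Fin n) (Fin n) ℝ :=
  Matrix.of fun i j => (x i - x j) ^ q * U i j

/-- The first order perturbation is a commutator with a diagonal matrix. A product of two of them
thus expands into four traces of the type of `SecondMoments.trace_diagonal`. -/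
lemma perturbMatrix_one (x : ℕ → ℝ) (U : Matrix (Fin n) (Fin n) ℝ) :
    perturbMatrix 1 x U = Matrix.diagonal (fun i : Fin n => x i) * U -
      U * Matrix.diagonal (fun i : Fin n => x i) := by
  ext i j
  simp [perturbMatrix]
  ring

/-- The expectation of the trace of `U' A V' B`, where `U'` and `V'` are the first order
perturbations of `U` and `V` by centred variables of variance `1 / 3`. -/
noncomputable def perturbExpectation {n : ℕ} (U A V B : Matrix (Fin n) (Fin n) ℝ) : ℝ :=
  1 / 3 * (diagPart (U * A) * diagPart (V * B)).trace -
    1 / 3 * (diagPart (U * A * V) * diagPart B).trace -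
    1 / 3 * (diagPart A * diagPart (V * B * U)).trace +
    1 / 3 * (diagPart (A * V) * diagPart (B * U)).trace

/-- The expectation of a trace with two first order perturbations. -/
lemma SecondMoments.trace_perturb (hX : SecondMoments P X) (U A V B : Matrix (Fin n) (Fin n) ℝ) :
    HasExpectation P (fun ω => (perturbMatrix 1 (fun i => X i ω) U * A *
      perturbMatrix 1 (fun i => X i ω) V * B).trace)
      (perturbExpectation U A V B) := by
  refine ((((hX.trace_diagonal (U * A) (V * B)).sub (hX.trace_diagonal (U * A * V) B)).sub
    (hX.trace_diagonal A (V * B * U))).add (hX.trace_diagonal (A * V) (B * U))).congr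
    (fun ω => ?_) rfl
  rw [perturbMatrix_one, perturbMatrix_one]
  set D := Matrix.diagonal fun i : Fin n => X i ω
  have e : (D * U - U * D) * A * (D * V - V * D) * B = D * (U * A) * D * (V * B) -
      D * (U * A * V) * D * B - U * (D * A * D * (V * B)) + U * (D * (A * V) * D * B) := by
    noncomm_ring
  rw [e, Matrix.trace_add, Matrix.trace_sub, Matrix.trace_sub, Matrix.trace_mul_comm U,
    Matrix.trace_mul_comm U]
  simp only [Matrix.mul_assoc]

/-- The expectation of a trace with a second order perturbation. -/
lemma SecondMoments.trace_perturb_two (hX : SecondMoments P X) (U B : Matrix (Fin n) (Fin n) ℝ)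
    (hU : ∀ i, U i i = 0) :
    HasExpectation P (fun ω => (perturbMatrix 2 (fun i => X i ω) U * B).trace)
      (2 / 3 * (U * B).trace) := by
  have h : HasExpectation P (fun ω => ∑ i : Fin n, ∑ j : Fin n, U i j * B j i *
      ((X i ω * X i ω - 2 * (X i ω * X j ω)) + X j ω * X j ω)) (∑ i : Fin n, ∑ j : Fin n,
        U i j * B j i * ((1 / 3 - 2 * if (i : ℕ) = j then 1 / 3 else 0) + 1 / 3)) :=
    HasExpectation.sum fun i _ => HasExpectation.sum fun j _ => by
      have h1 := hX i i
      have h2 := hX j j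
      rw [if_pos rfl] at h1 h2
      exact ((h1.sub ((hX i j).const_mul 2)).add h2).const_mul _
  refine h.congr (fun ω => ?_) ?_
  · simp only [Matrix.trace, Matrix.diag_apply, Matrix.mul_apply, perturbMatrix, Matrix.of_apply]
    exact Finset.sum_congr rfl fun i _ => Finset.sum_congr rfl fun j _ => by ring
  · simp only [Matrix.trace, Matrix.diag_apply, Matrix.mul_apply, Finset.mul_sum]
    refine Finset.sum_congr rfl fun i _ => Finset.sum_congr rfl fun j _ => ?_
    -- The mean of `(X i - X j) ^ 2` is `2 / 3` off the diagonal and `0` on it; the vanishing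
    -- diagonal of `U` makes the factor uniform.
    by_cases hij : i = j
    · subst hij; simp [hU]
    · rw [if_neg fun h => hij (Fin.ext h)]; ring

end Expectation

/-! ### Imaginary symbols and limits of perturbed traces -/

section Limits

open scoped Matrix

/-- A sequence of real matrices with the imaginary symbol `i p`. -/
def ImagSymbol (A : ∀ n, Matrix (Fin n) (Fin n) ℝ) (p : ℝ → ℝ) : Prop :=
  HasSymbol (fun n => toComplex (A n)) (fun x => Complex.I * (p x : ℂ))

variable {A B U V : ∀ n, Matrix (Fin n) (Fin n) ℝ} {a b p q : ℝ → ℝ}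

lemma ImagSymbol.mul_real (hU : ImagSymbol U p) (hA : RealSymbol A a) :
    ImagSymbol (fun n => U n * A n) (fun x => p x * a x) :=
  ((HasSymbol.mul hU hA).congr fun x => by push_cast; ring).congr_left fun n =>
    (toComplex_mul _ _).symm

lemma RealSymbol.mul_imag (hA : RealSymbol A a) (hU : ImagSymbol U p) :
    ImagSymbol (fun n => A n * U n) (fun x => a x * p x) :=
  ((HasSymbol.mul hA hU).congr fun x => by push_cast; ring).congr_left fun n =>
    (toComplex_mul _ _).symm

lemma ImagSymbol.mul (hU : ImagSymbol U p) (hV : ImagSymbol V q) :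
    RealSymbol (fun n => U n * V n) (fun x => -(p x * q x)) :=
  ((HasSymbol.mul hU hV).congr fun x => by
    push_cast; linear_combination (p x : ℂ) * q x * Complex.I_mul_I).congr_left fun n =>
    (toComplex_mul _ _).symm

/-- The diagonal part tends to the mean of the symbol, which is zero for an odd function. -/
lemma ImagSymbol.diagPart (hU : ImagSymbol U p) (hp : Function.Periodic p (2 * Real.pi))
    (ho : ∀ x, p (-x) = -p x) : RealSymbol (fun n => diagPart (U n)) (fun _ => 0) :=
  ((HasSymbol.diagonal_diag hU).congr fun x => by
    have h : circleMean (fun x => Complex.I * (p x : ℂ)) =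
        Complex.I * circleMean (fun x => (p x : ℂ)) := by
      rw [circleMean, intervalIntegral.integral_const_mul, circleMean]; ring
    rw [h, circleMean_ofReal hp, meanVal_eq_zero_of_odd ho]; simp).congr_left fun n =>
    (toComplex_diagPart _).symm

/-- The normalised limit of the expectations of traces with two first order perturbations. -/
lemma tendsto_trace_perturb (hU : ImagSymbol U p) (hV : ImagSymbol V q) (hA : RealSymbol A a)
    (hB : RealSymbol B b) (pp : Function.Periodic p (2 * Real.pi))
    (pq : Function.Periodic q (2 * Real.pi)) (pa : Function.Periodic a (2 * Real.pi))
    (pb : Function.Periodic b (2 * Real.pi)) (op : ∀ x, p (-x) = -p x) (oq : ∀ x, q (-x) = -q x)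
    (ea : ∀ x, a (-x) = a x) (eb : ∀ x, b (-x) = b x) :
    Tendsto (fun n : ℕ => (1 / (n : ℝ)) * perturbExpectation (U n) (A n) (V n) (B n)) atTop
      (𝓝 (1 / 3 * (meanVal (fun x => p x * q x * a x) * meanVal b +
        meanVal a * meanVal (fun x => p x * q x * b x)))) := by
  unfold perturbExpectation
  have hzero : ∀ {W : ∀ n, Matrix (Fin n) (Fin n) ℝ} {g : ℝ → ℝ}, ImagSymbol W g →
      (∀ x, g (x + 2 * Real.pi) = g x) → (∀ x, g (-x) = -g x) →
      RealSymbol (fun n => diagPart (W n)) (fun _ => 0) := fun h h1 h2 => h.diagPart h1 h2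
  -- In the first and last terms each diagonal part carries a single imaginary odd symbol, so these
  -- terms vanish in the limit.
  have d1 := (hzero (hU.mul_real hA) (fun x => by simp only [pp x, pa x])
    (fun x => by rw [op, ea]; ring)).mul (hzero (hV.mul_real hB)
      (fun x => by simp only [pq x, pb x]) (fun x => by rw [oq, eb]; ring))
  have d4 := (hzero (hA.mul_imag hV) (fun x => by simp only [pq x, pa x])
    (fun x => by rw [oq, ea]; ring)).mul (hzero (hB.mul_imag hU)
      (fun x => by simp only [pp x, pb x]) (fun x => by rw [op, eb]; ring))
  -- In the two middle terms the imaginary symbols meet in one product; the sign of `i * i = -1`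
  -- cancels the minus signs of `perturbExpectation`.
  have d2 := (((hU.mul_real hA).mul hV).diagPart (fun x => by simp only [pp x, pa x, pq x])).mul
    (hB.diagPart pb)
  have d3 := (hA.diagPart pa).mul (((hV.mul_real hB).mul hU).diagPart
    (fun x => by simp only [pp x, pb x, pq x]))
  have e1 := d1.tendsto_trace fun _ => rfl
  have e2 := d2.tendsto_trace fun _ => rfl
  have e3 := d3.tendsto_trace fun _ => rfl
  have e4 := d4.tendsto_trace fun _ => rfl
  have hc : ∀ c : ℝ, meanVal (fun _ => c) = c := fun c => by
    rw [meanVal, intervalIntegral.integral_const, smul_eq_mul]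
    field_simp
    ring
  rw [hc] at e1 e2 e3 e4
  have m1 : meanVal (fun x => -(p x * a x * q x)) = -meanVal (fun x => p x * q x * a x) := by
    rw [← neg_one_mul, ← meanVal_const_mul]
    congr 1; funext x; ring
  have m2 : meanVal (fun x => -(q x * b x * p x)) = -meanVal (fun x => p x * q x * b x) := by
    rw [← neg_one_mul, ← meanVal_const_mul]
    congr 1; funext x; ring
  rw [m1] at e2
  rw [m2] at e3
  have h := ((((e1.const_mul (1 / 3)).sub (e2.const_mul (1 / 3))).sub (e3.const_mul (1 / 3))).add
    (e4.const_mul (1 / 3)))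
  refine (h.congr fun n => ?_).trans (le_of_eq ?_)
  · ring
  · congr 1; ring

end Limits

/-! ### Limit of the expected second derivative at the regular grid -/

section SecondDerivativeLimit

open scoped Matrix

variable {Ω : Type*} [MeasurableSpace Ω] {P : Measure Ω} {X : ℕ → Ω → ℝ}
  {R S U V U₂ V₂ : ∀ n, Matrix (Fin n) (Fin n) ℝ} {f g p q p₂ q₂ : ℝ → ℝ}

lemma SymbolPair.inv_mul_inv_mul_inv (h : SymbolPair R S f g) :
    RealSymbol (fun n => (R n)⁻¹ * S n * (R n)⁻¹ * S n * (R n)⁻¹) (fun x => g x ^ 2 / f x ^ 3) :=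
  ((h.inv_mul_inv.mul h.right).mul h.inv).congr fun x => by
    have := h.ne_zero x
    field_simp

/-- The limit of the normalised expectation of the second derivative at the regular grid. -/
lemma SymbolPair.exists_tendsto_expectation (h : SymbolPair R S f g) (hX : SecondMoments P X)
    (hU : ImagSymbol U p) (hV : ImagSymbol V q) (hU₂ : RealSymbol U₂ p₂) (hV₂ : RealSymbol V₂ q₂)
    (dU₂ : ∀ n i, U₂ n i i = 0) (dV₂ : ∀ n i, V₂ n i i = 0)
    (pp : Function.Periodic p (2 * Real.pi)) (pq : Function.Periodic q (2 * Real.pi))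
    (pp₂ : Function.Periodic p₂ (2 * Real.pi)) (pq₂ : Function.Periodic q₂ (2 * Real.pi))
    (op : ∀ x, p (-x) = -p x) (oq : ∀ x, q (-x) = -q x)
    (ef : ∀ x, f (-x) = f x) (eg : ∀ x, g (-x) = g x) :
    ∃ e : ℕ → ℝ, (∀ n, HasExpectation P (fun ω =>
      (mlD₂ (R n) (perturbMatrix 1 (fun i => X i ω) (U n)) (perturbMatrix 2 (fun i => X i ω) (U₂ n))
        (S n) (perturbMatrix 1 (fun i => X i ω) (V n))
        (perturbMatrix 2 (fun i => X i ω) (V₂ n))).trace) (e n)) ∧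
      Tendsto (fun n : ℕ => (1 / (n : ℝ)) * e n) atTop (𝓝
        ((2 / 3) * meanVal (fun x => g x / f x ^ 2) * meanVal (fun x => p x ^ 2 * g x / f x ^ 2)
          - (4 / 3) * meanVal (fun x => 1 / f x) * meanVal (fun x => q x * p x * g x / f x ^ 2)
          - (4 / 3) * meanVal (fun x => g x / f x ^ 2) * meanVal (fun x => q x * p x / f x)
          + (2 / 3) * meanVal (fun x => 1 / f x) * meanVal (fun x => p x ^ 2 * g x ^ 2 / f x ^ 3)
          + (2 / 3) * meanVal (fun x => g x ^ 2 / f x ^ 3) * meanVal (fun x => p x ^ 2 / f x)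
          - (2 / 3) * meanVal (fun x => p₂ x * g x ^ 2 / f x ^ 3)
          + (2 / 3) * meanVal (fun x => 1 / f x) * meanVal (fun x => q x ^ 2 / f x)
          + (2 / 3) * meanVal (fun x => q₂ x * g x / f x ^ 2))) := by
  have hP : RealSymbol (fun n => (R n)⁻¹) (fun x => 1 / f x) :=
    h.inv.congr fun x => (one_div _).symm
  have hC := h.inv_mul_inv
  have hB := h.inv_mul_inv_mul_inv
  have pP : Function.Periodic (fun x => 1 / f x) (2 * Real.pi) := fun x => by
    simp only [h.periodic_left x]
  have pC : Function.Periodic (fun x => g x / f x ^ 2) (2 * Real.pi) := fun x => by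
    simp only [h.periodic_left x, h.periodic_right x]
  have pB : Function.Periodic (fun x => g x ^ 2 / f x ^ 3) (2 * Real.pi) := fun x => by
    simp only [h.periodic_left x, h.periodic_right x]
  have eP : ∀ x, (fun x => 1 / f x) (-x) = (fun x => 1 / f x) x := fun x => by simp only [ef]
  have eC : ∀ x, (fun x => g x / f x ^ 2) (-x) = (fun x => g x / f x ^ 2) x := fun x => by
    simp only [ef, eg]
  have eB : ∀ x, (fun x => g x ^ 2 / f x ^ 3) (-x) = (fun x => g x ^ 2 / f x ^ 3) x := fun x => by
    simp only [ef, eg]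
  -- The third and fourth limits coincide and each enters with factor `2`, which gives `4 / 3`. In
  -- the second and fifth the two summands are equal, which gives `2 / 3`.
  have t1 := tendsto_trace_perturb hU hU hP hB pp pp pP pB op op eP eB
  have t2 := tendsto_trace_perturb hU hU hC hC pp pp pC pC op op eC eC
  have t3 := tendsto_trace_perturb hU hV hP hC pp pq pP pC op oq eP eC
  have t4 := tendsto_trace_perturb hU hV hC hP pp pq pC pP op oq eC eP
  have t5 := tendsto_trace_perturb hV hV hP hP pq pq pP pP oq oq eP eP
  have t6 := (hU₂.mul hB).tendsto_trace fun x => by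
    simp only [pp₂ x, h.periodic_left x, h.periodic_right x]
  have t7 := (hV₂.mul hC).tendsto_trace fun x => by
    simp only [pq₂ x, h.periodic_left x, h.periodic_right x]
  refine ⟨fun n => 2 * perturbExpectation (U n) (R n)⁻¹ (U n)
        ((R n)⁻¹ * S n * (R n)⁻¹ * S n * (R n)⁻¹)
      + perturbExpectation (U n) ((R n)⁻¹ * S n * (R n)⁻¹) (U n) ((R n)⁻¹ * S n * (R n)⁻¹)
      - 2 * perturbExpectation (U n) (R n)⁻¹ (V n) ((R n)⁻¹ * S n * (R n)⁻¹)
      - 2 * perturbExpectation (U n) ((R n)⁻¹ * S n * (R n)⁻¹) (V n) (R n)⁻¹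
      + perturbExpectation (V n) (R n)⁻¹ (V n) (R n)⁻¹
      - 2 / 3 * (U₂ n * ((R n)⁻¹ * S n * (R n)⁻¹ * S n * (R n)⁻¹)).trace
      + 2 / 3 * (V₂ n * ((R n)⁻¹ * S n * (R n)⁻¹)).trace, fun n => ?_, ?_⟩
  · exact ((((((((hX.trace_perturb _ _ _ _).const_mul 2).add (hX.trace_perturb _ _ _ _)).sub
      ((hX.trace_perturb _ _ _ _).const_mul 2)).sub ((hX.trace_perturb _ _ _ _).const_mul 2)).add
      (hX.trace_perturb _ _ _ _)).sub (hX.trace_perturb_two _ _ (dU₂ n))).add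
      (hX.trace_perturb_two _ _ (dV₂ n))).congr (fun ω => (trace_mlD₂ rfl rfl rfl).symm) rfl
  · have m1 : (fun x => p x * p x * (1 / f x)) = fun x => p x ^ 2 / f x := by funext x; ring
    have m2 : (fun x => p x * p x * (g x ^ 2 / f x ^ 3)) = fun x => p x ^ 2 * g x ^ 2 / f x ^ 3 := by
      funext x; ring
    have m3 : (fun x => p x * p x * (g x / f x ^ 2)) = fun x => p x ^ 2 * g x / f x ^ 2 := by
      funext x; ring
    have m4 : (fun x => p x * q x * (1 / f x)) = fun x => q x * p x / f x := by funext x; ring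
    have m5 : (fun x => p x * q x * (g x / f x ^ 2)) = fun x => q x * p x * g x / f x ^ 2 := by
      funext x; ring
    have m6 : (fun x => q x * q x * (1 / f x)) = fun x => q x ^ 2 / f x := by funext x; ring
    have m7 : (fun x => p₂ x * (g x ^ 2 / f x ^ 3)) = fun x => p₂ x * g x ^ 2 / f x ^ 3 := by
      funext x; ring
    have m8 : (fun x => q₂ x * (g x / f x ^ 2)) = fun x => q₂ x * g x / f x ^ 2 := by
      funext x; ring
    rw [m1, m2] at t1
    rw [m3] at t2
    rw [m4, m5] at t3 t4
    rw [m6] at t5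
    rw [m7] at t6
    rw [m8] at t7
    have t := ((((((t1.const_mul 2).add t2).sub (t3.const_mul 2)).sub (t4.const_mul 2)).add t5).sub
      (t6.const_mul (2 / 3))).add (t7.const_mul (2 / 3))
    exact (t.congr fun n => by ring).trans (le_of_eq (by congr 1; ring))

end SecondDerivativeLimit

/-! ### Jets and measurability of the likelihood matrix -/

section MLJets

open scoped Matrix.Norms.L2Operator Matrix

variable {b : ℝ} {R R₁ R₂ S S₁ S₂ : ∀ n : ℕ, (ℕ → ℝ) → ℝ → Matrix (Fin n) (Fin n) ℝ}

/-- The Leibniz and inverse rules for jets are applied twice; `mlD₁` and `mlD₂` are bracketed as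
these rules produce them. -/
lemma uniformJet_ml (hb : b ≤ 1) (hR : UniformJet b R R₁) (hR₁ : UniformJet b R₁ R₂)
    (hS : UniformJet b S S₁) (hS₁ : UniformJet b S₁ S₂)
    (hinv : ∃ D, ∀ n x, Admissible x → ∀ s ∈ Icc 0 b, IsUnit (R n x s).det ∧ ‖(R n x s)⁻¹‖ ≤ D) :
    UniformJet b (fun n x s => matML (R n x s) (S n x s))
      (fun n x s => mlD₁ (R n x s) (R₁ n x s) (S n x s) (S₁ n x s)) ∧
    UniformJet b (fun n x s => mlD₁ (R n x s) (R₁ n x s) (S n x s) (S₁ n x s))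
      (fun n x s => mlD₂ (R n x s) (R₁ n x s) (R₂ n x s) (S n x s) (S₁ n x s) (S₂ n x s)) := by
  have hP : UniformJet b (fun n x s => (R n x s)⁻¹) (fun n x s => invD₁ (R n x s) (R₁ n x s)) :=
    hR.inv hb hinv
  have hP₁ : UniformJet b (fun n x s => invD₁ (R n x s) (R₁ n x s))
      (fun n x s => invD₂ (R n x s) (R₁ n x s) (R₂ n x s)) :=
    (((hP.mul hb hR₁).mul hb hP).neg)
  have hW := hP.mul hb hS
  have hW₁ := (hP₁.mul hb hS).add (hP.mul hb hS₁)
  refine ⟨?_, ((hW₁.mul hb hW).add (hW.mul hb hW₁)).smul (1 / 2)⟩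
  have h := (hW.mul hb hW).smul (1 / 2)
  have e : (fun (n : ℕ) (x : ℕ → ℝ) (s : ℝ) => matML (R n x s) (S n x s)) = fun n x s =>
      (1 / 2 : ℝ) • ((R n x s)⁻¹ * S n x s * ((R n x s)⁻¹ * S n x s)) := by
    funext n x s
    rw [matML, Matrix.mul_assoc ((R n x s)⁻¹ * S n x s)]
  rw [e]
  exact h

lemma MeasurableEntries.smul {α ι : Type*} [MeasurableSpace α] {A : α → Matrix ι ι ℝ}
    (hA : MeasurableEntries A) (c : ℝ) : MeasurableEntries fun a => c • A a :=
  fun i j => (hA i j).const_mul c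

lemma measurableEntries_jetMatrix {u : ℝ → ℝ} (hu : Measurable u) (q n : ℕ) (s : ℝ) :
    MeasurableEntries fun x : ℕ → ℝ => jetMatrix q u n x s := fun i j => by
  simp only [jetMatrix, Matrix.of_apply, obsPoint]
  exact Measurable.mul (by fun_prop) (hu.comp (by fun_prop))

variable {α ι : Type*} [MeasurableSpace α] [Fintype ι] [DecidableEq ι]
  {A A₁ A₂ B B₁ B₂ : α → Matrix ι ι ℝ}

lemma MeasurableEntries.invD₁ (hA : MeasurableEntries A) (hA₁ : MeasurableEntries A₁) :
    MeasurableEntries fun a => invD₁ (A a) (A₁ a) := ((hA.inv.mul hA₁).mul hA.inv).neg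

lemma MeasurableEntries.invD₂ (hA : MeasurableEntries A) (hA₁ : MeasurableEntries A₁)
    (hA₂ : MeasurableEntries A₂) : MeasurableEntries fun a => invD₂ (A a) (A₁ a) (A₂ a) :=
  (((((hA.invD₁ hA₁).mul hA₁).add (hA.inv.mul hA₂)).mul hA.inv).add
    ((hA.inv.mul hA₁).mul (hA.invD₁ hA₁))).neg

lemma MeasurableEntries.quotD₁ (hA : MeasurableEntries A) (hA₁ : MeasurableEntries A₁)
    (hB : MeasurableEntries B) (hB₁ : MeasurableEntries B₁) :
    MeasurableEntries fun a => quotD₁ (A a) (A₁ a) (B a) (B₁ a) :=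
  ((hA.invD₁ hA₁).mul hB).add (hA.inv.mul hB₁)

lemma MeasurableEntries.quotD₂ (hA : MeasurableEntries A) (hA₁ : MeasurableEntries A₁)
    (hA₂ : MeasurableEntries A₂) (hB : MeasurableEntries B) (hB₁ : MeasurableEntries B₁)
    (hB₂ : MeasurableEntries B₂) :
    MeasurableEntries fun a => quotD₂ (A a) (A₁ a) (A₂ a) (B a) (B₁ a) (B₂ a) :=
  (((hA.invD₂ hA₁ hA₂).mul hB).add ((hA.invD₁ hA₁).mul hB₁)).add
    (((hA.invD₁ hA₁).mul hB₁).add (hA.inv.mul hB₂))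

lemma MeasurableEntries.mlD₁ (hA : MeasurableEntries A) (hA₁ : MeasurableEntries A₁)
    (hB : MeasurableEntries B) (hB₁ : MeasurableEntries B₁) :
    MeasurableEntries fun a => mlD₁ (A a) (A₁ a) (B a) (B₁ a) :=
  MeasurableEntries.smul (((hA.quotD₁ hA₁ hB hB₁).mul (hA.inv.mul hB)).add
    ((hA.inv.mul hB).mul (hA.quotD₁ hA₁ hB hB₁))) _

lemma MeasurableEntries.mlD₂ (hA : MeasurableEntries A) (hA₁ : MeasurableEntries A₁)
    (hA₂ : MeasurableEntries A₂) (hB : MeasurableEntries B) (hB₁ : MeasurableEntries B₁)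
    (hB₂ : MeasurableEntries B₂) :
    MeasurableEntries fun a => mlD₂ (A a) (A₁ a) (A₂ a) (B a) (B₁ a) (B₂ a) :=
  MeasurableEntries.smul ((((hA.quotD₂ hA₁ hA₂ hB hB₁ hB₂).mul (hA.inv.mul hB)).add
    ((hA.quotD₁ hA₁ hB hB₁).mul (hA.quotD₁ hA₁ hB hB₁))).add
    (((hA.quotD₁ hA₁ hB hB₁).mul (hA.quotD₁ hA₁ hB hB₁)).add
      ((hA.inv.mul hB).mul (hA.quotD₂ hA₁ hA₂ hB hB₁ hB₂)))) _

end MLJets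

/-! ### From jets on compact intervals to derivatives -/

section TwiceDifferentiable

/-- Uniform first order jets of a function and of its derivative on the intervals `[0, b]` give
differentiability on `[0, c)` and a second derivative at `0`. -/
lemma differentiableOn_and_hasDerivWithinAt_of_firstJet {σ : ℝ → ℝ} {L c : ℝ} (hc : 0 < c)
    (h : ∀ b, 0 < b → b < c → ∃ σ₁ σ₂ C D, FirstJet (Icc 0 b) C σ σ₁ ∧
      FirstJet (Icc 0 b) D σ₁ σ₂ ∧ σ₂ 0 = L) :
    DifferentiableOn ℝ σ (Ico 0 c) ∧
      HasDerivWithinAt (derivWithin σ (Ico 0 c)) L (Ico 0 c) 0 := by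
  have hmem : ∀ {b s : ℝ}, 0 ≤ s → s < b → Icc 0 b ∈ 𝓝[Ico 0 c] s := by
    intro b s hs hsb
    filter_upwards [self_mem_nhdsWithin, nhdsWithin_le_nhds (gt_mem_nhds hsb)] with t h1 h2
    exact ⟨h1.1, h2.le⟩
  constructor
  · intro s hs
    obtain ⟨b, hb1, hb2⟩ := exists_between hs.2
    obtain ⟨σ₁, σ₂, C, D, h1, -, -⟩ := h b (hs.1.trans_lt hb1) hb2
    exact ((h1.hasDerivWithinAt ⟨hs.1, hb1.le⟩).mono_of_mem_nhdsWithin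
      (hmem hs.1 hb1)).differentiableWithinAt
  · obtain ⟨b, hb1, hb2⟩ := exists_between hc
    obtain ⟨σ₁, σ₂, C, D, h1, h2, h3⟩ := h b hb1 hb2
    -- The candidate `σ₁` depends on `b`, but it is the actual derivative on `[0, b)`, which
    -- suffices near `0`.
    have hd : ∀ s, 0 ≤ s → s < b → derivWithin σ (Ico 0 c) s = σ₁ s := fun s hs hsb =>
      ((h1.hasDerivWithinAt ⟨hs, hsb.le⟩).mono_of_mem_nhdsWithin (hmem hs hsb)).derivWithin
        ((uniqueDiffOn_Ico 0 c) s ⟨hs, hsb.trans hb2⟩)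
    have h4 := (h2.hasDerivWithinAt (left_mem_Icc.mpr hb1.le)).mono_of_mem_nhdsWithin
      (hmem le_rfl hb1)
    rw [h3] at h4
    refine h4.congr_of_eventuallyEq ?_ (hd 0 le_rfl hb1)
    filter_upwards [self_mem_nhdsWithin, nhdsWithin_le_nhds (gt_mem_nhds hb1)] with t a1 a2
    exact hd t a1.1 a2

end TwiceDifferentiable

/-! ### Lattice sequences as Toeplitz symbols -/

section LatticeSequences

lemma summable_abs_of_le_exp {s : ℤ → ℝ} {C a : ℝ} (ha : 0 < a)
    (h : ∀ i : ℤ, |s i| ≤ C * Real.exp (-a * |(i : ℝ)|)) : Summable fun i => |s i| := by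
  have h1 : Summable fun n : ℕ => C * Real.exp (-a * n) := by
    have := (summable_geometric_of_lt_one (Real.exp_nonneg (-a))
      (Real.exp_lt_one_iff.2 (neg_neg_of_pos ha))).mul_left C
    refine this.congr fun n => ?_
    rw [← Real.exp_nat_mul, mul_comm (n : ℝ)]
  refine Summable.of_nonneg_of_le (fun i => abs_nonneg _) h (Summable.of_nat_of_neg ?_ ?_)
  · simpa using h1
  · simpa using h1

lemma gridMatrix_zero (k : ℝ → ℝ) (x : ℕ → ℝ) (n : ℕ) :
    gridMatrix k 0 x n = toeplitz n (latticeSeq k) := by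
  ext i j
  simp [gridMatrix, toeplitz, latticeSeq, obsPoint]

/-- For `q ≠ 0` the factor `(x i - x i) ^ q` removes the diagonal, so the value of the derivative at
`0`, which may be a default value, can be replaced by zero in the sequence. -/
lemma jetMatrix_at_zero {q : ℕ} (hq : q ≠ 0) (k : ℝ → ℝ) (n : ℕ) (x : ℕ → ℝ) :
    jetMatrix q (iteratedDeriv q k) n x 0 = perturbMatrix q x (toeplitz n (latticeDerivSeq q k)) := by
  ext i j
  by_cases hij : i = j
  · subst hij
    simp [jetMatrix, perturbMatrix, hq]
  · have : ((i : ℕ) : ℤ) - ((j : ℕ) : ℤ) ≠ 0 := fun h => hij (Fin.ext (by omega))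
    simp [jetMatrix, perturbMatrix, toeplitz, latticeDerivSeq, obsPoint, this]

lemma toeplitz_latticeDerivSeq_diag (q : ℕ) (k : ℝ → ℝ) (n : ℕ) (i : Fin n) :
    toeplitz n (latticeDerivSeq q k) i i = 0 := by
  simp [toeplitz, latticeDerivSeq]

variable {k : ℝ → ℝ}

lemma latticeSeq_neg (hk : ∀ t, k (-t) = k t) (i : ℤ) : latticeSeq k (-i) = latticeSeq k i := by
  simp [latticeSeq, hk]

lemma latticeDerivSeq_neg (hk : ∀ t, k (-t) = k t) (q : ℕ) (i : ℤ) :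
    latticeDerivSeq q k (-i) = (-1) ^ q * latticeDerivSeq q k i := by
  have h := iteratedDeriv_comp_neg q k (i : ℝ)
  simp only [hk, smul_eq_mul] at h
  by_cases hi : i = 0
  · simp [latticeDerivSeq, hi]
  · rw [latticeDerivSeq, latticeDerivSeq, if_neg hi, if_neg (neg_ne_zero.mpr hi), h, ← mul_assoc,
      ← mul_pow]
    simp

lemma realSymbol_toeplitz {s : ℤ → ℝ} (hs : Summable fun k => |s k|) (he : ∀ k, s (-k) = s k) :
    RealSymbol (fun n => toeplitz n s) fun x => (seqFourier s x).re :=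
  (hasSymbol_toeplitz hs).congr (seqFourier_eq_ofReal_of_even he)

lemma imagSymbol_toeplitz {s : ℤ → ℝ} (hs : Summable fun k => |s k|) (ho : ∀ k, s (-k) = -s k) :
    ImagSymbol (fun n => toeplitz n s) fun x => (seqFourier s x).im :=
  (hasSymbol_toeplitz hs).congr (seqFourier_eq_I_mul_of_odd ho)

lemma periodic_re_seqFourier (s : ℤ → ℝ) :
    Function.Periodic (fun x => (seqFourier s x).re) (2 * Real.pi) := fun x => by
  simp only [seqFourier_add_two_pi]

lemma periodic_im_seqFourier (s : ℤ → ℝ) :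
    Function.Periodic (fun x => (seqFourier s x).im) (2 * Real.pi) := fun x => by
  simp only [seqFourier_add_two_pi]

end LatticeSequences

/-! ### The covariance model on the regular grid -/

section Model

variable {θinf θsup θ₀ : ℝ} {K : ℝ → ℝ → ℝ}

lemma CovarianceModel.dTheta_neg (hK : CovarianceModel θinf θsup K) (hθ : θ₀ ∈ Icc θinf θsup)
    (t : ℝ) : dTheta θinf θsup K θ₀ (-t) = dTheta θinf θsup K θ₀ t :=
  derivWithin_congr (fun s hs => (hK.stationary s hs).1 t) ((hK.stationary θ₀ hθ).1 t)

lemma symbolPair_of_covarianceModel (hK : CovarianceModel θinf θsup K) (hθ : θ₀ ∈ Icc θinf θsup)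
    (hE : ExponentialDecay θinf θsup K θ₀) :
    SymbolPair (fun n => toeplitz n (latticeSeq (K θ₀)))
      (fun n => toeplitz n (latticeSeq (dTheta θinf θsup K θ₀))) (specF K θ₀)
      (specFθ θinf θsup K θ₀) := by
  obtain ⟨C, a, ha, h⟩ := hE.bound
  have s0 := summable_abs_of_le_exp ha fun i => (h i).1
  have s1 := summable_abs_of_le_exp ha fun i => (h i).2.1
  -- The uniform lower bound for `b = 0` applies to the Toeplitz matrices themselves and then bounds
  -- the spectral density from below.
  obtain ⟨δ, D, hG⟩ := CovarianceModel.exists_gridBounds hK hθ (b := 0) (by norm_num)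
  have hc : ∀ n, Coercive δ (toeplitz n (latticeSeq (K θ₀))) := fun n => by
    rw [← gridMatrix_zero (K θ₀) (fun _ => 0) n]
    exact hG.coercive 0 (by simp) _ (fun i => by simp) n
  exact {
    left := realSymbol_toeplitz s0 (latticeSeq_neg (hK.stationary θ₀ hθ).1)
    right := realSymbol_toeplitz s1 (latticeSeq_neg (CovarianceModel.dTheta_neg hK hθ))
    pos := fun x => hG.pos.trans_le (le_re_seqFourier_of_coercive s0 hc x)
    periodic_left := periodic_re_seqFourier _
    periodic_right := periodic_re_seqFourier _
    coercive := ⟨δ, hG.pos, hc⟩ }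

end Model

/-! ### Moments of the uniform law -/

section UniformLaw

variable {Ω : Type*} [MeasurableSpace Ω] {P : Measure Ω} {X : ℕ → Ω → ℝ}

lemma integral_comp_of_isUniform {Y : Ω → ℝ} (hY : Measurable Y)
    (hu : pdf.IsUniform Y (Icc (-1 : ℝ) 1) P volume) {φ : ℝ → ℝ} (hφ : Continuous φ) :
    ∫ ω, φ (Y ω) ∂P = (1 / 2) * ∫ x in (-1 : ℝ)..1, φ x := by
  rw [← integral_map hY.aemeasurable hφ.aestronglyMeasurable, hu, ProbabilityTheory.cond,
    integral_smul_measure, intervalIntegral.integral_of_le (by norm_num),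
    ← integral_Icc_eq_integral_Ioc, Real.volume_Icc, smul_eq_mul]
  congr 1
  norm_num

lemma ae_admissible_of_isUniform (hXm : ∀ i, Measurable (X i))
    (hXu : ∀ i, pdf.IsUniform (X i) (Icc (-1 : ℝ) 1) P volume) :
    ∀ᵐ ω ∂P, Admissible fun i => X i ω := by
  refine ae_all_iff.mpr fun i => ?_
  have h : ∀ᵐ x ∂(P.map (X i)), x ∈ Icc (-1 : ℝ) 1 := by
    rw [hXu i]
    exact ae_cond_mem measurableSet_Icc
  filter_upwards [ae_of_ae_map (hXm i).aemeasurable h] with ω hω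
  exact abs_le.mpr hω

lemma secondMoments_of_isUniform [IsProbabilityMeasure P] (hXm : ∀ i, Measurable (X i))
    (hXi : iIndepFun X P) (hXu : ∀ i, pdf.IsUniform (X i) (Icc (-1 : ℝ) 1) P volume) :
    SecondMoments P X := fun i j => by
  refine ⟨Integrable.of_bound ((hXm i).mul (hXm j)).aestronglyMeasurable 1 ?_, ?_⟩
  · filter_upwards [ae_admissible_of_isUniform hXm hXu] with ω hω
    rw [norm_mul]
    exact mul_le_one₀ (hω i) (norm_nonneg _) (hω j)
  · split_ifs with hij
    · subst hij
      rw [integral_comp_of_isUniform (hXm i) (hXu i) (φ := fun x => x * x) (by fun_prop)]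
      simp only [← sq, integral_pow]
      norm_num
    · rw [(hXi.indepFun hij).integral_fun_mul_eq_mul_integral (hXm i).aestronglyMeasurable
        (hXm j).aestronglyMeasurable]
      have := integral_comp_of_isUniform (hXm i) (hXu i) (φ := fun x => x) continuous_id
      rw [this, integral_id]
      norm_num

end UniformLaw

/-! ### Consequences of smoothness away from the origin -/

section Smoothness

variable {k : ℝ → ℝ} {b : ℝ}

lemma measurable_of_differentiableAt_ne_zero (h : ∀ t, t ≠ 0 → DifferentiableAt ℝ k t) :
    Measurable k :=
  measurable_of_continuousOn_compl_singleton 0 fun t ht => (h t ht).continuousAt.continuousWithinAt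

lemma measurable_iteratedDeriv (hk : Measurable k) (q : ℕ) : Measurable (iteratedDeriv q k) := by
  cases q with
  | zero => rwa [iteratedDeriv_zero]
  | succ q => rw [iteratedDeriv_succ]; exact measurable_deriv _

lemma uniformJet_iteratedDeriv (hb : b < 1 / 2)
    (hd : ∀ q < 3, ∀ t, t ≠ 0 → DifferentiableAt ℝ (iteratedDeriv q k) t) {C : ℝ} (hC : 0 ≤ C)
    (hbd : ∀ q ≤ 3, ∀ t, 1 - 2 * b ≤ |t| → |iteratedDeriv q k t| ≤ C / (1 + |t| ^ 2))
    (h0 : |k 0| ≤ C) {q : ℕ} (hq : q ≤ 1) :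
    UniformJet b (jetMatrix q (iteratedDeriv q k)) (jetMatrix (q + 1) (iteratedDeriv (q + 1) k)) := by
  have key : ∀ q < 3, ∀ t, t ≠ 0 → HasDerivAt (iteratedDeriv q k) (iteratedDeriv (q + 1) k t) t := by
    intro q hq t ht
    rw [iteratedDeriv_succ]
    exact (hd q hq t ht).hasDerivAt
  refine uniformJet_jetMatrix hC hb (key q (by omega)) (key (q + 1) (by omega)) ?_
    fun t ht => ⟨hbd q (by omega) t ht, hbd (q + 1) (by omega) t ht, hbd (q + 1 + 1) (by omega) t ht⟩
  interval_cases q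
  · simpa using h0
  · simpa using hC

variable {θinf θsup θ₀ : ℝ} {K : ℝ → ℝ → ℝ}

lemma exists_iteratedDeriv_bound (hK : CovarianceModel θinf θsup K) (hθ : θ₀ ∈ Icc θinf θsup)
    (hS : SpatiallySmooth θinf θsup K) (hb : b < 1 / 2) :
    ∃ C, 0 ≤ C ∧ |K θ₀ 0| ≤ C ∧ |dTheta θinf θsup K θ₀ 0| ≤ C ∧
      ∀ q ≤ 3, ∀ t, 1 - 2 * b ≤ |t| → |iteratedDeriv q (K θ₀) t| ≤ C / (1 + |t| ^ 2) ∧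
        |iteratedDeriv q (dTheta θinf θsup K θ₀) t| ≤ C / (1 + |t| ^ 2) := by
  obtain ⟨C, hC, h0, h0'⟩ := CovarianceModel.exists_decay hK hθ
  -- Derivative bounds are needed only at the separation distance `1 - 2 * b`; order zero is covered
  -- by the global decay of the model.
  have hT : 0 < 1 - 2 * b := by linarith
  obtain ⟨C₁, h1⟩ := hS.bound _ hT θ₀ hθ 1 le_rfl (by norm_num)
  obtain ⟨C₂, h2⟩ := hS.bound _ hT θ₀ hθ 2 (by norm_num) (by norm_num)
  obtain ⟨C₃, h3⟩ := hS.bound _ hT θ₀ hθ 3 (by norm_num) le_rfl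
  set D := max (max C C₁) (max C₂ C₃)
  have m0 : C ≤ D := (le_max_left _ _).trans (le_max_left _ _)
  have m1 : C₁ ≤ D := (le_max_right _ _).trans (le_max_left _ _)
  have m2 : C₂ ≤ D := (le_max_left _ _).trans (le_max_right _ _)
  have m3 : C₃ ≤ D := (le_max_right _ _).trans (le_max_right _ _)
  have hm : ∀ {c : ℝ} (t : ℝ), c ≤ D → c / (1 + |t| ^ 2) ≤ D / (1 + |t| ^ 2) := fun t h => by gcongr
  refine ⟨D, hC.trans m0, ?_, ?_, fun q hq t ht => ?_⟩
  · simpa using (h0 0).trans (hm 0 m0)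
  · simpa using (h0' 0).trans (hm 0 m0)
  · interval_cases q
    · simp only [iteratedDeriv_zero]
      exact ⟨(h0 t).trans (hm t m0), (h0' t).trans (hm t m0)⟩
    · exact ⟨(h1 t ht).1.trans (hm t m1), (h1 t ht).2.trans (hm t m1)⟩
    · exact ⟨(h2 t ht).1.trans (hm t m2), (h2 t ht).2.trans (hm t m2)⟩
    · exact ⟨(h3 t ht).1.trans (hm t m3), (h3 t ht).2.trans (hm t m3)⟩

end Smoothness

/-! ### Jets of the limiting variance -/

section SecondOrderExpansion

lemma MeasurableEntries.matML {α : Type*} [MeasurableSpace α] {n : ℕ}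
    {A B : α → Matrix (Fin n) (Fin n) ℝ} (hA : MeasurableEntries A) (hB : MeasurableEntries B) :
    MeasurableEntries fun a => matML (A a) (B a) :=
  MeasurableEntries.smul (((hA.inv.mul hB).mul hA.inv).mul hB) _

open scoped Matrix.Norms.L2Operator

variable {Ω : Type*} [MeasurableSpace Ω] {P : Measure Ω} [IsProbabilityMeasure P] {X : ℕ → Ω → ℝ}
  {θinf θsup θ₀ b : ℝ} {K : ℝ → ℝ → ℝ}

lemma exists_uniformJet_matML (hK : CovarianceModel θinf θsup K) (hθ : θ₀ ∈ Icc θinf θsup)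
    (hS : SpatiallySmooth θinf θsup K) (hb : b < 1 / 2) :
    UniformJet b
      (fun n x s => matML (jetMatrix 0 (iteratedDeriv 0 (K θ₀)) n x s)
        (jetMatrix 0 (iteratedDeriv 0 (dTheta θinf θsup K θ₀)) n x s))
      (fun n x s => mlD₁ (jetMatrix 0 (iteratedDeriv 0 (K θ₀)) n x s)
        (jetMatrix 1 (iteratedDeriv 1 (K θ₀)) n x s)
        (jetMatrix 0 (iteratedDeriv 0 (dTheta θinf θsup K θ₀)) n x s)
        (jetMatrix 1 (iteratedDeriv 1 (dTheta θinf θsup K θ₀)) n x s)) ∧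
    UniformJet b
      (fun n x s => mlD₁ (jetMatrix 0 (iteratedDeriv 0 (K θ₀)) n x s)
        (jetMatrix 1 (iteratedDeriv 1 (K θ₀)) n x s)
        (jetMatrix 0 (iteratedDeriv 0 (dTheta θinf θsup K θ₀)) n x s)
        (jetMatrix 1 (iteratedDeriv 1 (dTheta θinf θsup K θ₀)) n x s))
      (fun n x s => mlD₂ (jetMatrix 0 (iteratedDeriv 0 (K θ₀)) n x s)
        (jetMatrix 1 (iteratedDeriv 1 (K θ₀)) n x s) (jetMatrix 2 (iteratedDeriv 2 (K θ₀)) n x s)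
        (jetMatrix 0 (iteratedDeriv 0 (dTheta θinf θsup K θ₀)) n x s)
        (jetMatrix 1 (iteratedDeriv 1 (dTheta θinf θsup K θ₀)) n x s)
        (jetMatrix 2 (iteratedDeriv 2 (dTheta θinf θsup K θ₀)) n x s)) := by
  obtain ⟨C, hC, h0, h0', hbd⟩ := exists_iteratedDeriv_bound hK hθ hS hb
  obtain ⟨δ, D, hG⟩ := CovarianceModel.exists_gridBounds hK hθ hb
  have d1 : ∀ q < 3, ∀ t : ℝ, t ≠ 0 → DifferentiableAt ℝ (iteratedDeriv q (K θ₀)) t :=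
    fun q hq t ht => (hS.differentiable θ₀ hθ q hq t ht).1
  have d2 : ∀ q < 3, ∀ t : ℝ, t ≠ 0 →
      DifferentiableAt ℝ (iteratedDeriv q (dTheta θinf θsup K θ₀)) t :=
    fun q hq t ht => (hS.differentiable θ₀ hθ q hq t ht).2
  have b1 := fun q hq t ht => (hbd q hq t ht).1
  have b2 := fun q hq t ht => (hbd q hq t ht).2
  refine uniformJet_ml (by linarith)
    (uniformJet_iteratedDeriv hb d1 hC b1 h0 (q := 0) (by norm_num))
    (uniformJet_iteratedDeriv hb d1 hC b1 h0 (q := 1) le_rfl)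
    (uniformJet_iteratedDeriv hb d2 hC b2 h0' (q := 0) (by norm_num))
    (uniformJet_iteratedDeriv hb d2 hC b2 h0' (q := 1) le_rfl)
    ⟨δ⁻¹, fun n x hx s hs => ?_⟩
  rw [iteratedDeriv_zero, jetMatrix_zero]
  have := hG.coercive s hs x hx n
  exact ⟨this.isUnit_det hG.pos, this.norm_inv_le hG.pos⟩

/-- The almost sure limit of the normalised traces has two uniform first order jets, and the second
derivative at `0` is the limit of the expectations at the regular grid. -/
lemma exists_firstJet_of_isTraceLimit (hXm : ∀ i, Measurable (X i))
    (hXa : ∀ᵐ ω ∂P, Admissible fun i => X i ω) (hK : CovarianceModel θinf θsup K)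
    (hθ : θ₀ ∈ Icc θinf θsup) (hS : SpatiallySmooth θinf θsup K) (hb0 : 0 < b) (hb : b < 1 / 2)
    {σ : ℝ → ℝ} (hσ : ∀ s ∈ Icc 0 b, IsTraceLimit P X θinf θsup K θ₀ matML s (σ s)) {e : ℕ → ℝ}
    {L : ℝ} (he : ∀ n, HasExpectation P (fun ω =>
      (mlD₂ (toeplitz n (latticeSeq (K θ₀)))
        (perturbMatrix 1 (fun i => X i ω) (toeplitz n (latticeDerivSeq 1 (K θ₀))))
        (perturbMatrix 2 (fun i => X i ω) (toeplitz n (latticeDerivSeq 2 (K θ₀))))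
        (toeplitz n (latticeSeq (dTheta θinf θsup K θ₀)))
        (perturbMatrix 1 (fun i => X i ω)
          (toeplitz n (latticeDerivSeq 1 (dTheta θinf θsup K θ₀))))
        (perturbMatrix 2 (fun i => X i ω)
          (toeplitz n (latticeDerivSeq 2 (dTheta θinf θsup K θ₀))))).trace) (e n))
    (hL : Tendsto (fun n : ℕ => (1 / (n : ℝ)) * e n) atTop (𝓝 L)) :
    ∃ σ₁ σ₂ C D, FirstJet (Icc 0 b) C σ σ₁ ∧ FirstJet (Icc 0 b) D σ₁ σ₂ ∧ σ₂ 0 = L := by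
  obtain ⟨j0, j1⟩ := exists_uniformJet_matML hK hθ hS hb
  obtain ⟨C, hC⟩ := j0.trace
  obtain ⟨D, hD⟩ := j1.trace
  have hk := measurable_of_differentiableAt_ne_zero (k := K θ₀) fun t ht => by
    simpa using (hS.differentiable θ₀ hθ 0 (by norm_num) t ht).1
  have hk' := measurable_of_differentiableAt_ne_zero (k := dTheta θinf θsup K θ₀) fun t ht => by
    simpa using (hS.differentiable θ₀ hθ 0 (by norm_num) t ht).2
  have hJ := fun q n s => measurableEntries_jetMatrix (measurable_iteratedDeriv hk q) q n s
  have hJ' := fun q n s => measurableEntries_jetMatrix (measurable_iteratedDeriv hk' q) q n s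
  have hXp : Measurable fun ω i => X i ω := measurable_pi_lambda _ hXm
  have hmeas : ∀ {n : ℕ} {A : (ℕ → ℝ) → Matrix (Fin n) (Fin n) ℝ}, MeasurableEntries A →
      AEStronglyMeasurable (fun ω => (1 / (n : ℝ)) * (A fun i => X i ω).trace) P := fun hA =>
    ((hA.trace.comp hXp).const_mul _).aestronglyMeasurable
  have m0 := fun n s => hmeas ((hJ 0 n s).matML (hJ' 0 n s))
  have m1 := fun n s => hmeas ((hJ 0 n s).mlD₁ (hJ 1 n s) (hJ' 0 n s) (hJ' 1 n s))
  have m2 := fun n s => hmeas ((hJ 0 n s).mlD₂ (hJ 1 n s) (hJ 2 n s) (hJ' 0 n s) (hJ' 1 n s)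
    (hJ' 2 n s))
  -- Expectations are taken at fixed `n`: they turn random jets into deterministic ones with the
  -- same constants.
  have f0 := fun n => FirstJet.integral (P := P)
    (hXa.mono fun ω hω => hC n (fun i => X i ω) hω) (m0 n) (m1 n)
  have f1 := fun n => FirstJet.integral (P := P)
    (hXa.mono fun ω hω => hD n (fun i => X i ω) hω) (m1 n) (m2 n)
  -- The limit is a constant and the traces are bounded by `C`, so dominated convergence identifies
  -- it as the limit of the expectations.
  obtain ⟨σ₁, t1, g1⟩ := FirstJet.exists_limit hb0 f0 (σ := σ) fun s hs => by
    have h := tendsto_integral_of_dominated_convergence (μ := P) (fun _ => C) (m0 · s)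
      (integrable_const C)
      (fun n => hXa.mono fun ω hω => (hC n (fun i => X i ω) hω).bound s hs) (f := fun _ => σ s)
      ((hσ s hs).mono fun ω hω => by
        refine hω.congr fun n => ?_
        simp only [iteratedDeriv_zero, jetMatrix_zero])
    rwa [integral_const, probReal_univ, one_smul] at h
  obtain ⟨σ₂, t2, g2⟩ := FirstJet.exists_limit hb0 f1 t1
  -- The second candidate derivative at `0` is by construction the limit of the normalised expected
  -- second derivatives, as is `L`.
  refine ⟨σ₁, σ₂, C, D, g1, g2, tendsto_nhds_unique (t2 0 (left_mem_Icc.mpr hb0.le)) ?_⟩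
  refine hL.congr fun n => ?_
  rw [← (he n).2, ← integral_const_mul]
  refine integral_congr_ae (Eventually.of_forall fun ω => ?_)
  simp only [iteratedDeriv_zero, jetMatrix_zero, gridMatrix_zero]
  rw [jetMatrix_at_zero one_ne_zero, jetMatrix_at_zero one_ne_zero,
    jetMatrix_at_zero two_ne_zero, jetMatrix_at_zero two_ne_zero]

end SecondOrderExpansion

end SpatialSampling

/-! ### Proof of the theorem -/

theorem mainTheorem11 {Ω : Type*} [MeasurableSpace Ω] (P : Measure Ω) [IsProbabilityMeasure P]
    (X : ℕ → Ω → ℝ) (hXm : ∀ i, Measurable (X i)) (hXi : iIndepFun X P)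
    (hXu : ∀ i, pdf.IsUniform (X i) (Icc (-1 : ℝ) 1) P volume)
    (θinf θsup θ₀ : ℝ) (hθ : θ₀ ∈ Ioo θinf θsup) (K : ℝ → ℝ → ℝ)
    (hK : CovarianceModel θinf θsup K) (hE : ExponentialDecay θinf θsup K θ₀)
    (f fθ ft ftθ ftt fttθ : ℝ → ℝ)
    (hf : f = specF K θ₀) (hfθ : fθ = specFθ θinf θsup K θ₀)
    (hft : ft = specFt K θ₀) (hftθ : ftθ = specFtθ θinf θsup K θ₀)
    (hftt : ftt = specFtt K θ₀) (hfttθ : fttθ = specFttθ θinf θsup K θ₀) :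
    IsTraceLimit P X θinf θsup K θ₀ matML 0
      ((1 / 2) * meanVal (fun x => fθ x ^ 2 / f x ^ 2)) ∧
    IsTraceLimit P X θinf θsup K θ₀ matCV1 0
      (8 * meanVal (fun x => 1 / f x) ^ (-6 : ℤ) * meanVal (fun x => fθ x / f x ^ 2) ^ 2 *
          meanVal (fun x => 1 / f x ^ 2)
        + 8 * meanVal (fun x => 1 / f x) ^ (-4 : ℤ) * meanVal (fun x => fθ x ^ 2 / f x ^ 4)
        - 16 * meanVal (fun x => 1 / f x) ^ (-5 : ℤ) * meanVal (fun x => fθ x / f x ^ 2) *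
          meanVal (fun x => fθ x / f x ^ 3)) ∧
    IsTraceLimit P X θinf θsup K θ₀ matCV2 0
      (2 * meanVal (fun x => 1 / f x) ^ (-3 : ℤ) *
        (meanVal (fun x => fθ x ^ 2 / f x ^ 3) * meanVal (fun x => 1 / f x)
          - meanVal (fun x => fθ x / f x ^ 2) ^ 2)) ∧
    (SpatiallySmooth θinf θsup K →
      ∃ sigmaML : ℝ → ℝ,
        (∀ ε ∈ Ico (0 : ℝ) (1 / 2), IsTraceLimit P X θinf θsup K θ₀ matML ε (sigmaML ε)) ∧
        DifferentiableOn ℝ sigmaML (Ico (0 : ℝ) (1 / 2)) ∧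
        HasDerivWithinAt (derivWithin sigmaML (Ico (0 : ℝ) (1 / 2)))
          ((2 / 3) * meanVal (fun x => fθ x / f x ^ 2) *
              meanVal (fun x => ft x ^ 2 * fθ x / f x ^ 2)
            - (4 / 3) * meanVal (fun x => 1 / f x) *
              meanVal (fun x => ftθ x * ft x * fθ x / f x ^ 2)
            - (4 / 3) * meanVal (fun x => fθ x / f x ^ 2) *
              meanVal (fun x => ftθ x * ft x / f x)
            + (2 / 3) * meanVal (fun x => 1 / f x) *
              meanVal (fun x => ft x ^ 2 * fθ x ^ 2 / f x ^ 3)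
            + (2 / 3) * meanVal (fun x => fθ x ^ 2 / f x ^ 3) *
              meanVal (fun x => ft x ^ 2 / f x)
            - (2 / 3) * meanVal (fun x => ftt x * fθ x ^ 2 / f x ^ 3)
            + (2 / 3) * meanVal (fun x => 1 / f x) * meanVal (fun x => ftθ x ^ 2 / f x)
            + (2 / 3) * meanVal (fun x => fttθ x * fθ x / f x ^ 2))
          (Ico (0 : ℝ) (1 / 2)) 0) := by
  subst hf hfθ hft hftθ hftt hfttθ
  have hθ' := Ioo_subset_Icc_self hθ
  have hpair := SpatialSampling.symbolPair_of_covarianceModel hK hθ' hE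
  refine ⟨Eventually.of_forall fun ω => ?_, Eventually.of_forall fun ω => ?_,
    Eventually.of_forall fun ω => ?_, fun hS => ?_⟩
  -- For `ε = 0` the matrices do not depend on the sample point, so the limit holds everywhere.
  · simpa only [SpatialSampling.gridMatrix_zero] using hpair.tendsto_matML
  · simpa only [SpatialSampling.gridMatrix_zero] using hpair.tendsto_matCV1
  · simpa only [SpatialSampling.gridMatrix_zero] using hpair.tendsto_matCV2
  have hXa := SpatialSampling.ae_admissible_of_isUniform hXm hXu
  have hX := SpatialSampling.secondMoments_of_isUniform hXm hXi hXu
  have hk : Measurable (K θ₀) := SpatialSampling.measurable_of_differentiableAt_ne_zero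
    fun t ht => by simpa using (hS.differentiable θ₀ hθ' 0 (by norm_num) t ht).1
  have hk' : Measurable (dTheta θinf θsup K θ₀) :=
    SpatialSampling.measurable_of_differentiableAt_ne_zero
      fun t ht => by simpa using (hS.differentiable θ₀ hθ' 0 (by norm_num) t ht).2
  -- The limit is chosen for every real `ε` to obtain a total function; outside the interval its
  -- value is irrelevant. Inside, the uniform bounds are taken with `b = ε`.
  have hlim : ∀ ε, ∃ σ, ε ∈ Ico (0 : ℝ) (1 / 2) →
      IsTraceLimit P X θinf θsup K θ₀ matML ε σ := fun ε => by
    by_cases hε : ε ∈ Ico (0 : ℝ) (1 / 2)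
    · obtain ⟨δ, C, hG⟩ := SpatialSampling.CovarianceModel.exists_gridBounds hK hθ' hε.2
      obtain ⟨σ, hσ⟩ := hG.exists_ae_tendsto hk hk' hXm hXi
        (fun i => (hXu i).trans (hXu 0).symm) hXa (right_mem_Icc.mpr hε.1)
      exact ⟨σ, fun _ => hσ⟩
    · exact ⟨0, fun h => absurd h hε⟩
  choose sigmaML hsigma using hlim
  obtain ⟨C, a, ha, hbd⟩ := hE.bound
  have ek := (hK.stationary θ₀ hθ').1
  have ek' := SpatialSampling.CovarianceModel.dTheta_neg hK hθ'
  have odd : ∀ {k : ℝ → ℝ}, (∀ t, k (-t) = k t) →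
      ∀ i, latticeDerivSeq 1 k (-i) = -latticeDerivSeq 1 k i := fun hk i => by
    rw [SpatialSampling.latticeDerivSeq_neg hk, pow_one, neg_one_mul]
  have even : ∀ {k : ℝ → ℝ}, (∀ t, k (-t) = k t) →
      ∀ i, latticeDerivSeq 2 k (-i) = latticeDerivSeq 2 k i := fun hk i => by
    rw [SpatialSampling.latticeDerivSeq_neg hk, neg_one_sq, one_mul]
  obtain ⟨e, he, hL⟩ := hpair.exists_tendsto_expectation hX
    (SpatialSampling.imagSymbol_toeplitz
      (SpatialSampling.summable_abs_of_le_exp ha fun i => (hbd i).2.2.1) (odd ek))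
    (SpatialSampling.imagSymbol_toeplitz
      (SpatialSampling.summable_abs_of_le_exp ha fun i => (hbd i).2.2.2.1) (odd ek'))
    (SpatialSampling.realSymbol_toeplitz
      (SpatialSampling.summable_abs_of_le_exp ha fun i => (hbd i).2.2.2.2.1) (even ek))
    (SpatialSampling.realSymbol_toeplitz
      (SpatialSampling.summable_abs_of_le_exp ha fun i => (hbd i).2.2.2.2.2) (even ek'))
    (SpatialSampling.toeplitz_latticeDerivSeq_diag 2 _)
    (SpatialSampling.toeplitz_latticeDerivSeq_diag 2 _)
    (SpatialSampling.periodic_im_seqFourier _) (SpatialSampling.periodic_im_seqFourier _)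
    (SpatialSampling.periodic_re_seqFourier _) (SpatialSampling.periodic_re_seqFourier _)
    (fun x => by rw [SpatialSampling.seqFourier_neg_of_odd (odd ek), Complex.neg_im])
    (fun x => by rw [SpatialSampling.seqFourier_neg_of_odd (odd ek'), Complex.neg_im])
    (fun x => by
      rw [specF, specF, SpatialSampling.seqFourier_neg_of_even (SpatialSampling.latticeSeq_neg ek)])
    (fun x => by
      rw [specFθ, specFθ,
        SpatialSampling.seqFourier_neg_of_even (SpatialSampling.latticeSeq_neg ek')])
  exact ⟨sigmaML, hsigma,
    SpatialSampling.differentiableOn_and_hasDerivWithinAt_of_firstJet (by norm_num)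
      fun b hb0 hb => SpatialSampling.exists_firstJet_of_isTraceLimit hXm hXa hK hθ' hS hb0 hb
        (fun s hs => hsigma s ⟨hs.1, hs.2.trans_lt hb⟩) he hL⟩
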